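/- Let $N\ge 2$. Let $A=C(U_N^+)$ be the universal unital $C^*$-algebra generated by the entries of an $N\times N$ matrix $u=(u_{ij})$ subject to the relations $uu^*=u^*u=1$ and $u^t\bar u=\bar uu^t=1$, where $\bar u=(u_{ij}^*)$. It is a Woronowicz algebra, with comultiplication $\Delta:A\to A\otimes_{\max}A$, counit $\varepsilon:A\to\mathbb C$ and antipode $S:A\to A^{opp}$ given by $$\Delta(u_{ij})=\sum_ku_{ik}\otimes u_{kj},\qquad \varepsilon(u_{ij})=\delta_{ij},\qquad S(u_{ij})=u_{ji}^*.$$ Let $\mathcal A\subset A$ be the $*$-algebra generated by the $u_{ij}$. A representation of $U_N^+$ is a unitary matrix $v\in M_n(\mathcal A)$ with $\Delta(v_{ij})=\sum_kv_{ik}\otimes v_{kj}$, $\varepsilon(v_{ij})=\delta_{ij}$, $S(v_{ij})=v_{ji}^*$. We set $Hom(v,w)=\{T\in M_{m\times n}(\mathbb C)\mid Tv=wT\}$ for $v\in M_n(\mathcal A)$, $w\in M_m(\mathcal A)$, write $v\sim w$ when $Hom(v,w)$ contains an invertible matrix, and call $v$ irreducible when $n\ge 1$ and $Hom(v,v)=\mathbb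 C1$. Moreover $\bar v=(v_{ij}^*)$, $(v\otimes w)_{ia,jb}=v_{ij}w_{ab}$, and sums are block-diagonal sums. A Haar integration is a continuous linear form $\int:A\to\mathbb C$ which is positive, unital, tracial, and satisfies $(\int\otimes id)\Delta=(id\otimes\int)\Delta=\int(\cdot)1$. Let $W$ be the set of colored integers, that is, of finite words in the letters $\circ,\bullet$, with empty word $e$. For $k\in W$ let $\bar k$ be obtained by reversing the word $k$ and switching the colors, and let $\mathcal{NC}_2(k)$ be the set of noncrossing pairings of the letters of $k$ such that each string joins a $\circ$ to a $\bullet$. For $a\in A$ define $a^k$ by $a^e=1$, $a^\circ=a$, $a^\bullet=a^*$ and multiplicativity. Then: 1. There is a unique Haar integration $\int$ on $A$, and with respect to it the main character $\chi=\sum_iu_{ii}$ follows the Voiculescu circular law $\Gamma_1$, in the sense that $\int\chi^k=|\mathcal{NC}_2(k)|$ for every $k\in W$. 2. There are irreducible representations $r_k$, $k\in W$, such that each irreducible representation of $U_N^+$ is equivalent to $r_k$ for exactly one $k\in W$, and such that, up to equivalence, $$r_e=1,\qquad r_\circ=u,\qquad r_\bullet=\bar u,\qquad \bar r_k=r_{\bar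 k}\quad(k\in W),$$ $$r_k\otimes r_l=\sum_{k=xy,\ l=\bar yz}r_{xz}\quad(k,l\in W),$$ the sum being over all triples $(x,y,z)\in W^3$ with $k=xy$ and $l=\bar yz$. -/

import Mathlib

universe u v
noncomputable section

/-- A C*-seminorm on a unital complex *-algebra. -/
structure CStarSeminorm (P : Type u) [Ring P] [StarRing P] [Algebra ℂ P] [StarModule ℂ P]
    extends Seminorm ℂ P where
  mul_le' : ∀ a b : P, toFun (a * b) ≤ toFun a * toFun b
  star_mul_self' : ∀ a : P, toFun (star a * a) = toFun a * toFun a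

namespace CStarSeminorm

variable {P : Type u} [Ring P] [StarRing P] [Algebra ℂ P] [StarModule ℂ P]

instance : CoeFun (CStarSeminorm P) (fun _ => P → ℝ) := ⟨fun p => p.toFun⟩

theorem nonneg (p : CStarSeminorm P) (a : P) : 0 ≤ p a := apply_nonneg p.toSeminorm a

theorem le_star (p : CStarSeminorm P) (a : P) : p a ≤ p (star a) := by
  rcases (p.nonneg a).eq_or_lt with h | h
  · rw [← h]; exact p.nonneg _
  · have h1 := p.mul_le' (star a) a
    rw [p.star_mul_self'] at h1
    exact le_of_mul_le_mul_right h1 h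

theorem map_star (p : CStarSeminorm P) (a : P) : p (star a) = p a :=
  le_antisymm (by simpa using p.le_star (star a)) (p.le_star a)

/-- A copy of the algebra `P`, topologized by the C*-seminorm `p`. -/
def Dom (_p : CStarSeminorm P) : Type u := P

instance (p : CStarSeminorm P) : Ring p.Dom := inferInstanceAs (Ring P)
instance (p : CStarSeminorm P) : StarRing p.Dom := inferInstanceAs (StarRing P)
instance (p : CStarSeminorm P) : Algebra ℂ p.Dom := inferInstanceAs (Algebra ℂ P)
instance (p : CStarSeminorm P) : StarModule ℂ p.Dom := inferInstanceAs (StarModule ℂ P)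

instance (p : CStarSeminorm P) : SeminormedRing p.Dom where
  __ := (inferInstance : Ring p.Dom)
  __ := AddGroupSeminorm.toSeminormedAddCommGroup (E := P) p.toAddGroupSeminorm
  norm_mul_le := p.mul_le'

theorem norm_def (p : CStarSeminorm P) (a : p.Dom) : ‖a‖ = p a := rfl

instance (p : CStarSeminorm P) : NormedAlgebra ℂ p.Dom where
  norm_smul_le c a := le_of_eq (p.smul' c a)

instance (p : CStarSeminorm P) : NormedStarGroup p.Dom where
  norm_star_le a := le_of_eq (p.map_star a)

/-- The completion of `P` with respect to the C*-seminorm `p` (elements of zero seminorm become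
zero). -/
def Completion (p : CStarSeminorm P) : Type u := UniformSpace.Completion p.Dom

instance (p : CStarSeminorm P) : NormedRing p.Completion :=
  inferInstanceAs (NormedRing (UniformSpace.Completion p.Dom))
instance (p : CStarSeminorm P) : CompleteSpace p.Completion :=
  inferInstanceAs (CompleteSpace (UniformSpace.Completion p.Dom))
instance (p : CStarSeminorm P) : Algebra ℂ p.Completion :=
  inferInstanceAs (Algebra ℂ (UniformSpace.Completion p.Dom))
instance (p : CStarSeminorm P) : NormedAlgebra ℂ p.Completion where
  norm_smul_le := norm_smul_le (α := ℂ) (β := UniformSpace.Completion p.Dom)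

/-- The canonical map of `P` into its completion. -/
def toCompl (p : CStarSeminorm P) : P →ₐ[ℂ] p.Completion where
  toFun a := UniformSpace.Completion.coe' (α := p.Dom) a
  map_one' := UniformSpace.Completion.coe_one p.Dom
  map_mul' a b := UniformSpace.Completion.coe_mul (α := p.Dom) a b
  map_zero' := UniformSpace.Completion.coe_zero (α := p.Dom)
  map_add' a b := UniformSpace.Completion.coe_add (α := p.Dom) a b
  commutes' _ := rfl

theorem norm_toCompl (p : CStarSeminorm P) (a : P) : ‖p.toCompl a‖ = p a :=
  UniformSpace.Completion.norm_coe (E := p.Dom) a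

theorem denseRange_toCompl (p : CStarSeminorm P) : DenseRange p.toCompl :=
  UniformSpace.Completion.denseRange_coe (α := p.Dom)

instance (p : CStarSeminorm P) : Star p.Completion where
  star := UniformSpace.Completion.map (fun a : p.Dom => star a)

instance (p : CStarSeminorm P) : ContinuousStar p.Completion where
  continuous_star := UniformSpace.Completion.continuous_map

theorem star_toCompl (p : CStarSeminorm P) (a : P) :
    star (p.toCompl a) = p.toCompl (star a) :=
  UniformSpace.Completion.map_coe (α := p.Dom) (star_isometry (E := p.Dom)).uniformContinuous a

theorem induction (p : CStarSeminorm P) {Q : p.Completion → Prop}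
    (hc : IsClosed {x | Q x}) (h : ∀ a : P, Q (p.toCompl a)) (a : p.Completion) : Q a :=
  p.denseRange_toCompl.induction_on a hc h

instance (p : CStarSeminorm P) : StarRing p.Completion where
  star_involutive := by
    refine p.induction (Q := fun a => star (star a) = a)
      (isClosed_eq (by fun_prop) (by fun_prop)) fun a => ?_
    rw [star_toCompl, star_toCompl, star_star]
  star_mul a := by
    revert a
    refine p.induction (Q := fun a => ∀ b, star (a * b) = star b * star a) ?_ fun a => ?_
    · rw [Set.ofPred_forall]
      exact isClosed_iInter fun b => isClosed_eq (by fun_prop) (by fun_prop)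
    refine p.induction (isClosed_eq (by fun_prop) (by fun_prop)) fun b => ?_
    rw [← map_mul, star_toCompl, star_toCompl, star_toCompl, star_mul, map_mul]
  star_add a := by
    revert a
    refine p.induction (Q := fun a => ∀ b, star (a + b) = star a + star b) ?_ fun a => ?_
    · rw [Set.ofPred_forall]
      exact isClosed_iInter fun b => isClosed_eq (by fun_prop) (by fun_prop)
    refine p.induction (isClosed_eq (by fun_prop) (by fun_prop)) fun b => ?_
    rw [← map_add, star_toCompl, star_toCompl, star_toCompl, star_add, map_add]

instance (p : CStarSeminorm P) : CStarRing p.Completion where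
  norm_mul_self_le := by
    refine p.induction (Q := fun a => ‖a‖ * ‖a‖ ≤ ‖star a * a‖)
      (isClosed_le (by fun_prop) (by fun_prop)) fun a => ?_
    rw [star_toCompl, ← map_mul, norm_toCompl, norm_toCompl]
    exact (p.star_mul_self' a).ge

instance (p : CStarSeminorm P) : StarModule ℂ p.Completion where
  star_smul c := by
    have h1 : Continuous fun a : p.Completion => c • a := continuous_const_smul c
    have h2 : Continuous fun a : p.Completion => star c • a := continuous_const_smul (star c)
    refine p.induction (Q := fun a : p.Completion => star (c • a) = star c • star a)
      (isClosed_eq (continuous_star.comp h1) (h2.comp continuous_star)) fun a => ?_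
    have e : ∀ (c : ℂ) (a : P), c • p.toCompl a = p.toCompl (c • a) :=
      fun c a => (map_smul p.toCompl c a).symm
    rw [e, star_toCompl, star_toCompl, star_smul, e]

instance (p : CStarSeminorm P) : CStarAlgebra p.Completion where

/-- The canonical map of `P` into its completion, as a morphism of *-algebras. -/
def ofAlg (p : CStarSeminorm P) : P →⋆ₐ[ℂ] p.Completion where
  __ := p.toCompl
  map_star' a := (p.star_toCompl a).symm

theorem norm_ofAlg (p : CStarSeminorm P) (a : P) : ‖p.ofAlg a‖ = p a := p.norm_toCompl a

theorem denseRange_ofAlg (p : CStarSeminorm P) : DenseRange p.ofAlg := p.denseRange_toCompl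

theorem algHom_ext (p : CStarSeminorm P) {B : Type v} [CStarAlgebra B]
    {f g : p.Completion →⋆ₐ[ℂ] B} (h : ∀ a, f (p.ofAlg a) = g (p.ofAlg a)) : f = g := by
  have hf : Continuous f := AddMonoidHomClass.continuous_of_bound f 1 fun a => by
    rw [one_mul]; exact NonUnitalStarAlgHom.norm_apply_le f a
  have hg : Continuous g := AddMonoidHomClass.continuous_of_bound g 1 fun a => by
    rw [one_mul]; exact NonUnitalStarAlgHom.norm_apply_le g a
  exact DFunLike.ext _ _ (p.induction (isClosed_eq hf hg) h)

/-- The C*-seminorm given by a morphism into a C*-algebra. -/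
def comap {B : Type v} [CStarAlgebra B] (f : P →⋆ₐ[ℂ] B) : CStarSeminorm P where
  toFun a := ‖f a‖
  map_zero' := by simp
  add_le' a b := by rw [map_add]; exact norm_add_le _ _
  neg' a := by rw [map_neg, norm_neg]
  smul' c a := by rw [map_smul, norm_smul]
  mul_le' a b := by rw [map_mul]; exact norm_mul_le _ _
  star_mul_self' a := by
    rw [map_mul, StarHomClass.map_star, CStarRing.norm_star_mul_self]

theorem continuous_of_le (p : CStarSeminorm P) {B : Type v} [CStarAlgebra B] (f : P →⋆ₐ[ℂ] B)
    (hf : ∀ a, ‖f a‖ ≤ p a) : Continuous (fun a : p.Dom => f a) :=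
  AddMonoidHomClass.continuous_of_bound (E := p.Dom) (f : P →+* B) 1 fun a => by
    rw [one_mul]; exact hf a

/-- A morphism into a C*-algebra which is bounded by `p` extends to the completion. -/
def extend (p : CStarSeminorm P) {B : Type v} [CStarAlgebra B] (f : P →⋆ₐ[ℂ] B)
    (hf : ∀ a, ‖f a‖ ≤ p a) : p.Completion →⋆ₐ[ℂ] B :=
  let g : p.Completion →+* B :=
    UniformSpace.Completion.extensionHom (α := p.Dom) (f : P →+* B) (p.continuous_of_le f hf)
  have hg : ∀ a : P, g (p.toCompl a) = f a := fun a =>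
    UniformSpace.Completion.extensionHom_coe (α := p.Dom) (f : P →+* B) (p.continuous_of_le f hf) a
  have hc : Continuous g := UniformSpace.Completion.continuous_extension (α := p.Dom)
  { toRingHom := g
    commutes' := fun c => (hg (algebraMap ℂ P c)).trans (AlgHomClass.commutes f c)
    map_star' := by
      refine p.induction (Q := fun a => g (star a) = star (g a))
        (isClosed_eq (hc.comp continuous_star) hc.star) fun a => ?_
      rw [star_toCompl, hg, hg, StarHomClass.map_star] }

theorem extend_ofAlg (p : CStarSeminorm P) {B : Type v} [CStarAlgebra B] (f : P →⋆ₐ[ℂ] B)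
    (hf : ∀ a, ‖f a‖ ≤ p a) (a : P) : p.extend f hf (p.ofAlg a) = f a :=
  UniformSpace.Completion.extensionHom_coe (α := p.Dom) (f : P →+* B) (p.continuous_of_le f hf) a

end CStarSeminorm

section UniversalCStar

variable {P : Type u} [Ring P] [StarRing P] [Algebra ℂ P] [StarModule ℂ P]

/-- The C*-seminorms on `P` for which the relations `r = 0`, with `r ∈ R`, hold. -/
abbrev AdmissibleSeminorm (R : Set P) : Type u := {p : CStarSeminorm P // ∀ r ∈ R, p r = 0}

/-- The C*-seminorms respecting the relations `R` are pointwise bounded, so that there is a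
biggest one. -/
def HasMaxSeminorm (R : Set P) : Prop :=
  ∀ a : P, ∃ C : ℝ, ∀ p : AdmissibleSeminorm R, p.1 a ≤ C

theorem HasMaxSeminorm.bddAbove {R : Set P} (h : HasMaxSeminorm R) (a : P) :
    BddAbove (Set.range fun p : AdmissibleSeminorm R => p.1 a) := by
  obtain ⟨C, hC⟩ := h a
  exact ⟨C, by rintro _ ⟨p, rfl⟩; exact hC p⟩

instance (R : Set P) : Nonempty (AdmissibleSeminorm R) :=
  ⟨⟨{ (0 : Seminorm ℂ P) with
      mul_le' := fun _ _ => (mul_zero (0 : ℝ)).ge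
      star_mul_self' := fun _ => (mul_zero (0 : ℝ)).symm }, fun _ _ => rfl⟩⟩

/-- The biggest C*-seminorm respecting the relations `R`. -/
def maxSeminorm (R : Set P) (h : HasMaxSeminorm R) : CStarSeminorm P where
  toFun a := ⨆ p : AdmissibleSeminorm R, p.1 a
  map_zero' := by
    have : ∀ p : AdmissibleSeminorm R, p.1 0 = 0 := fun p => p.1.map_zero'
    simp [this]
  add_le' a b := ciSup_le fun p => (p.1.add_le' a b).trans
    (add_le_add (le_ciSup (h.bddAbove a) p) (le_ciSup (h.bddAbove b) p))
  neg' a := by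
    have : ∀ p : AdmissibleSeminorm R, p.1 (-a) = p.1 a := fun p => p.1.neg' a
    simp [this]
  smul' c a := by
    have : ∀ p : AdmissibleSeminorm R, p.1 (c • a) = ‖c‖ * p.1 a := fun p => p.1.smul' c a
    simp only [this]
    exact (Real.mul_iSup_of_nonneg (norm_nonneg c) _).symm
  mul_le' a b := ciSup_le fun p => (p.1.mul_le' a b).trans
    (mul_le_mul (le_ciSup (h.bddAbove a) p) (le_ciSup (h.bddAbove b) p) (p.1.nonneg b)
      (Real.iSup_nonneg fun p => p.1.nonneg a))
  star_mul_self' a := by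
    have h0 : 0 ≤ ⨆ p : AdmissibleSeminorm R, p.1 a := Real.iSup_nonneg fun p => p.1.nonneg a
    have h1 : 0 ≤ ⨆ p : AdmissibleSeminorm R, p.1 (star a * a) :=
      Real.iSup_nonneg fun p => p.1.nonneg _
    refine le_antisymm (ciSup_le fun p => ?_) ?_
    · rw [p.1.star_mul_self']
      exact mul_self_le_mul_self (p.1.nonneg a) (le_ciSup (h.bddAbove a) p)
    · rw [← sq, ← Real.le_sqrt h0 h1]
      refine ciSup_le fun p => Real.le_sqrt_of_sq_le ?_
      rw [sq, ← p.1.star_mul_self']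
      exact le_ciSup (h.bddAbove (star a * a)) p

theorem le_maxSeminorm {R : Set P} (h : HasMaxSeminorm R) (p : AdmissibleSeminorm R) (a : P) :
    p.1 a ≤ maxSeminorm R h a := le_ciSup (h.bddAbove a) p

/-- The universal C*-algebra of the *-algebra `P` subject to the relations `r = 0`, `r ∈ R`:
the completion of `P` with respect to the biggest C*-seminorm respecting these relations. -/
abbrev UniversalCStar (R : Set P) (h : HasMaxSeminorm R) : Type u := (maxSeminorm R h).Completion

namespace UniversalCStar

variable {R : Set P} (h : HasMaxSeminorm R)

/-- The canonical map of `P` into its universal C*-algebra. -/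
def of : P →⋆ₐ[ℂ] UniversalCStar R h := (maxSeminorm R h).ofAlg

theorem of_relation {r : P} (hr : r ∈ R) : of h r = 0 := by
  rw [← norm_eq_zero]
  refine ((maxSeminorm R h).norm_ofAlg r).trans ?_
  have : ∀ p : AdmissibleSeminorm R, p.1 r = 0 := fun p => p.2 r hr
  change (⨆ p : AdmissibleSeminorm R, p.1 r) = 0
  simp [this]

/-- The universal property. -/
def lift {B : Type v} [CStarAlgebra B] (f : P →⋆ₐ[ℂ] B) (hf : ∀ r ∈ R, f r = 0) :
    UniversalCStar R h →⋆ₐ[ℂ] B :=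
  (maxSeminorm R h).extend f fun a =>
    le_maxSeminorm h ⟨CStarSeminorm.comap f, fun r hr => (congrArg norm (hf r hr)).trans norm_zero⟩ a

theorem lift_of {B : Type v} [CStarAlgebra B] (f : P →⋆ₐ[ℂ] B) (hf : ∀ r ∈ R, f r = 0) (a : P) :
    lift h f hf (of h a) = f a :=
  (maxSeminorm R h).extend_ofAlg f _ a

end UniversalCStar

end UniversalCStar

section MaxTensor

open scoped TensorProduct

variable (A : Type u) (B : Type v) [CStarAlgebra A] [CStarAlgebra B]

theorem hasMaxSeminorm_tensor : HasMaxSeminorm (∅ : Set (A ⊗[ℂ] B)) := by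
  intro t
  induction t with
  | zero => exact ⟨0, fun p => le_of_eq p.1.map_zero'⟩
  | add x y hx hy =>
    obtain ⟨C, hC⟩ := hx
    obtain ⟨D, hD⟩ := hy
    exact ⟨C + D, fun p => (p.1.add_le' x y).trans (add_le_add (hC p) (hD p))⟩
  | tmul a b =>
    refine ⟨‖a‖ * ‖b‖, fun p => ?_⟩
    let f : A →⋆ₐ[ℂ] p.1.Completion := p.1.ofAlg.comp
      { Algebra.TensorProduct.includeLeft (R := ℂ) (S := ℂ) (A := A) (B := B) with
        map_star' := fun a => by simp }
    let g : B →⋆ₐ[ℂ] p.1.Completion := p.1.ofAlg.comp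
      { Algebra.TensorProduct.includeRight (R := ℂ) (A := A) (B := B) with
        map_star' := fun a => by simp }
    have hfg : p.1.ofAlg (a ⊗ₜ b) = f a * g b := by
      refine Eq.trans ?_ (map_mul p.1.ofAlg (a ⊗ₜ[ℂ] (1 : B)) ((1 : A) ⊗ₜ[ℂ] b))
      rw [Algebra.TensorProduct.tmul_mul_tmul, mul_one, one_mul]
    rw [← p.1.norm_ofAlg, hfg]
    exact (norm_mul_le _ _).trans (mul_le_mul (NonUnitalStarAlgHom.norm_apply_le f a)
      (NonUnitalStarAlgHom.norm_apply_le g b) (norm_nonneg _) (norm_nonneg _))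

/-- The tensor product of C*-algebras, with respect to the biggest C*-norm. -/
abbrev MaxTensor : Type (max u v) := UniversalCStar (∅ : Set (A ⊗[ℂ] B)) (hasMaxSeminorm_tensor A B)

variable {A B}

/-- The elementary tensors `a ⊗ b`. -/
def MaxTensor.tmul (a : A) (b : B) : MaxTensor A B :=
  UniversalCStar.of (hasMaxSeminorm_tensor A B) (a ⊗ₜ[ℂ] b)

end MaxTensor

section FreeStarAlgebra

/-- The free complex *-algebra on the variables `x ∈ X`. It has as basis the words in the letters
`x = (x, true)` and `x* = (x, false)`. -/
def FreeStarAlgebra (X : Type u) : Type u := MonoidAlgebra ℂ (FreeMonoid (X × Bool))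

namespace FreeStarAlgebra

variable {X : Type u}

instance : Ring (FreeStarAlgebra X) :=
  inferInstanceAs (Ring (MonoidAlgebra ℂ (FreeMonoid (X × Bool))))
instance : Algebra ℂ (FreeStarAlgebra X) :=
  inferInstanceAs (Algebra ℂ (MonoidAlgebra ℂ (FreeMonoid (X × Bool))))

/-- The letters `x` and `x*`. -/
def letter (y : X × Bool) : FreeStarAlgebra X := MonoidAlgebra.of ℂ _ (FreeMonoid.of y)

/-- The variables. -/
def var (x : X) : FreeStarAlgebra X := letter (x, true)

theorem ringHom_ext {S : Type v} [Semiring S] {f g : FreeStarAlgebra X →+* S}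
    (hc : ∀ c : ℂ, f (algebraMap ℂ _ c) = g (algebraMap ℂ _ c))
    (hl : ∀ y, f (letter y) = g (letter y)) : f = g := by
  refine MonoidAlgebra.ringHom_ext' (RingHom.ext hc) ?_
  exact FreeMonoid.hom_eq hl

/-- The involution, as an antilinear morphism into the opposite algebra. -/
def starHom : FreeStarAlgebra X →+* (FreeStarAlgebra X)ᵐᵒᵖ :=
  MonoidAlgebra.liftNCRingHom ((algebraMap ℂ (FreeStarAlgebra X)ᵐᵒᵖ).comp (starRingEnd ℂ))
    (FreeMonoid.lift fun y => MulOpposite.op (letter (y.1, !y.2)))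
    (fun c _ => Algebra.commutes (starRingEnd ℂ c) _)

theorem starHom_algebraMap (c : ℂ) :
    starHom (X := X) (algebraMap ℂ _ c) = algebraMap ℂ _ (starRingEnd ℂ c) := by
  refine (MonoidAlgebra.liftNC_single _ _ _ _).trans ?_
  simp

theorem starHom_letter (y : X × Bool) :
    starHom (letter y) = MulOpposite.op (letter (y.1, !y.2)) := by
  refine (MonoidAlgebra.liftNC_single _ _ _ _).trans ?_
  simp

theorem starHom_comp : (RingHom.op (starHom (X := X))).comp starHom =
    (RingEquiv.opOp (FreeStarAlgebra X) : FreeStarAlgebra X →+* (FreeStarAlgebra X)ᵐᵒᵖᵐᵒᵖ) := by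
  refine ringHom_ext (fun c => ?_) fun y => ?_
  · change MulOpposite.op (starHom (starHom (algebraMap ℂ _ c)).unop) = _
    rw [starHom_algebraMap, MulOpposite.algebraMap_apply, MulOpposite.unop_op, starHom_algebraMap,
      Complex.conj_conj]
    rfl
  · change MulOpposite.op (starHom (starHom (letter y)).unop) = _
    rw [starHom_letter, MulOpposite.unop_op, starHom_letter]
    simp

instance : StarRing (FreeStarAlgebra X) where
  star a := (starHom a).unop
  star_involutive a := congrArg (fun b => b.unop.unop) (DFunLike.congr_fun starHom_comp a)
  star_mul a b := by simp [map_mul]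
  star_add a b := by simp [map_add]

theorem star_algebraMap (c : ℂ) : star (algebraMap ℂ (FreeStarAlgebra X) c) =
    algebraMap ℂ (FreeStarAlgebra X) (star c) :=
  congrArg MulOpposite.unop (starHom_algebraMap c)

instance : StarModule ℂ (FreeStarAlgebra X) where
  star_smul c a := by
    rw [Algebra.smul_def, star_mul, star_algebraMap, Algebra.smul_def, Algebra.commutes]

theorem star_letter (y : X × Bool) : star (letter y) = letter (y.1, !y.2) :=
  congrArg MulOpposite.unop (starHom_letter y)

theorem star_var (x : X) : star (var x) = letter (x, false) := star_letter _

/-- The evaluation of the *-polynomials at a family of elements of a *-algebra. -/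
def eval {B : Type v} [Ring B] [StarRing B] [Algebra ℂ B] [StarModule ℂ B] (b : X → B) :
    FreeStarAlgebra X →⋆ₐ[ℂ] B :=
  let f : FreeStarAlgebra X →ₐ[ℂ] B := MonoidAlgebra.lift ℂ B (FreeMonoid (X × Bool))
    (FreeMonoid.lift fun y => if y.2 then b y.1 else star (b y.1))
  have hl : ∀ y, f (letter y) = if y.2 then b y.1 else star (b y.1) := fun y =>
    (MonoidAlgebra.lift_of _ _).trans (FreeMonoid.lift_eval_of _ _)
  { f with
    map_star' := fun a => by
      have : (RingHom.op (f : FreeStarAlgebra X →+* B)).comp starHom =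
          (starRingEquiv (R := B) : B →+* Bᵐᵒᵖ).comp (f : FreeStarAlgebra X →+* B) := by
        refine ringHom_ext (fun c => ?_) fun y => ?_
        · change MulOpposite.op (f (starHom (algebraMap ℂ _ c)).unop) =
            MulOpposite.op (star (f (algebraMap ℂ _ c)))
          rw [starHom_algebraMap, MulOpposite.algebraMap_apply, MulOpposite.unop_op,
            AlgHom.commutes, AlgHom.commutes, ← algebraMap_star_comm]
          rfl
        · change MulOpposite.op (f (starHom (letter y)).unop) = MulOpposite.op (star (f (letter y)))
          rw [starHom_letter, MulOpposite.unop_op, hl, hl]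
          cases y.2 <;> simp
      exact congrArg MulOpposite.unop (DFunLike.congr_fun this a) }

theorem eval_var {B : Type v} [Ring B] [StarRing B] [Algebra ℂ B] [StarModule ℂ B] (b : X → B)
    (x : X) : eval b (var x) = b x :=
  (MonoidAlgebra.lift_of _ _).trans (FreeMonoid.lift_eval_of _ _)

theorem induction {Q : FreeStarAlgebra X → Prop} (hc : ∀ c : ℂ, Q (algebraMap ℂ _ c))
    (hl : ∀ y, Q (letter y)) (ha : ∀ a b, Q a → Q b → Q (a + b))
    (hm : ∀ a b, Q a → Q b → Q (a * b)) (a : FreeStarAlgebra X) : Q a := by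
  refine MonoidAlgebra.induction_on (motive := Q) a (fun w => ?_) ha fun c a h => ?_
  · induction w using FreeMonoid.inductionOn' with
    | one => exact (map_one (algebraMap ℂ (FreeStarAlgebra X))) ▸ hc 1
    | of_mul y w hw =>
      rw [map_mul]
      exact hm _ _ (hl y) hw
  · rw [Algebra.smul_def]
    exact hm _ _ (hc c) h

/-- Boundedness of the admissible C*-seminorms has to be checked on the variables only. -/
theorem hasMaxSeminorm {R : Set (FreeStarAlgebra X)}
    (h : ∀ x : X, ∃ C : ℝ, ∀ p : AdmissibleSeminorm R, p.1 (var x) ≤ C) : HasMaxSeminorm R := by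
  refine induction (fun c => ?_) (fun y => ?_) (fun a b ha hb => ?_) fun a b ha hb => ?_
  · refine ⟨‖c‖, fun p => ?_⟩
    have h1 : p.1 1 ≤ 1 := by
      have h2 := p.1.star_mul_self' 1
      rw [star_one, one_mul] at h2
      nlinarith [p.1.nonneg 1]
    rw [Algebra.algebraMap_eq_smul_one]
    refine (p.1.smul' c 1).le.trans ?_
    exact mul_le_of_le_one_right (norm_nonneg c) h1
  · obtain ⟨C, hC⟩ := h y.1
    refine ⟨C, fun p => ?_⟩
    obtain ⟨x, b⟩ := y
    cases b with
    | true => exact hC p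
    | false =>
      have := p.1.map_star (var x)
      rw [star_var] at this
      rw [this]
      exact hC p
  · obtain ⟨C, hC⟩ := ha
    obtain ⟨D, hD⟩ := hb
    exact ⟨C + D, fun p => (p.1.add_le' a b).trans (add_le_add (hC p) (hD p))⟩
  · obtain ⟨C, hC⟩ := ha
    obtain ⟨D, hD⟩ := hb
    refine ⟨|C| * |D|, fun p => (p.1.mul_le' a b).trans ?_⟩
    exact mul_le_mul ((hC p).trans (le_abs_self C)) ((hD p).trans (le_abs_self D)) (p.1.nonneg b)
      (abs_nonneg C)

end FreeStarAlgebra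
end FreeStarAlgebra

section FreeUnitary

open scoped Matrix

/-- A square matrix over a *-algebra is biunitary when `u* = u⁻¹` and `uᵗ = ū⁻¹`. -/
structure IsBiunitary {n : Type u} [Fintype n] [DecidableEq n] {B : Type v} [Ring B] [StarRing B]
    (w : Matrix n n B) : Prop where
  mul_conjTranspose : w * wᴴ = 1
  conjTranspose_mul : wᴴ * w = 1
  transpose_mul_conj : wᵀ * w.map star = 1
  conj_mul_transpose : w.map star * wᵀ = 1

theorem IsBiunitary.mul {n : Type u} [Fintype n] [DecidableEq n] {B : Type v} [Ring B] [StarRing B]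
    {w z : Matrix n n B} (hw : IsBiunitary w) (hz : IsBiunitary z)
    (hc : ∀ i j k l, Commute (w i j) (z k l)) : IsBiunitary (w * z) := by
  have h1 : (w * z)ᵀ = zᵀ * wᵀ := by
    ext i j
    simp only [Matrix.transpose_apply, Matrix.mul_apply]
    exact Finset.sum_congr rfl fun k _ => (hc _ _ _ _).eq
  have h2 : (w * z).map star = w.map star * z.map star := by
    ext i j
    simp only [Matrix.map_apply, Matrix.mul_apply, star_sum, star_mul]
    exact Finset.sum_congr rfl fun k _ => ((hc _ _ _ _).star_star).eq.symm
  constructor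
  · rw [Matrix.conjTranspose_mul, Matrix.mul_assoc, ← Matrix.mul_assoc z, hz.mul_conjTranspose,
      Matrix.one_mul, hw.mul_conjTranspose]
  · rw [Matrix.conjTranspose_mul, Matrix.mul_assoc, ← Matrix.mul_assoc _ w, hw.conjTranspose_mul,
      Matrix.one_mul, hz.conjTranspose_mul]
  · rw [h1, h2, Matrix.mul_assoc, ← Matrix.mul_assoc _ (w.map star), hw.transpose_mul_conj,
      Matrix.one_mul, hz.transpose_mul_conj]
  · rw [h1, h2, Matrix.mul_assoc, ← Matrix.mul_assoc _ zᵀ, hz.conj_mul_transpose,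
      Matrix.one_mul, hw.conj_mul_transpose]

theorem IsBiunitary.map {n : Type*} [Fintype n] [DecidableEq n] {B C : Type*}
    [Ring B] [StarRing B] [Algebra ℂ B] [Ring C] [StarRing C] [Algebra ℂ C]
    {w : Matrix n n B} (hw : IsBiunitary w) (f : B →⋆ₐ[ℂ] C) : IsBiunitary (w.map f) := by
  have hmul : ∀ x y : Matrix n n B, x * y = 1 → x.map f * y.map f = 1 := fun x y h => by
    have := congrArg (f.toAlgHom.toRingHom.mapMatrix (m := n)) h
    rwa [map_mul, map_one] at this
  have h1 : (w.map f)ᴴ = wᴴ.map f := by ext i j; exact (map_star f _).symm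
  have h2 : (w.map f).map star = (w.map star).map f := by ext i j; exact (map_star f _).symm
  refine ⟨?_, ?_, ?_, ?_⟩
  · rw [h1]; exact hmul _ _ hw.mul_conjTranspose
  · rw [h1]; exact hmul _ _ hw.conjTranspose_mul
  · rw [h2]; exact hmul _ _ hw.transpose_mul_conj
  · rw [h2]; exact hmul _ _ hw.conj_mul_transpose

theorem IsBiunitary.antipode {n : Type*} [Fintype n] [DecidableEq n] {B : Type*}
    [Ring B] [StarRing B] {w : Matrix n n B} (hw : IsBiunitary w) :
    IsBiunitary (wᴴ.map MulOpposite.op) := by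
  have key : ∀ x y : Matrix n n B, x * y = 1 →
      yᵀ.map MulOpposite.op * xᵀ.map MulOpposite.op = 1 := fun x y h => by
    ext i j
    have := congrFun (congrFun h j) i
    simp only [Matrix.mul_apply, Matrix.map_apply, Matrix.transpose_apply] at this ⊢
    simp only [← MulOpposite.op_mul, ← Finset.op_sum, this, Matrix.one_apply, eq_comm (a := j)]
    split_ifs <;> rfl
  have e1 : (wᴴ.map MulOpposite.op)ᴴ = w.map MulOpposite.op := by ext i j; simp
  have e2 : (wᴴ.map MulOpposite.op).map star = wᵀ.map MulOpposite.op := by ext i j; simp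
  have e3 : (wᴴ.map MulOpposite.op)ᵀ = (w.map star).map MulOpposite.op := by ext i j; simp
  have e4 : (w.map star)ᵀ = wᴴ := rfl
  have e5 : (wᴴ)ᵀ = w.map star := rfl
  constructor
  · rw [e1]; exact key _ _ hw.transpose_mul_conj
  · rw [e1]; exact key _ _ hw.conj_mul_transpose
  · rw [e3, e2]; exact key _ _ hw.mul_conjTranspose
  · rw [e3, e2]; exact key _ _ hw.conjTranspose_mul

/-- The matrix of the `N²` variables of the free *-algebra. -/
def genericMatrix (N : ℕ) : Matrix (Fin N) (Fin N) (FreeStarAlgebra (Fin N × Fin N)) :=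
  Matrix.of fun i j => FreeStarAlgebra.var (i, j)

/-- The `4N²` relations coming from `uu* = u*u = uᵗū = ūuᵗ = 1`. -/
def biunitaryRelations (N : ℕ) : Set (FreeStarAlgebra (Fin N × Fin N)) :=
  let w := genericMatrix N
  {r | ∃ i j, r = (w * wᴴ - 1) i j ∨ r = (wᴴ * w - 1) i j ∨ r = (wᵀ * w.map star - 1) i j ∨
    r = (w.map star * wᵀ - 1) i j}

theorem biunitaryRelations_iff {N : ℕ} {B : Type*} [Ring B] [StarRing B] [Algebra ℂ B]
    (f : FreeStarAlgebra (Fin N × Fin N) →⋆ₐ[ℂ] B) :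
    (∀ r ∈ biunitaryRelations N, f r = 0) ↔ IsBiunitary ((genericMatrix N).map f) := by
  set w := genericMatrix N with hw
  have h1 : (w.map f)ᴴ = wᴴ.map f := by ext i j; exact (map_star f _).symm
  have h2 : (w.map f).map star = (w.map star).map f := by ext i j; exact (map_star f _).symm
  have h3 : (w.map f)ᵀ = wᵀ.map f := rfl
  have key : ∀ x y : Matrix (Fin N) (Fin N) (FreeStarAlgebra (Fin N × Fin N)),
      x.map f * y.map f = 1 ↔ ∀ i j, f ((x * y - 1) i j) = 0 := fun x y => by
    have e : (x * y - 1).map f = x.map f * y.map f - 1 := by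
      have := map_sub (f.toAlgHom.toRingHom.mapMatrix (m := Fin N)) (x * y) 1
      rwa [map_mul, map_one] at this
    rw [← sub_eq_zero, ← e]
    exact ⟨fun h i j => congrFun (congrFun h i) j, fun h => by ext i j; exact h i j⟩
  constructor
  · intro h
    refine ⟨?_, ?_, ?_, ?_⟩
    · rw [h1, key]; exact fun i j => h _ ⟨i, j, Or.inl rfl⟩
    · rw [h1, key]; exact fun i j => h _ ⟨i, j, Or.inr (Or.inl rfl)⟩
    · rw [h2, h3, key]; exact fun i j => h _ ⟨i, j, Or.inr (Or.inr (Or.inl rfl))⟩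
    · rw [h2, h3, key]; exact fun i j => h _ ⟨i, j, Or.inr (Or.inr (Or.inr rfl))⟩
  · rintro ⟨a, b, c, d⟩ r ⟨i, j, rfl | rfl | rfl | rfl⟩
    · rw [h1, key] at a; exact a i j
    · rw [h1, key] at b; exact b i j
    · rw [h2, h3, key] at c; exact c i j
    · rw [h2, h3, key] at d; exact d i j

theorem IsBiunitary.norm_le_one {n : Type*} [Fintype n] [DecidableEq n] {B : Type*}
    [CStarAlgebra B] {w : Matrix n n B} (hw : IsBiunitary w) (i j : n) : ‖w i j‖ ≤ 1 := by
  let _ := CStarAlgebra.spectralOrder B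
  have _ := CStarAlgebra.spectralOrderedRing B
  have h := congrFun (congrFun hw.conjTranspose_mul j) j
  rw [Matrix.mul_apply, Matrix.one_apply_eq] at h
  have h1 : star (w i j) * w i j ≤ 1 := by
    rw [← h]
    exact Finset.single_le_sum (f := fun k => wᴴ j k * w k j)
      (fun k _ => star_mul_self_nonneg (w k j)) (Finset.mem_univ i)
  have h2 : ‖star (w i j) * w i j‖ ≤ 1 :=
    (CStarAlgebra.norm_le_one_iff_of_nonneg _ (star_mul_self_nonneg _)).2 h1
  rw [CStarRing.norm_star_mul_self] at h2
  nlinarith [norm_nonneg (w i j)]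

theorem hasMaxSeminorm_biunitary (N : ℕ) : HasMaxSeminorm (biunitaryRelations N) := by
  refine FreeStarAlgebra.hasMaxSeminorm fun x => ⟨1, fun p => ?_⟩
  have h := (biunitaryRelations_iff p.1.ofAlg).1 fun r hr => by
    rw [← norm_eq_zero, p.1.norm_ofAlg]
    exact p.2 r hr
  rw [← p.1.norm_ofAlg]
  exact h.norm_le_one x.1 x.2

/-- The universal C*-algebra `C(U_N⁺)` generated by the entries of a biunitary `N × N` matrix. -/
abbrev FreeUnitaryAlgebra (N : ℕ) : Type :=
  UniversalCStar (biunitaryRelations N) (hasMaxSeminorm_biunitary N)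

namespace FreeUnitaryAlgebra

/-- The standard coordinates `u_{ij}`. -/
def coord (N : ℕ) : Matrix (Fin N) (Fin N) (FreeUnitaryAlgebra N) :=
  (genericMatrix N).map (UniversalCStar.of (hasMaxSeminorm_biunitary N))

theorem isBiunitary_coord (N : ℕ) : IsBiunitary (coord N) :=
  (biunitaryRelations_iff _).1 fun _ hr => UniversalCStar.of_relation _ hr

theorem genericMatrix_map_eval {N : ℕ} {B : Type v} [CStarAlgebra B]
    (w : Matrix (Fin N) (Fin N) B) :
    (genericMatrix N).map (FreeStarAlgebra.eval fun x : Fin N × Fin N => w x.1 x.2) = w := by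
  ext i j
  exact FreeStarAlgebra.eval_var (fun x : Fin N × Fin N => w x.1 x.2) (i, j)

/-- The universal property. -/
def lift {N : ℕ} {B : Type v} [CStarAlgebra B] (w : Matrix (Fin N) (Fin N) B)
    (hw : IsBiunitary w) : FreeUnitaryAlgebra N →⋆ₐ[ℂ] B :=
  UniversalCStar.lift (hasMaxSeminorm_biunitary N)
    (FreeStarAlgebra.eval fun x : Fin N × Fin N => w x.1 x.2)
    ((biunitaryRelations_iff _).2 ((genericMatrix_map_eval w).symm ▸ hw))

theorem lift_coord {N : ℕ} {B : Type v} [CStarAlgebra B] (w : Matrix (Fin N) (Fin N) B)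
    (hw : IsBiunitary w) (i j : Fin N) : lift w hw (coord N i j) = w i j :=
  (UniversalCStar.lift_of _ _ _ _).trans
    (FreeStarAlgebra.eval_var (fun x : Fin N × Fin N => w x.1 x.2) (i, j))

theorem dense_coord (N : ℕ) :
    (StarAlgebra.adjoin ℂ (Set.range fun x : Fin N × Fin N => coord N x.1 x.2)).topologicalClosure
      = ⊤ := by
  set S := StarAlgebra.adjoin ℂ (Set.range fun x : Fin N × Fin N => coord N x.1 x.2)
  have hS : ∀ a, UniversalCStar.of (hasMaxSeminorm_biunitary N) a ∈ S := by
    have hv : ∀ x, UniversalCStar.of (hasMaxSeminorm_biunitary N) (FreeStarAlgebra.var x) ∈ S :=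
      fun x => StarAlgebra.subset_adjoin ℂ _ ⟨x, rfl⟩
    refine FreeStarAlgebra.induction (fun c => ?_) (fun y => ?_) (fun a b ha hb => ?_)
      fun a b ha hb => ?_
    · rw [AlgHomClass.commutes]; exact algebraMap_mem S c
    · obtain ⟨x, b⟩ := y
      cases b with
      | true => exact hv x
      | false =>
        rw [← FreeStarAlgebra.star_var, map_star]
        exact star_mem (hv x)
    · rw [map_add]; exact add_mem ha hb
    · rw [map_mul]; exact mul_mem ha hb
  refine eq_top_iff.2 fun a _ => ?_
  have hd : DenseRange (UniversalCStar.of (hasMaxSeminorm_biunitary N)) :=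
    (maxSeminorm _ (hasMaxSeminorm_biunitary N)).denseRange_ofAlg
  refine closure_mono ?_ (hd a)
  rintro _ ⟨b, rfl⟩
  exact hS b

end FreeUnitaryAlgebra

end FreeUnitary

section WoronowiczAlgebra

open scoped Matrix TensorProduct

/-- A Woronowicz algebra: a C*-algebra `A`, generated by the entries of a unitary matrix `u`, with
comultiplication, counit and antipode given by the usual formulae on the entries of `u`. -/
structure WoronowiczAlgebra (N : ℕ) (A : Type u) [CStarAlgebra A] where
  u : Matrix (Fin N) (Fin N) A
  unitary_u : u * uᴴ = 1 ∧ uᴴ * u = 1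
  dense_u : (StarAlgebra.adjoin ℂ
    (Set.range fun x : Fin N × Fin N => u x.1 x.2)).topologicalClosure = ⊤
  comul : A →⋆ₐ[ℂ] MaxTensor A A
  counit : A →⋆ₐ[ℂ] ℂ
  antipode : A →⋆ₐ[ℂ] Aᵐᵒᵖ
  comul_u : ∀ i j, comul (u i j) = ∑ k, MaxTensor.tmul (u i k) (u k j)
  counit_u : ∀ i j, counit (u i j) = if i = j then 1 else 0
  antipode_u : ∀ i j, antipode (u i j) = MulOpposite.op (star (u j i))

theorem isBiunitary_comul {N : ℕ} {A : Type u} [CStarAlgebra A] {w : Matrix (Fin N) (Fin N) A}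
    (hw : IsBiunitary w) :
    IsBiunitary (Matrix.of fun i j => ∑ k, MaxTensor.tmul (w i k) (w k j)) := by
  let ι := UniversalCStar.of (hasMaxSeminorm_tensor A A)
  let f : A →⋆ₐ[ℂ] MaxTensor A A := ι.comp
    { Algebra.TensorProduct.includeLeft (R := ℂ) (S := ℂ) (A := A) (B := A) with
      map_star' := fun a => by simp }
  let g : A →⋆ₐ[ℂ] MaxTensor A A := ι.comp
    { Algebra.TensorProduct.includeRight (R := ℂ) (A := A) (B := A) with
      map_star' := fun a => by simp }
  have h1 : ∀ a b, f a * g b = MaxTensor.tmul a b := fun a b => by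
    refine (map_mul ι (a ⊗ₜ[ℂ] (1 : A)) ((1 : A) ⊗ₜ[ℂ] b)).symm.trans ?_
    rw [Algebra.TensorProduct.tmul_mul_tmul, mul_one, one_mul]
    rfl
  have h2 : ∀ a b, g b * f a = MaxTensor.tmul a b := fun a b => by
    refine (map_mul ι ((1 : A) ⊗ₜ[ℂ] b) (a ⊗ₜ[ℂ] (1 : A))).symm.trans ?_
    rw [Algebra.TensorProduct.tmul_mul_tmul, mul_one, one_mul]
    rfl
  have h3 : (Matrix.of fun i j => ∑ k, MaxTensor.tmul (w i k) (w k j)) = w.map f * w.map g := by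
    ext i j
    simp [Matrix.mul_apply, h1]
  rw [h3]
  exact (hw.map f).mul (hw.map g) fun i j k l => (h1 _ _).trans (h2 _ _).symm

/-- The free unitary quantum group `U_N⁺`. -/
def freeUnitary (N : ℕ) : WoronowiczAlgebra N (FreeUnitaryAlgebra N) where
  u := FreeUnitaryAlgebra.coord N
  unitary_u := ⟨(FreeUnitaryAlgebra.isBiunitary_coord N).mul_conjTranspose,
    (FreeUnitaryAlgebra.isBiunitary_coord N).conjTranspose_mul⟩
  dense_u := FreeUnitaryAlgebra.dense_coord N
  comul := FreeUnitaryAlgebra.lift _ (isBiunitary_comul (FreeUnitaryAlgebra.isBiunitary_coord N))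
  counit := FreeUnitaryAlgebra.lift (1 : Matrix (Fin N) (Fin N) ℂ) (by constructor <;> simp)
  antipode := FreeUnitaryAlgebra.lift _ (FreeUnitaryAlgebra.isBiunitary_coord N).antipode
  comul_u i j := FreeUnitaryAlgebra.lift_coord _ _ i j
  counit_u i j := (FreeUnitaryAlgebra.lift_coord _ _ i j).trans Matrix.one_apply
  antipode_u i j := FreeUnitaryAlgebra.lift_coord _ _ i j

namespace WoronowiczAlgebra

variable {N : ℕ} {A : Type u} [CStarAlgebra A] (W : WoronowiczAlgebra N A)

/-- The dense *-algebra of smooth elements, generated by the entries of `u`. -/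
def smooth : StarSubalgebra ℂ A :=
  StarAlgebra.adjoin ℂ (Set.range fun x : Fin N × Fin N => W.u x.1 x.2)

/-- The matrix `v` is a (finite dimensional, unitary) corepresentation. -/
structure IsCorep {n : Type v} [Fintype n] [DecidableEq n] (v : Matrix n n A) : Prop where
  smooth : ∀ i j, v i j ∈ W.smooth
  unitary : v * vᴴ = 1 ∧ vᴴ * v = 1
  comul : ∀ i j, W.comul (v i j) = ∑ k, MaxTensor.tmul (v i k) (v k j)
  counit : ∀ i j, W.counit (v i j) = if i = j then 1 else 0
  antipode : ∀ i j, W.antipode (v i j) = MulOpposite.op (star (v j i))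

/-- The main character `χ = ∑ u_{ii}`. -/
def mainCharacter : A := ∑ i, W.u i i

/-- The functional `h` is a Haar integration: a positive unital trace such that
`(h ⊗ id)Δ = (id ⊗ h)Δ = h(.)1`. Here `h ⊗ id` and `id ⊗ h` are the continuous extensions of
`a ⊗ b ↦ h(a)b` and of `a ⊗ b ↦ h(b)a`. -/
structure IsHaar (h : A →L[ℂ] ℂ) : Prop where
  nonneg : ∀ a, 0 ≤ (h (star a * a)).re ∧ (h (star a * a)).im = 0
  map_one : h 1 = 1
  trace : ∀ a b, h (a * b) = h (b * a)
  left_invariant : ∃ E : MaxTensor A A →L[ℂ] A,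
    (∀ a b, E (MaxTensor.tmul a b) = h a • b) ∧ ∀ a, E (W.comul a) = h a • (1 : A)
  right_invariant : ∃ E : MaxTensor A A →L[ℂ] A,
    (∀ a b, E (MaxTensor.tmul a b) = h b • a) ∧ ∀ a, E (W.comul a) = h a • (1 : A)

end WoronowiczAlgebra

section Corepresentations

variable {A : Type u} [CStarAlgebra A]

/-- The intertwiners `Hom(v, w)`, formed by the scalar matrices `T` such that `Tv = wT`. -/
def corepHom {m n : Type*} [Fintype m] [Fintype n] (v : Matrix n n A) (w : Matrix m m A) :
    Set (Matrix m n ℂ) :=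
  {T | T.map (algebraMap ℂ A) * v = w * T.map (algebraMap ℂ A)}

/-- Equivalence of corepresentations: `Hom(v, w)` contains an invertible matrix. -/
def CorepEquiv {m n : Type*} [Fintype m] [Fintype n] [DecidableEq m] [DecidableEq n]
    (v : Matrix n n A) (w : Matrix m m A) : Prop :=
  ∃ T ∈ corepHom v w, ∃ T' : Matrix n m ℂ, T * T' = 1 ∧ T' * T = 1

/-- Irreducibility: `v` is nonzero, and `End(v) = ℂ1`. -/
def CorepIrreducible {n : Type*} [Fintype n] [DecidableEq n] (v : Matrix n n A) : Prop :=
  Nonempty n ∧ ∀ T ∈ corepHom v v, ∃ c : ℂ, T = c • (1 : Matrix n n ℂ)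

/-- The conjugate corepresentation. -/
def corepConj {n : Type*} (v : Matrix n n A) : Matrix n n A := v.map star

/-- The tensor product `(v ⊗ w)_{ia,jb} = v_{ij} w_{ab}`. -/
def corepTensor {m n : Type*} (v : Matrix m m A) (w : Matrix n n A) :
    Matrix (m × n) (m × n) A :=
  Matrix.of fun x y => v x.1 y.1 * w x.2 y.2

/-- The direct sum of a family of corepresentations. -/
def corepSum {ι : Type*} [DecidableEq ι] {n : ι → Type*} (v : ∀ i, Matrix (n i) (n i) A) :
    Matrix (Σ i, n i) (Σ i, n i) A :=
  Matrix.blockDiagonal' v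

end Corepresentations

end WoronowiczAlgebra

section ColoredWords

/-- Colored integers: words in the letters `∘ = true` and `• = false`. -/
abbrev ColoredWord : Type := List Bool

/-- The conjugate of a word is obtained by reversing it, and switching the colors. -/
def ColoredWord.conj (k : ColoredWord) : ColoredWord := (k.map Bool.not).reverse

/-- The noncrossing matching pairings of the letters of `k`, seen as involutions without fixed
points: two paired letters have different colors, and no two strings cross. -/
abbrev NCMatchingPairing (k : ColoredWord) : Type :=
  {π : Fin k.length → Fin k.length // (∀ i, π (π i) = i) ∧ (∀ i, π i ≠ i) ∧
    (∀ i, k.get (π i) ≠ k.get i) ∧ ∀ i j, ¬ (i < j ∧ j < π i ∧ π i < π j)}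

/-- Colored powers: `a^∅ = 1`, `a^∘ = a`, `a^• = a*`, and multiplicativity. -/
def coloredPow {A : Type u} [Ring A] [StarRing A] (a : A) (k : ColoredWord) : A :=
  (k.map fun c => if c then a else star a).prod

/-- The variable `a` follows the Voiculescu circular law with respect to `h`: its moments count the
noncrossing matching pairings. -/
def IsCircular {A : Type u} [CStarAlgebra A] (h : A →L[ℂ] ℂ) (a : A) : Prop :=
  ∀ k : ColoredWord, h (coloredPow a k) = (Nat.card (NCMatchingPairing k) : ℂ)

/-- The triples `(x, y, z)` such that `k = xy` and `l = ȳz`. -/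
abbrev FusionIndex (k l : ColoredWord) : Type :=
  {t : ColoredWord × ColoredWord × ColoredWord //
    k = t.1 ++ t.2.1 ∧ l = ColoredWord.conj t.2.1 ++ t.2.2}

instance (k l : ColoredWord) : Finite (FusionIndex k l) := by
  refine Finite.of_injective
    (fun t : FusionIndex k l => (⟨t.1.1.length, ?_⟩ : Fin (k.length + 1))) ?_
  · have h := congrArg List.length t.2.1
    rw [List.length_append] at h
    omega
  · rintro ⟨⟨x, y, z⟩, h1, h2⟩ ⟨⟨x', y', z'⟩, h1', h2'⟩ h
    simp only [Fin.mk.injEq] at h h1 h2 h1' h2'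
    obtain ⟨rfl, rfl⟩ := List.append_inj (h1.symm.trans h1') h
    obtain rfl := List.append_cancel_left (h2.symm.trans h2')
    rfl

instance (k l : ColoredWord) : Fintype (FusionIndex k l) := Fintype.ofFinite _

end ColoredWords

end

/-! The whole argument is driven by noncrossing diagrams. Tensors on the powers of `ℂ^N` indexed by
a colored word `k` are functions on multi-indices. The noncrossing matching pairings give vectors
there, and their spans `ncSpan` are stable under cups, caps, reflection, rotation and composition,
by the Temperley–Lieb relations. Biunitarity of `u` says that the cups are fixed by `u ⊗ ū` and `ū ⊗
u`, so the tensor powers `u^k` fix all these vectors (`sum_ncSpan_smul_coef`).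

The Haar integration is constructed directly: on the entry `(i, j)` of `u^k` it takes the value
`P_k(i, j)`, with `P_k` the orthogonal projection onto `ncSpan`. The crux is positivity. The
noncrossing intertwiners form a *-algebra of matrices; the orthogonal projection onto it is a
bimodule map, hence completely positive, and this is the required positivity, up to rearranging
indices (`posSemidef_of_projection`, `ncProj_nonneg`). Since the projections commute with cups
(`sum_ncProj_col`), the functional vanishes on the biunitarity relations, so GNS carries it to the
C*-algebra; rotation of diagrams makes it a trace, and `u^k P_k = P_k u^k = P_k` is the invariance.
Applying it to a fixed vector `ξ` gives `ξ = P_k ξ`, so there are no other fixed vectors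
(`mem_ncSpan_of_fixed`), and by Frobenius duality all intertwiners between tensor powers are
noncrossing.

The irreducible `r_k` is the compression of `u^k` to the vectors killed by all contractions of
neighbouring letters of different colors (`capKernel`). In an intertwiner from `r_k` to `r_l`, a cup
lying within one of the two words acts by zero, so only nested strings joining the two words
survive: this forces `k = l` and a scalar (`ncSpan_pairing`). For `N ≥ 2` an explicit vector shows
`r_k ≠ 0`. Conversely, averaging against the Haar integration gives a nonzero intertwiner from some
`u^k` to any irreducible `v`; composing it with cups shortens `k` until all the contractions vanish,
and Schur's lemma then identifies `v` with `r_k`.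

For the fusion rules, each decomposition `k = xy`, `l = ȳz` gives an intertwiner contracting `y`
against `ȳ` and then projecting to `r_{xz}`. These are nonzero by a computation on alternating
indices, mutually orthogonal because the words `xz` are distinct, and jointly injective by induction
on the length of `x` (`junction_eq_zero`).

Finally, the fusion rules give a recursion for the integrals of the products of `χ_{r_s}` with a
colored power of `χ`, and the noncrossing pairings which leave the letters of `s` unpaired among
themselves are counted by the same recursion (`haar_character_mul_coloredPow`). The case of empty
`s` is the circular law. -/

noncomputable section

namespace FreeUnitary

/-! ### Tensors as functions on multi-indices; cups, caps and the Temperley–Lieb relations -/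

section Lists

variable {X : Type u} [Fintype X] [DecidableEq X] {M : Type v}

/-- The multi-indices of length `n`. -/
def lists (X : Type u) [Fintype X] : ℕ → Finset (List X)
  | 0 => {[]}
  | n + 1 => (Finset.univ ×ˢ lists X n).map
      ⟨fun p => p.1 :: p.2, fun p q h => by
        obtain ⟨h1, h2⟩ := List.cons.inj h
        exact Prod.ext h1 h2⟩

omit [DecidableEq X] in
theorem mem_lists {n : ℕ} {i : List X} : i ∈ lists X n ↔ i.length = n := by
  induction n generalizing i with
  | zero => simp [lists]
  | succ n ih =>
    cases i with
    | nil => simp [lists]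
    | cons a i =>
      simp only [lists, Finset.mem_map, Finset.mem_product, Finset.mem_univ, true_and, ih,
        Prod.exists, List.length_cons]
      constructor
      · rintro ⟨c, b, h, e⟩
        obtain ⟨-, rfl⟩ := List.cons.inj e
        rw [h]
      · intro h; exact ⟨a, i, by omega, rfl⟩

omit [DecidableEq X] in
theorem sum_lists_zero [AddCommMonoid M] (f : List X → M) : ∑ i ∈ lists X 0, f i = f [] := by
  simp [lists]

omit [DecidableEq X] in
theorem sum_lists_succ [AddCommMonoid M] (n : ℕ) (f : List X → M) :
    ∑ i ∈ lists X (n + 1), f i = ∑ b, ∑ i ∈ lists X n, f (b :: i) := by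
  rw [lists, Finset.sum_map, Finset.sum_product]
  rfl

omit [DecidableEq X] in
theorem sum_lists_add [AddCommMonoid M] (m n : ℕ) (f : List X → M) :
    ∑ i ∈ lists X (m + n), f i = ∑ i ∈ lists X m, ∑ j ∈ lists X n, f (i ++ j) := by
  induction m generalizing f with
  | zero => simp [sum_lists_zero]
  | succ m ih =>
    rw [show m + 1 + n = m + n + 1 by omega, sum_lists_succ, sum_lists_succ]
    exact Finset.sum_congr rfl fun b _ => ih _

omit [DecidableEq X] in
theorem sum_lists_reverse [AddCommMonoid M] (n : ℕ) (f : List X → M) :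
    ∑ i ∈ lists X n, f i.reverse = ∑ i ∈ lists X n, f i :=
  Finset.sum_nbij' List.reverse List.reverse (by simp [mem_lists]) (by simp [mem_lists])
    (by simp) (by simp) (by simp)

omit [DecidableEq X] in
theorem sum_lists_one [AddCommMonoid M] (f : List X → M) :
    ∑ i ∈ lists X 1, f i = ∑ b, f [b] := by
  rw [sum_lists_succ]
  simp [sum_lists_zero]

/-- The functions on multi-indices which are supported on those of length `n`. -/
def Supp [Zero M] (n : ℕ) (f : List X → M) : Prop := ∀ i, i.length ≠ n → f i = 0

omit [Fintype X] [DecidableEq X] in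
theorem Supp.ext [Zero M] {n : ℕ} {f g : List X → M} (hf : Supp n f) (hg : Supp n g)
    (h : ∀ i, i.length = n → f i = g i) : f = g := by
  ext i
  by_cases hi : i.length = n
  · exact h i hi
  · rw [hf i hi, hg i hi]

/-- Insertion of a pair of equal indices at position `p`. -/
def cup [Zero M] : ℕ → (List X → M) → List X → M
  | 0, f, b :: c :: l => if b = c then f l else 0
  | 0, _, [_] => 0
  | 0, _, [] => 0
  | p + 1, f, b :: l => cup p (fun l => f (b :: l)) l
  | _ + 1, _, [] => 0

/-- Contraction of the indices at positions `p` and `p + 1`. -/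
def cap [AddCommMonoid M] : ℕ → (List X → M) → List X → M
  | 0, f, l => ∑ b, f (b :: b :: l)
  | p + 1, f, b :: l => cap p (fun l => f (b :: l)) l
  | _ + 1, _, [] => 0

omit [Fintype X] in
theorem cup_append [Zero M] (f : List X → M) (i j : List X) (b c : X) :
    cup i.length f (i ++ b :: c :: j) = if b = c then f (i ++ j) else 0 := by
  induction i generalizing f with
  | nil => rfl
  | cons a i ih => exact ih _

omit [DecidableEq X] in
theorem cap_append [AddCommMonoid M] (f : List X → M) (i j : List X) :
    cap i.length f (i ++ j) = ∑ b, f (i ++ b :: b :: j) := by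
  induction i generalizing f with
  | nil => rfl
  | cons a i ih => exact ih _

omit [Fintype X] in
theorem cup_of_short [Zero M] {p : ℕ} {l : List X} (h : l.length < p + 2) (f : List X → M) :
    cup p f l = 0 := by
  induction p generalizing l f with
  | zero =>
    match l, h with
    | [], _ => rfl
    | [_], _ => rfl
    | _ :: _ :: _, h => simp at h
  | succ p ih =>
    match l, h with
    | [], _ => rfl
    | _ :: l, h => exact ih (by simpa using h) _

omit [DecidableEq X] in
theorem cap_of_short [AddCommMonoid M] {p : ℕ} {l : List X} (h : l.length < p) (f : List X → M) :
    cap p f l = 0 := by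
  induction p generalizing l f with
  | zero => simp at h
  | succ p ih =>
    match l, h with
    | [], _ => rfl
    | _ :: l, h => exact ih (by simpa using h) _

omit [Fintype X] [DecidableEq X] in
theorem exists_split {n : ℕ} {l : List X} {p : ℕ} (h : p ≤ n) (hl : l.length = n) :
    ∃ i j, l = i ++ j ∧ i.length = p ∧ j.length = n - p :=
  ⟨l.take p, l.drop p, (List.take_append_drop p l).symm, by simp; omega, by simp [hl]⟩

omit [Fintype X] [DecidableEq X] in
theorem exists_split_two {n p : ℕ} {l : List X} (h : p ≤ n) (hl : l.length = n + 2) :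
    ∃ i b c j, l = i ++ b :: c :: j ∧ i.length = p ∧ j.length = n - p := by
  obtain ⟨i, j, rfl, hi, hj⟩ := exists_split (p := p) (by omega) hl
  match j, hj with
  | [], h => simp at h; omega
  | [_], h => simp at h; omega
  | b :: c :: j, h => exact ⟨i, b, c, j, rfl, hi, by simp at h; omega⟩

omit [Fintype X] in
theorem Supp.cup [Zero M] {n p : ℕ} {f : List X → M} (hf : Supp n f) :
    Supp (n + 2) (cup p f) := by
  intro l hl
  by_cases h : l.length < p + 2
  · exact cup_of_short h f
  · obtain ⟨m, hm⟩ : ∃ m, l.length = m + 2 := ⟨l.length - 2, by omega⟩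
    obtain ⟨i, b, c, j, rfl, rfl, hj⟩ := exists_split_two (p := p) (by omega) hm
    rw [cup_append, hf, ite_self]
    simp at hl ⊢
    omega

omit [DecidableEq X] in
theorem Supp.cap [AddCommMonoid M] {n p : ℕ} {f : List X → M} (hf : Supp (n + 2) f) :
    Supp n (cap p f) := by
  intro l hl
  by_cases h : l.length < p
  · exact cap_of_short h f
  · obtain ⟨i, j, rfl, rfl, hj⟩ := exists_split (p := p) (by omega) (rfl : l.length = _)
    rw [cap_append]
    refine Finset.sum_eq_zero fun b _ => hf _ ?_
    simp at hl ⊢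
    omega

omit [Fintype X] in
theorem cup_zero [Zero M] (p : ℕ) (l : List X) : cup p (fun _ => (0 : M)) l = 0 := by
  induction p generalizing l with
  | zero =>
    match l with
    | [] => rfl
    | [_] => rfl
    | b :: c :: l => exact ite_self _
  | succ p ih =>
    match l with
    | [] => rfl
    | b :: l => exact ih l

omit [Fintype X] in
theorem cup_add [AddZeroClass M] (p : ℕ) (f g : List X → M) (l : List X) :
    cup p (fun l => f l + g l) l = cup p f l + cup p g l := by
  induction p generalizing l f g with
  | zero =>
    match l with
    | [] => exact (add_zero _).symm
    | [_] => exact (add_zero _).symm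
    | b :: c :: l => simp only [cup]; split_ifs <;> simp
  | succ p ih =>
    match l with
    | [] => exact (add_zero _).symm
    | b :: l => exact ih _ _ l

omit [Fintype X] in
theorem cup_map {M' : Type*} [Zero M] [Zero M'] (φ : M → M') (h0 : φ 0 = 0) (p : ℕ)
    (f : List X → M) (l : List X) : cup p (fun l => φ (f l)) l = φ (cup p f l) := by
  induction p generalizing l f with
  | zero =>
    match l with
    | [] => exact h0.symm
    | [_] => exact h0.symm
    | b :: c :: l => simp only [cup]; split_ifs <;> simp [h0]
  | succ p ih =>
    match l with
    | [] => exact h0.symm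
    | b :: l => exact ih _ l

omit [Fintype X] in
theorem cup_sum [AddCommMonoid M] {ι : Type*} (s : Finset ι) (p : ℕ) (f : ι → List X → M)
    (l : List X) : cup p (fun l => ∑ a ∈ s, f a l) l = ∑ a ∈ s, cup p (f a) l := by
  classical
  induction s using Finset.induction_on with
  | empty => simpa using cup_zero p l
  | insert a s ha ih => simp only [Finset.sum_insert ha, cup_add, ih]

omit [DecidableEq X] in
theorem cap_zero [AddCommMonoid M] (p : ℕ) (l : List X) : cap p (fun _ => (0 : M)) l = 0 := by
  induction p generalizing l with
  | zero => exact Finset.sum_const_zero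
  | succ p ih =>
    match l with
    | [] => rfl
    | b :: l => exact ih l

omit [DecidableEq X] in
theorem cap_add [AddCommMonoid M] (p : ℕ) (f g : List X → M) (l : List X) :
    cap p (fun l => f l + g l) l = cap p f l + cap p g l := by
  induction p generalizing l f g with
  | zero => exact Finset.sum_add_distrib
  | succ p ih =>
    match l with
    | [] => exact (add_zero _).symm
    | b :: l => exact ih _ _ l

omit [DecidableEq X] in
theorem cap_map {M' : Type*} [AddCommMonoid M] [AddCommMonoid M'] (φ : M →+ M') (p : ℕ)
    (f : List X → M) (l : List X) : cap p (fun l => φ (f l)) l = φ (cap p f l) := by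
  induction p generalizing l f with
  | zero => exact (map_sum φ _ _).symm
  | succ p ih =>
    match l with
    | [] => exact (map_zero φ).symm
    | b :: l => exact ih _ l

omit [DecidableEq X] in
theorem cap_sum [AddCommMonoid M] {ι : Type*} (s : Finset ι) (p : ℕ) (f : ι → List X → M)
    (l : List X) : cap p (fun l => ∑ a ∈ s, f a l) l = ∑ a ∈ s, cap p (f a) l := by
  classical
  induction s using Finset.induction_on with
  | empty => simpa using cap_zero p l
  | insert a s ha ih => simp only [Finset.sum_insert ha, cap_add, ih]

/-- `cup p` and `cap p` are adjoint to each other. -/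
theorem sum_cup_smul {R : Type*} [Semiring R] [AddCommMonoid M] [Module R M] {n p : ℕ}
    (hp : p ≤ n) (f : List X → R) (g : List X → M) :
    ∑ l ∈ lists X (n + 2), cup p f l • g l = ∑ l ∈ lists X n, f l • cap p g l := by
  induction p generalizing n f g with
  | zero =>
    simp only [sum_lists_succ, cup, cap]
    rw [Finset.sum_congr rfl fun b _ => Finset.sum_eq_single b
      (fun c _ hc => by simp [Ne.symm hc]) (by simp)]
    simp only [if_true, Finset.smul_sum]
    exact Finset.sum_comm
  | succ p ih =>
    obtain ⟨m, rfl⟩ : ∃ m, n = m + 1 := ⟨n - 1, by omega⟩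
    rw [sum_lists_succ, show m + 1 + 1 = m + 2 from rfl, sum_lists_succ]
    exact Finset.sum_congr rfl fun b _ => ih (by omega) _ _

/-- Temperley–Lieb relations, here and in the next lemmas: a closed loop is worth `Fintype.card X`,
and a zigzag straightens (`cap_succ_cup`, `cap_cup_succ`). -/
theorem cap_cup [AddCommMonoid M] {p : ℕ} {l : List X} (h : p ≤ l.length) (f : List X → M) :
    cap p (cup p f) l = Fintype.card X • f l := by
  induction p generalizing l f with
  | zero => simp [cap, cup]
  | succ p ih =>
    match l, h with
    | [], h => simp at h
    | b :: l, h => exact ih (by simpa using h) _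

theorem cap_succ_cup [AddCommMonoid M] {p : ℕ} {l : List X} (h : p + 1 ≤ l.length)
    (f : List X → M) : cap (p + 1) (cup p f) l = f l := by
  induction p generalizing l f with
  | zero =>
    match l, h with
    | [], h => simp at h
    | b :: l, h => simp [cap, cup]
  | succ p ih =>
    match l, h with
    | [], h => simp at h
    | b :: l, h => exact ih (by simpa using h) _

theorem cap_cup_succ [AddCommMonoid M] {p : ℕ} {l : List X} (h : p + 1 ≤ l.length)
    (f : List X → M) : cap p (cup (p + 1) f) l = f l := by
  induction p generalizing l f with
  | zero =>
    match l, h with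
    | [], h => simp at h
    | b :: l, h => simp [cap, cup]
  | succ p ih =>
    match l, h with
    | [], h => simp at h
    | b :: l, h => exact ih (by simpa using h) _

/-- A cap and a cup which do not overlap slide past each other, the shift by 2 being the width of
the cup. -/
theorem cap_cup_of_lt [AddCommMonoid M] (p q : ℕ) (f : List X → M) (l : List X) :
    cap (p + q + 2) (cup p f) l = cup p (cap (p + q) f) l := by
  induction p generalizing l f with
  | zero =>
    match l with
    | [] => rfl
    | [b] => exact cap_of_short (by simp) _
    | b :: c :: l =>
      change cap (0 + q) (fun l => if b = c then f l else 0) l =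
        if b = c then cap (0 + q) f l else 0
      split_ifs
      · rfl
      · exact cap_zero _ _
  | succ p ih =>
    match l with
    | [] => rw [cap_of_short (by simp)]; rfl
    | b :: l =>
      rw [show p + 1 + q + 2 = (p + q + 2) + 1 by omega, show p + 1 + q = (p + q) + 1 by omega]
      exact ih _ _

theorem cap_cup_of_gt [AddCommMonoid M] (p q : ℕ) (f : List X → M) (l : List X) :
    cap p (cup (p + q + 2) f) l = cup (p + q) (cap p f) l := by
  induction p generalizing l f with
  | zero =>
    rw [Nat.zero_add]
    exact (cup_sum Finset.univ q (fun b l => f (b :: b :: l)) l).symm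
  | succ p ih =>
    rw [show p + 1 + q + 2 = (p + q + 2) + 1 by omega, show p + 1 + q = (p + q) + 1 by omega]
    match l with
    | [] => rfl
    | b :: l => exact ih _ _

end Lists

/-! ### The spans of the noncrossing vectors and the operations preserving them -/

section NCSpan

variable {X : Type u} [Fintype X] [DecidableEq X]

/-- The unit of the tensor algebra. -/
def unitVec : List X → ℂ
  | [] => 1
  | _ :: _ => 0

/-- The vectors of the tensor powers of `ℂ^X` associated to the noncrossing matching pairings of
the colored words: they are obtained from the unit by inserting pairs of neighbouring letters. -/
inductive NCVector : ColoredWord → (List X → ℂ) → Prop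
  | nil : NCVector [] unitVec
  | cup (x : ColoredWord) (a : Bool) (y : ColoredWord) (f : List X → ℂ) :
      NCVector (x ++ y) f → NCVector (x ++ a :: (!a) :: y) (cup x.length f)

/-- The span of the vectors of the noncrossing matching pairings of `k`. -/
def ncSpan (X : Type u) [DecidableEq X] (k : ColoredWord) : Submodule ℂ (List X → ℂ) :=
  Submodule.span ℂ {f | NCVector k f}

omit [Fintype X] in
theorem NCVector.supp {k : ColoredWord} {f : List X → ℂ} (hf : NCVector k f) :
    Supp k.length f := by
  induction hf with
  | nil => intro l hl; cases l <;> simp [unitVec] at hl ⊢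
  | cup x a y f _ ih =>
    have := ih.cup (p := x.length)
    rwa [List.length_append] at this ⊢

omit [Fintype X] in
theorem ncSpan_induction {k : ColoredWord} {f : List X → ℂ} (hf : f ∈ ncSpan X k)
    {p : (List X → ℂ) → Prop} (h : ∀ f, NCVector k f → p f) (h0 : p 0)
    (ha : ∀ f g, p f → p g → p (f + g)) (hs : ∀ (c : ℂ) f, p f → p (c • f)) : p f :=
  Submodule.span_induction (p := fun f _ => p f) h h0 (fun f g _ _ => ha f g)
    (fun c f _ => hs c f) hf

omit [Fintype X] in
theorem ncSpan_supp {k : ColoredWord} {f : List X → ℂ} (hf : f ∈ ncSpan X k) :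
    Supp k.length f := by
  refine ncSpan_induction hf (fun f h => h.supp) (fun _ _ => rfl) (fun f g hf hg i hi => ?_)
    fun c f hf i hi => ?_
  · simp [hf i hi, hg i hi]
  · simp [hf i hi]

omit [Fintype X] in
-- Reduction to the generators; the twist `σ` is there to cover antilinear operations, such as the
-- reflection.
theorem ncSpan_map {k k' : ColoredWord} (σ : ℂ →+* ℂ) (φ : (List X → ℂ) → List X → ℂ)
    (ha : ∀ f g l, φ (f + g) l = φ f l + φ g l) (hs : ∀ c f l, φ (c • f) l = σ c * φ f l)
    (h : ∀ f, NCVector k f → φ f ∈ ncSpan X k') {f : List X → ℂ} (hf : f ∈ ncSpan X k) :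
    φ f ∈ ncSpan X k' := by
  refine ncSpan_induction (p := fun f => φ f ∈ ncSpan X k') hf h ?_ (fun f g hf hg => ?_)
    fun c f hf => ?_
  · have : φ 0 = 0 := funext fun l => by simpa using hs 0 0 l
    rw [this]
    exact Submodule.zero_mem _
  · rw [show φ (f + g) = φ f + φ g from funext (ha f g)]
    exact Submodule.add_mem _ hf hg
  · rw [show φ (c • f) = σ c • φ f from funext (hs c f)]
    exact Submodule.smul_mem _ _ hf

omit [Fintype X] in
theorem cup_mem_ncSpan {x y : ColoredWord} (a : Bool) {f : List X → ℂ}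
    (hf : f ∈ ncSpan X (x ++ y)) : cup x.length f ∈ ncSpan X (x ++ a :: (!a) :: y) :=
  ncSpan_map (RingHom.id ℂ) (cup x.length) (cup_add _)
    (fun c => cup_map (fun z => c * z) (mul_zero c) _)
    (fun f h => Submodule.subset_span (.cup x a y f h)) hf

/-- Induction on the cup inserted last. If the cap meets it exactly, a loop appears; if it is
shifted by one on either side, a zigzag is straightened; otherwise the two commute and the induction
hypothesis applies to the cap. -/
theorem cap_mem_of_NCVector {m : ColoredWord} {f : List X → ℂ} (hf : NCVector m f) :
    ∀ (x : ColoredWord) (a : Bool) (y : ColoredWord), m = x ++ a :: (!a) :: y →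
      cap x.length f ∈ ncSpan X (x ++ y) := by
  induction hf with
  | nil => intro x a y h; simp at h
  | cup x' b y' f hf ih =>
    intro x a y h
    have hs := hf.supp
    -- Both sides are supported on a single length, so the Temperley–Lieb relations are needed only
    -- for lists of that length, where their length hypotheses hold.
    have hcap : ∀ {z : ColoredWord} {g : List X → ℂ}, g ∈ ncSpan X z →
        z.length = x.length + y.length → (∀ l, l.length = x.length + y.length →
          cap x.length (cup x'.length f) l = g l) →
        cap x.length (cup x'.length f) = g := fun {z g} hg hz h' => by
      have hl := congrArg List.length h
      simp only [List.length_append, List.length_cons] at hl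
      refine Supp.ext (n := x.length + y.length) (Supp.cap ?_) (hz ▸ ncSpan_supp hg) h'
      have := hs.cup (p := x'.length)
      rw [List.length_append] at this
      rwa [show x'.length + y'.length + 2 = x.length + y.length + 2 by omega] at this
    rcases List.append_eq_append_iff.1 h with ⟨w, rfl, h2⟩ | ⟨w, rfl, h2⟩
    · match w, h2 with
      | [], h2 =>
        simp only [List.nil_append, List.cons.injEq] at h2
        obtain ⟨rfl, -, rfl⟩ := h2
        simp only [List.append_nil] at hcap ⊢
        have hg : Fintype.card X • f ∈ ncSpan X (x' ++ y') :=
          Submodule.smul_of_tower_mem _ _ (Submodule.subset_span hf)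
        rw [hcap hg (by simp) fun l hl => cap_cup (by omega) f]
        exact hg
      | [c], h2 =>
        simp only [List.cons_append, List.nil_append, List.cons.injEq] at h2
        obtain ⟨rfl, rfl, rfl⟩ := h2
        have hg : f ∈ ncSpan X (x' ++ [b] ++ y) := by
          simp only [Bool.not_not] at hf
          have := Submodule.subset_span (R := ℂ) (s := {f | NCVector _ f}) hf
          rw [ncSpan]
          simpa using this
        rw [hcap hg (by simp; omega) fun l hl => by
          rw [List.length_append]; exact cap_succ_cup (by simp at hl; omega) f]
        exact hg
      | c :: d :: w, h2 =>
        simp only [List.cons_append, List.cons.injEq] at h2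
        obtain ⟨rfl, rfl, rfl⟩ := h2
        have hg := cup_mem_ncSpan (x := x') (y := w ++ y) b (f := cap (x'.length + w.length) f) (by
          have := ih (x' ++ w) a y (by simp)
          simpa using this)
        rw [hcap hg (by simp; omega) fun l hl => by
          rw [← cap_cup_of_lt]; simp; rfl]
        simpa using hg
    · match w, h2 with
      | [], h2 =>
        simp only [List.nil_append, List.cons.injEq] at h2
        obtain ⟨rfl, -, rfl⟩ := h2
        simp only [List.append_nil] at hcap ⊢
        have hg : Fintype.card X • f ∈ ncSpan X (x ++ y) := by
          simp only [List.append_nil] at hf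
          exact Submodule.smul_of_tower_mem _ _ (Submodule.subset_span hf)
        rw [hcap hg (by simp) fun l hl => cap_cup (hl ▸ Nat.le_add_right _ _) f]
        exact hg
      | [c], h2 =>
        simp only [List.cons_append, List.nil_append, List.cons.injEq] at h2
        obtain ⟨rfl, h3, rfl⟩ := h2
        obtain rfl : b = !a := h3.symm
        have hg : f ∈ ncSpan X (x ++ a :: y') := by
          have := Submodule.subset_span (R := ℂ) (s := {f | NCVector _ f}) hf
          rw [ncSpan]
          simpa using this
        simp only [Bool.not_not]
        rw [hcap hg (by simp) fun l hl => by
          rw [List.length_append]; exact cap_cup_succ (by simp at hl; omega) f]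
        exact hg
      | c :: d :: w, h2 =>
        simp only [List.cons_append, List.cons.injEq] at h2
        obtain ⟨rfl, rfl, rfl⟩ := h2
        have hg := cup_mem_ncSpan (x := x ++ w) (y := y') b (f := cap x.length f) (by
          have := ih x a (w ++ y') (by simp)
          simpa using this)
        rw [List.length_append] at hg
        rw [hcap hg (by simp) fun l hl => by
          rw [← cap_cup_of_gt]; simp; rfl]
        simpa using hg

theorem cap_mem_ncSpan {x y : ColoredWord} {a : Bool} {f : List X → ℂ}
    (hf : f ∈ ncSpan X (x ++ a :: (!a) :: y)) : cap x.length f ∈ ncSpan X (x ++ y) :=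
  ncSpan_map (RingHom.id ℂ) (cap x.length) (cap_add _)
    (fun c => cap_map (AddMonoidHom.mulLeft c) _)
    (fun _ h => cap_mem_of_NCVector h x a y rfl) hf

/-- Insertion of the vector `g` of length `n` into the vector `f`, at position `p`. -/
def subst (p n : ℕ) (f g : List X → ℂ) (l : List X) : ℂ :=
  f (l.take p ++ l.drop (p + n)) * g ((l.drop p).take n)

omit [Fintype X] [DecidableEq X] in
theorem subst_append (f g : List X → ℂ) (i m j : List X) :
    subst i.length m.length f g (i ++ (m ++ j)) = f (i ++ j) * g m := by
  simp [subst, ← List.drop_drop]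

omit [Fintype X] [DecidableEq X] in
theorem subst_append' {p n : ℕ} (f g : List X → ℂ) (i m j : List X) (hi : i.length = p)
    (hm : m.length = n) : subst p n f g (i ++ (m ++ j)) = f (i ++ j) * g m := by
  subst hi hm
  exact subst_append f g i m j

omit [Fintype X] [DecidableEq X] in
theorem Supp.subst {p n q : ℕ} {f g : List X → ℂ} (hf : Supp (p + q) f) (hg : Supp n g) :
    Supp (p + (n + q)) (subst p n f g) := by
  intro l hl
  rw [FreeUnitary.subst]
  by_cases h : ((l.drop p).take n).length = n
  · rw [hf, zero_mul]
    simp at h ⊢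
    omega
  · rw [hg _ h, mul_zero]

omit [Fintype X] in
-- Induction on the inserted diagram: its last cup can be added after the substitution instead of
-- before.
theorem subst_mem_ncSpan {x l y : ColoredWord} {f g : List X → ℂ} (hf : f ∈ ncSpan X (x ++ y))
    (hg : g ∈ ncSpan X l) : subst x.length l.length f g ∈ ncSpan X (x ++ (l ++ y)) := by
  have hfs : Supp (x.length + y.length) f := by simpa using ncSpan_supp hf
  refine ncSpan_map (RingHom.id ℂ) (subst x.length l.length f)
    (fun g g' l => by simp [subst, mul_add]) (fun c g l => by simp [subst, mul_left_comm])
    (fun g h => ?_) hg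
  · clear hg
    induction h with
    | nil =>
      have h0 : subst x.length 0 f unitVec = f := by
        ext l
        simp [subst, unitVec]
      simpa [h0] using hf
    | cup x' a y' g hg' ih =>
      have h1 := cup_mem_ncSpan (x := x ++ x') (y := y' ++ y) a (by simpa using ih)
      rw [show x ++ ((x' ++ a :: (!a) :: y') ++ y) = (x ++ x') ++ a :: (!a) :: (y' ++ y) by simp]
      convert h1 using 1
      have hs := hg'.supp
      rw [List.length_append] at hs
      rw [show (x' ++ a :: (!a) :: y').length = x'.length + y'.length + 2 by simp; omega]
      refine Supp.ext (hfs.subst (hs.cup (p := x'.length))) ?_ fun l hl => ?_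
      · have := (hfs.subst hs).cup (p := (x ++ x').length)
        simp only [List.length_append] at this ⊢
        convert this using 1
        omega
      · obtain ⟨i, m, rfl, hi, hm⟩ := exists_split (p := x.length) (by omega) hl
        obtain ⟨m, j, rfl, hm, hj⟩ := exists_split (p := x'.length + y'.length + 2) (by omega) hm
        obtain ⟨m, b, c, m', rfl, hm1, hm2⟩ := exists_split_two (p := x'.length) (by omega) hm
        rw [subst_append' _ _ _ _ _ hi (by simp [hm1, hm2]; omega), ← hm1,
          cup_append]
        have e : i ++ (m ++ b :: c :: m' ++ j) = (i ++ m) ++ b :: c :: (m' ++ j) := by simp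
        rw [e, show (x ++ x').length = (i ++ m).length by simp [hi, hm1], cup_append,
          List.append_assoc, show m ++ (m' ++ j) = (m ++ m') ++ j by simp,
          subst_append' _ _ _ _ _ hi (by simp [hm1, hm2])]
        split_ifs <;> simp

theorem conj_append (k l : ColoredWord) :
    ColoredWord.conj (k ++ l) = ColoredWord.conj l ++ ColoredWord.conj k := by
  simp [ColoredWord.conj]

theorem conj_cons (a : Bool) (k : ColoredWord) :
    ColoredWord.conj (a :: k) = ColoredWord.conj k ++ [!a] := by
  simp [ColoredWord.conj]

theorem conj_conj (k : ColoredWord) : ColoredWord.conj (ColoredWord.conj k) = k := by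
  simp [ColoredWord.conj, Function.comp_def]

theorem length_conj (k : ColoredWord) : (ColoredWord.conj k).length = k.length := by
  simp [ColoredWord.conj]

theorem conj_cup (x : ColoredWord) (a : Bool) (y : ColoredWord) :
    ColoredWord.conj (x ++ a :: (!a) :: y) =
      ColoredWord.conj y ++ a :: (!a) :: ColoredWord.conj x := by
  simp [ColoredWord.conj]

theorem conj_nil : ColoredWord.conj [] = [] := rfl

omit [Fintype X] in
-- Reflection of diagrams, which for intertwiners is the passage to the adjoint: a cup reflects to a
-- cup.
theorem conj_reverse_mem_ncSpan {k : ColoredWord} {f : List X → ℂ} (hf : f ∈ ncSpan X k) :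
    (fun l => starRingEnd ℂ (f l.reverse)) ∈ ncSpan X (ColoredWord.conj k) := by
  refine ncSpan_map (starRingEnd ℂ) (fun f l => starRingEnd ℂ (f l.reverse))
    (fun f g l => by simp) (fun c f l => by simp) (fun f h => ?_) hf
  · clear hf
    induction h with
    | nil =>
      refine Submodule.subset_span ?_
      rw [show (fun l : List X => starRingEnd ℂ (unitVec l.reverse)) = unitVec from ?_]
      · exact NCVector.nil
      ext l
      cases l using List.reverseRecOn with
      | nil => simp [unitVec]
      | append_singleton l b =>
        rw [List.reverse_append]
        cases l <;> simp [unitVec]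
    | cup x a y f hf ih =>
      rw [conj_append] at ih
      rw [conj_cup]
      convert cup_mem_ncSpan a ih using 1
      have hs := hf.supp
      rw [List.length_append] at hs
      refine Supp.ext (n := x.length + y.length + 2) ?_ (Supp.cup ?_) fun l hl => ?_
      · intro l hl
        change starRingEnd ℂ _ = 0
        rw [hs.cup, map_zero]
        simpa using hl
      · intro l hl
        change starRingEnd ℂ _ = 0
        rw [hs, map_zero]
        simpa using hl
      · obtain ⟨i, b, c, j, rfl, hi, hj⟩ := exists_split_two (p := y.length) (by omega) hl
        rw [length_conj, ← hi, cup_append, show (i ++ b :: c :: j).reverse =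
          j.reverse ++ c :: b :: i.reverse by simp, show x.length = j.reverse.length by
            simp; omega, cup_append]
        simp only [eq_comm (a := c), List.reverse_append]
        split_ifs <;> simp

omit [Fintype X] in
theorem pair_mem_ncSpan (a : Bool) :
    cup 0 (unitVec (X := X)) ∈ ncSpan X [!a, a] := by
  have := NCVector.cup [] (!a) [] _ (NCVector.nil (X := X))
  rw [Bool.not_not] at this
  exact Submodule.subset_span this

/-- Surround the vector by one string with ends `!a` and `a`, then contract the left end with the
first letter: the letter `a` has moved from the front to the back. This is the source of the trace
property of the Haar integration. -/
theorem rotate_mem_ncSpan {a : Bool} {k : ColoredWord} {f : List X → ℂ}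
    (hf : f ∈ ncSpan X (a :: k)) : (fun l => f (l.rotate k.length)) ∈ ncSpan X (k ++ [a]) := by
  have h1 := subst_mem_ncSpan (x := [!a]) (y := [a]) (pair_mem_ncSpan a) hf
  have h2 := cap_mem_ncSpan (x := []) (a := !a) (y := k ++ [a]) (by simpa using h1)
  rw [List.nil_append] at h2
  convert h2 using 1
  refine Supp.ext (n := k.length + 1) (fun l hl => ncSpan_supp hf _ (by simpa using hl))
    (fun l hl => ncSpan_supp h2 _ (by simpa using hl)) fun l hl => ?_
  obtain ⟨j, m, rfl, hj, hm⟩ := exists_split (p := k.length) (by omega) hl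
  obtain ⟨b, rfl⟩ := List.length_eq_one_iff.1 (hm.trans (by omega))
  have h3 : ∀ d, subst [!a].length (a :: k).length
      (cup 0 (unitVec (X := X))) f (d :: d :: (j ++ [b])) =
      if d = b then f (b :: j) else 0 := fun d => by
    refine (subst_append' _ _ [d] (d :: j) [b] rfl (by simp [hj])).trans ?_
    simp only [List.cons_append, List.nil_append, cup]
    split_ifs with h
    · simp [h, unitVec]
    · simp
  rw [← hj, List.rotate_append_length_eq]
  change _ = ∑ d, subst _ _ _ _ (d :: d :: (j ++ [b]))
  simp only [List.length_cons, ← hj] at h3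
  have h4 : ∀ d, subst 1 (j.length + 1) (cup 0 unitVec) f (d :: d :: (j ++ [b])) = _ := h3
  simp only [h4]
  simp

/-- Contraction of the `n` indices after the position `p` with the next `n` ones, backwards. -/
def capIter : ℕ → ℕ → (List X → ℂ) → List X → ℂ
  | 0, _, f => f
  | n + 1, p, f => cap p (capIter n (p + 1) f)

omit [DecidableEq X] in
theorem capIter_append (n : ℕ) (f : List X → ℂ) (i j : List X) :
    capIter n i.length f (i ++ j) = ∑ q ∈ lists X n, f (i ++ (q ++ (q.reverse ++ j))) := by
  induction n generalizing i j with
  | zero => simp [capIter, sum_lists_zero]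
  | succ n ih =>
    rw [capIter, cap_append, sum_lists_succ]
    refine Finset.sum_congr rfl fun b _ => ?_
    have := ih (i ++ [b]) (b :: j)
    simpa using this

theorem capIter_mem_ncSpan {x l y : ColoredWord} {f : List X → ℂ}
    (hf : f ∈ ncSpan X (x ++ (l ++ (ColoredWord.conj l ++ y)))) :
    capIter l.length x.length f ∈ ncSpan X (x ++ y) := by
  induction l generalizing x y with
  | nil => simpa [ColoredWord.conj, capIter] using hf
  | cons a l ih =>
    refine cap_mem_ncSpan (a := a) ?_
    have := ih (x := x ++ [a]) (y := (!a) :: y) (by simpa [conj_cons] using hf)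
    simpa using this

/-- The composition of intertwiners, seen as vectors. -/
theorem comp_mem_ncSpan {k l m : ColoredWord} {f g : List X → ℂ}
    (hf : f ∈ ncSpan X (ColoredWord.conj k ++ l)) (hg : g ∈ ncSpan X (ColoredWord.conj l ++ m)) :
    ∃ h ∈ ncSpan X (ColoredWord.conj k ++ m), ∀ i j, i.length = k.length → j.length = m.length →
      h (i ++ j) = ∑ q ∈ lists X l.length, f (i ++ q) * g (q.reverse ++ j) := by
  -- Juxtapose the two vectors; the middle block `l` followed by `conj l` is then contracted from
  -- the inside out by `capIter`.
  have h1 := subst_mem_ncSpan (x := ColoredWord.conj k ++ l) (y := []) (by simpa using hf) hg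
  refine ⟨_, capIter_mem_ncSpan (x := ColoredWord.conj k) (l := l) (y := m) (by simpa using h1),
    fun i j hi hj => ?_⟩
  rw [show (ColoredWord.conj k).length = i.length by rw [length_conj, hi], capIter_append]
  refine Finset.sum_congr rfl fun q hq => ?_
  rw [mem_lists] at hq
  have := subst_append' (p := (ColoredWord.conj k ++ l).length)
    (n := (ColoredWord.conj l ++ m).length) f g (i ++ q) (q.reverse ++ j) []
    (by simp [length_conj, hi, hq]) (by simp [length_conj, hj, hq])
  simpa [length_conj, hi] using this

end NCSpan

/-! ### Vectors killed by the contractions, and the vanishing of noncrossing intertwiners on them -/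

section CapKernel

variable {X : Type u} [Fintype X]

/-- The vectors of the tensor power of `ℂ^X` associated to `k` which are killed by all the
contractions of neighbouring letters having different colors. -/
def capKernel (X : Type u) [Fintype X] (k : ColoredWord) : Submodule ℂ (List X → ℂ) where
  carrier := {f | Supp k.length f ∧ ∀ x a y, k = x ++ a :: (!a) :: y → ∀ i j : List X,
    i.length = x.length → j.length = y.length → ∑ b, f (i ++ b :: b :: j) = 0}
  zero_mem' := ⟨fun _ _ => rfl, fun _ _ _ _ _ _ _ _ => by simp⟩
  add_mem' := fun {f g} hf hg => ⟨fun i hi => by simp [hf.1 i hi, hg.1 i hi],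
    fun x a y h i j hi hj => by
      simp [Finset.sum_add_distrib, hf.2 x a y h i j hi hj, hg.2 x a y h i j hi hj]⟩
  smul_mem' := fun c f hf => ⟨fun i hi => by simp [hf.1 i hi],
    fun x a y h i j hi hj => by
      simp [← Finset.mul_sum, hf.2 x a y h i j hi hj]⟩

theorem mem_capKernel {k : ColoredWord} {f : List X → ℂ} : f ∈ capKernel X k ↔
    Supp k.length f ∧ ∀ x a y, k = x ++ a :: (!a) :: y → ∀ i j : List X,
      i.length = x.length → j.length = y.length → ∑ b, f (i ++ b :: b :: j) = 0 := Iff.rfl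

theorem capKernel_supp {k : ColoredWord} {f : List X → ℂ} (hf : f ∈ capKernel X k) :
    Supp k.length f := hf.1

theorem capKernel_conj {k : ColoredWord} {f : List X → ℂ} (hf : f ∈ capKernel X k) :
    (fun i => starRingEnd ℂ (f i)) ∈ capKernel X k := by
  refine ⟨fun i hi => by simp [hf.1 i hi], fun x a y h i j hi hj => ?_⟩
  rw [← map_sum, hf.2 x a y h i j hi hj, map_zero]

theorem capKernel_reverse {k : ColoredWord} {f : List X → ℂ} (hf : f ∈ capKernel X k) :
    (fun i => f i.reverse) ∈ capKernel X (ColoredWord.conj k) := by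
  refine ⟨fun i hi => hf.1 _ (by simpa [length_conj] using hi), fun x a y h i j hi hj => ?_⟩
  have h' := congrArg ColoredWord.conj h
  rw [conj_conj, conj_cup] at h'
  have := hf.2 _ _ _ h' j.reverse i.reverse (by simp [length_conj, hj]) (by simp [length_conj, hi])
  simpa using this

theorem capKernel_cons {a : Bool} {k : ColoredWord} {f : List X → ℂ}
    (hf : f ∈ capKernel X (a :: k)) (b : X) : (fun i => f (b :: i)) ∈ capKernel X k := by
  refine ⟨fun i hi => hf.1 _ (by simpa using hi), fun x c y h i j hi hj => ?_⟩
  exact hf.2 (a :: x) c y (by simp [h]) (b :: i) j (by simpa using hi) hj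

theorem cap_capKernel {x y : ColoredWord} {a : Bool} {f : List X → ℂ}
    (hf : f ∈ capKernel X (x ++ a :: (!a) :: y)) {l : List X}
    (hl : l.length = x.length + y.length) : cap x.length f l = 0 := by
  obtain ⟨i, j, rfl, hi, hj⟩ := exists_split (p := x.length) (by omega) hl
  rw [← hi, cap_append]
  exact hf.2 x a y rfl i j hi (by omega)

variable [DecidableEq X]

omit [Fintype X] in
theorem cup_append_left (f : List X → ℂ) (i l : List X) (q : ℕ) :
    cup (i.length + q) f (i ++ l) = cup q (fun l => f (i ++ l)) l := by
  induction i generalizing f with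
  | nil => simp
  | cons b i ih =>
    rw [show (b :: i).length + q = (i.length + q) + 1 by simp; omega]
    exact ih _

omit [Fintype X] in
theorem cup_append_right (f : List X → ℂ) {p : ℕ} (l j : List X) (h : p + 2 ≤ l.length) :
    cup p f (l ++ j) = cup p (fun l => f (l ++ j)) l := by
  obtain ⟨n, hn⟩ : ∃ n, l.length = n + 2 := ⟨l.length - 2, by omega⟩
  obtain ⟨i, b, c, m, rfl, rfl, -⟩ := exists_split_two (p := p) (by omega) hn
  rw [cup_append, List.append_assoc, List.cons_append, List.cons_append, cup_append,
    List.append_assoc]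

/-- The bilinear pairing of a vector of the tensor power given by `k̄l` with vectors of the tensor
powers given by `k` and `l`. -/
def pairing (k l : ColoredWord) (ξ α β : List X → ℂ) : ℂ :=
  ∑ j ∈ lists X k.length, ∑ i ∈ lists X l.length, ξ (j.reverse ++ i) * (α j * β i)

/-- By adjointness the cup becomes a cap on `α`, which vanishes. -/
theorem sum_cup_mul_capKernel {x y : ColoredWord} {a : Bool} (f : List X → ℂ) {α : List X → ℂ}
    (hα : α ∈ capKernel X (x ++ a :: (!a) :: y)) :
    ∑ i ∈ lists X (x ++ a :: (!a) :: y).length, cup x.length f i * α i = 0 := by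
  rw [show (x ++ a :: (!a) :: y).length = x.length + y.length + 2 by simp; omega]
  refine (sum_cup_smul (by omega) f α).trans (Finset.sum_eq_zero fun i hi => ?_)
  rw [cap_capKernel hα (mem_lists.1 hi), smul_zero]

/-- Consider the cup inserted last. Inside `l` it kills `β`, and inside `conj k` it kills `α`. If it
straddles the boundary it identifies the first letters and first indices of `k` and `l`, and the
induction hypothesis applies to what remains. So only fully nested diagrams contribute, which
requires `k = l`. -/
theorem pairing_of_NCVector {m : ColoredWord} {ξ : List X → ℂ} (hξ : NCVector m ξ) :
    ∀ k l, m = ColoredWord.conj k ++ l → ∃ c : ℂ, ∀ α ∈ capKernel X k, ∀ β ∈ capKernel X l,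
      pairing k l ξ α β = c * if k = l then ∑ i ∈ lists X k.length, α i * β i else 0 := by
  induction hξ with
  | nil =>
    intro k l h
    obtain ⟨h1, rfl⟩ := List.append_eq_nil_iff.1 h.symm
    obtain rfl : k = [] := by rw [← conj_conj k, h1]; rfl
    exact ⟨1, fun α _ β _ => by
      simp [pairing, sum_lists_zero, unitVec]⟩
  | cup x a y f hf ih =>
    intro k l h
    have main : ∀ w, x = ColoredWord.conj k ++ w → l = w ++ a :: (!a) :: y → ∃ c : ℂ,
        ∀ α ∈ capKernel X k, ∀ β ∈ capKernel X l, pairing k l (cup x.length f) α β =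
          c * if k = l then ∑ i ∈ lists X k.length, α i * β i else 0 := by
      rintro w rfl rfl
      refine ⟨0, fun α hα β hβ => ?_⟩
      rw [zero_mul, pairing]
      refine Finset.sum_eq_zero fun j hj => ?_
      rw [mem_lists] at hj
      have h1 := sum_cup_mul_capKernel (fun i => α j * f (j.reverse ++ i)) hβ
      rw [← h1]
      refine Finset.sum_congr rfl fun i _ => ?_
      rw [List.length_append, length_conj, ← hj, ← List.length_reverse (as := j), cup_append_left,
        cup_map (fun z => α j * z) (mul_zero _)]
      ring
    rcases List.append_eq_append_iff.1 h with ⟨w, h1, h2⟩ | ⟨w, h1, h2⟩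
    · match w, h1, h2 with
      | [], h1, h2 => exact main [] (by simpa using h1.symm) (by simpa using h2.symm)
      | [c], h1, h2 =>
        simp only [List.cons_append, List.nil_append, List.cons.injEq] at h2
        obtain ⟨rfl, rfl⟩ := h2
        obtain ⟨k, rfl⟩ : ∃ k', k = (!a) :: k' := ⟨ColoredWord.conj x, by
          rw [← conj_conj k, h1]; simp [ColoredWord.conj]⟩
        obtain rfl : x = ColoredWord.conj k := by
          rw [conj_cons] at h1
          exact (List.append_inj_left' h1 rfl).symm
        obtain ⟨c, hc⟩ := ih k y rfl
        refine ⟨c, fun α hα β hβ => ?_⟩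
        have h3 : pairing ((!a) :: k) ((!a) :: y)
            (cup (ColoredWord.conj k).length f) α β =
            ∑ b, pairing k y f (fun i => α (b :: i)) (fun i => β (b :: i)) := by
          simp only [pairing, List.length_cons, sum_lists_succ]
          refine Finset.sum_congr rfl fun b _ => Finset.sum_congr rfl fun j hj => ?_
          rw [mem_lists] at hj
          have h4 : ∀ (e : X) (i : List X), cup (ColoredWord.conj k).length f
              ((b :: j).reverse ++ e :: i) = if b = e then f (j.reverse ++ i) else 0 := by
            intro e i
            rw [length_conj, ← hj, ← List.length_reverse (as := j), ← cup_append]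
            simp
          simp only [h4, ite_mul, zero_mul]
          rw [Finset.sum_comm]
          simp
        rw [h3, Finset.sum_congr rfl fun b _ =>
          hc _ (capKernel_cons hα b) _ (capKernel_cons hβ b), ← Finset.mul_sum]
        congr 1
        simp only [List.cons.injEq, true_and, List.length_cons, sum_lists_succ]
        split_ifs
        · rfl
        · simp
      | c :: d :: w, h1, h2 =>
        simp only [List.cons_append, List.cons.injEq] at h2
        obtain ⟨rfl, rfl, rfl⟩ := h2
        refine ⟨0, fun α hα β hβ => ?_⟩
        rw [zero_mul, pairing, Finset.sum_comm]
        refine Finset.sum_eq_zero fun i hi => ?_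
        have h3 := capKernel_reverse hα
        rw [h1] at h3
        have h4 := sum_cup_mul_capKernel (fun j => β i * f (j ++ i)) h3
        rw [← h1, length_conj, ← sum_lists_reverse] at h4
        rw [← h4]
        refine Finset.sum_congr rfl fun j hj => ?_
        have h5 := congrArg List.length h1
        rw [length_conj, ← mem_lists.1 hj] at h5
        rw [cup_append_right _ _ _ (by simp at h5 ⊢; omega),
          cup_map (fun z => β i * z) (mul_zero _), List.reverse_reverse]
        ring
    · exact main w h1 h2

/-- The intertwiners given by noncrossing matching pairings act by scalars between the spaces
`capKernel`, which are pairwise disjoint. -/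
theorem ncSpan_pairing {k l : ColoredWord} {ξ : List X → ℂ}
    (hξ : ξ ∈ ncSpan X (ColoredWord.conj k ++ l)) :
    ∃ c : ℂ, ∀ α ∈ capKernel X k, ∀ β ∈ capKernel X l,
      pairing k l ξ α β = c * if k = l then ∑ i ∈ lists X k.length, α i * β i else 0 := by
  refine ncSpan_induction (p := fun ξ => ∃ c : ℂ, ∀ α ∈ capKernel X k, ∀ β ∈ capKernel X l,
      pairing k l ξ α β = c * if k = l then ∑ i ∈ lists X k.length, α i * β i else 0) hξ
    (fun f h => pairing_of_NCVector h k l rfl) ⟨0, by simp [pairing]⟩ ?_ ?_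
  · rintro f g ⟨c, hc⟩ ⟨d, hd⟩
    refine ⟨c + d, fun α hα β hβ => ?_⟩
    rw [add_mul, ← hc α hα β hβ, ← hd α hα β hβ]
    simp [pairing, add_mul, Finset.sum_add_distrib]
  · rintro z f ⟨c, hc⟩
    refine ⟨z * c, fun α hα β hβ => ?_⟩
    rw [mul_assoc, ← hc α hα β hβ]
    simp [pairing, Finset.mul_sum, mul_assoc]

end CapKernel

/-! ### Orthonormal bases of spaces of finitely supported vectors -/

open scoped ComplexOrder Matrix

/-- Restriction to the finite set `D` is injective on `F`, so an orthonormal basis can be taken in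
the Euclidean space on `D` and lifted back. This serves both `ncSpan` and `capKernel`. -/
theorem exists_orthonormal_family {ι : Type*} (D : Finset ι) (F : Submodule ℂ (ι → ℂ))
    (hF : ∀ f ∈ F, ∀ i, i ∉ D → f i = 0) :
    ∃ (d : ℕ) (B : Fin d → ι → ℂ), (∀ a, B a ∈ F) ∧
      (∀ a b, ∑ i ∈ D, starRingEnd ℂ (B a i) * B b i = if a = b then 1 else 0) ∧
      ∀ f ∈ F, ∀ i, f i = ∑ a, B a i * ∑ j ∈ D, starRingEnd ℂ (B a j) * f j := by
  let R : (ι → ℂ) →ₗ[ℂ] EuclideanSpace ℂ D :=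
    (WithLp.linearEquiv 2 ℂ (D → ℂ)).symm.toLinearMap ∘ₗ LinearMap.funLeft ℂ ℂ Subtype.val
  have hR : ∀ f i, R f i = f i.1 := fun f i => rfl
  let e := stdOrthonormalBasis ℂ (F.map R)
  have h1 : ∀ a, ∃ f ∈ F, R f = (e a : EuclideanSpace ℂ D) := fun a => (e a).2
  choose B hB hBe using h1
  have hin : ∀ f g, inner ℂ (R f) (R g) = ∑ i ∈ D, starRingEnd ℂ (f i) * g i := fun f g => by
    rw [PiLp.inner_apply, ← Finset.sum_coe_sort D]
    exact Finset.sum_congr rfl fun i _ => by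
      rw [RCLike.inner_apply, hR, hR, mul_comm]
  refine ⟨_, B, hB, fun a b => ?_, fun f hf i => ?_⟩
  · rw [← hin, hBe, hBe]
    have := orthonormal_iff_ite.1 e.orthonormal a b
    rwa [Submodule.coe_inner] at this
  · by_cases hi : i ∈ D
    · have h2 := e.sum_repr' ⟨R f, f, hf, rfl⟩
      have h3 := congrArg (fun x : F.map R => (x : EuclideanSpace ℂ D) ⟨i, hi⟩) h2
      simp only [Submodule.coe_sum, Submodule.coe_smul, Submodule.coe_inner, ← hBe, hin] at h3
      have h4 : R f ⟨i, hi⟩ = f i := rfl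
      rw [h4] at h3
      rw [← h3]
      simp [hR, mul_comm]
    · rw [hF f hf i hi]
      simp [hF _ (hB _) i hi]

/-! ### Complete positivity of the projection onto a matrix *-algebra -/

section PosSemidef

variable {ι : Type*} [Fintype ι] [DecidableEq ι]

/-- If `G² = LG` with `G` hermitian and `L` positive then `G` is positive. -/
theorem posSemidef_of_mul_self_eq {n : Type*} [Fintype n] [DecidableEq n] {G L : Matrix n n ℂ}
    (hG : G.IsHermitian) (hL : L.PosSemidef) (h : G * G = L * G) : G.PosSemidef := by
  rw [hG.posSemidef_iff_eigenvalues_nonneg]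
  intro a
  set v : n → ℂ := (hG.eigenvectorBasis a).ofLp with hv
  set t := hG.eigenvalues a
  have h1 : G *ᵥ v = (t : ℂ) • v := by
    have := hG.mulVec_eigenvectorBasis a
    simpa using this
  have h2 : star v ⬝ᵥ v = 1 := by
    have := orthonormal_iff_ite.1 hG.eigenvectorBasis.orthonormal a a
    rw [if_pos rfl, EuclideanSpace.inner_eq_star_dotProduct, dotProduct_comm] at this
    exact this
  -- On a unit eigenvector `v` with eigenvalue `t < 0` the relation reads `t² v = t L v`, hence `L v
  -- = t v`, against the positivity of `L`.
  by_contra hlt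
  have h0 : t < 0 := not_le.1 hlt
  have h3 : G *ᵥ (G *ᵥ v) = L *ᵥ (G *ᵥ v) := by simp [Matrix.mulVec_mulVec, h]
  simp only [h1, Matrix.mulVec_smul, smul_smul] at h3
  have h4 : (t : ℂ) • v = L *ᵥ v := by
    have ht : (t : ℂ) ≠ 0 := by exact_mod_cast h0.ne
    rw [mul_smul] at h3
    exact smul_right_injective _ ht h3
  have h5 := hL.dotProduct_mulVec_nonneg v
  rw [← h4, dotProduct_smul, h2, smul_eq_mul, mul_one] at h5
  exact hlt (by exact_mod_cast h5)

/-- The complete positivity of the orthogonal projection onto a `*`-subalgebra of a matrix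
algebra. -/
theorem posSemidef_of_projection {C : Submodule ℂ (Matrix ι ι ℂ)}
    (hmul : ∀ x ∈ C, ∀ y ∈ C, x * y ∈ C) (hstar : ∀ x ∈ C, xᴴ ∈ C)
    {Q : Matrix (ι × ι) (ι × ι) ℂ} (hQ : Q.IsHermitian)
    (hcol : ∀ s, (Matrix.of fun i i' => Q (i, i') s) ∈ C)
    (hrep : ∀ x ∈ C, ∀ s, ∑ t, Q s t * x t.1 t.2 = x s.1 s.2) :
    (Matrix.of fun p q : ι × ι => Q (p.1, q.1) (p.2, q.2)).PosSemidef := by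
  -- `Q` is the matrix of the orthogonal projection of the space of matrices onto `C`, and `Λ z` is
  -- that of the left multiplication by `z`.
  let Λ : Matrix ι ι ℂ → Matrix (ι × ι) (ι × ι) ℂ := fun z => Matrix.kroneckerMap (· * ·) z 1
  have hΛ : ∀ z s t, (Λ z * Q) s t = ∑ k, z s.1 k * Q (k, s.2) t := fun z s t => by
    simp [Λ, Matrix.mul_apply, Fintype.sum_prod_type, Matrix.one_apply]
  have hΛ' : ∀ z s t, (Q * Λ z) s t = ∑ k, Q s (k, t.2) * z k t.1 := fun z s t => by
    simp [Λ, Matrix.mul_apply, Fintype.sum_prod_type, Matrix.one_apply]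
  have hQQ : Q * Q = Q := by
    ext s t
    rw [Matrix.mul_apply]
    exact hrep _ (hcol t) s
  have h1 : ∀ z ∈ C, Q * (Λ z * Q) = Λ z * Q := fun z hz => by
    ext s t
    have h := hrep _ (hmul z hz _ (hcol t)) s
    rw [Matrix.mul_apply, hΛ]
    simp only [hΛ]
    simpa [Matrix.mul_apply] using h
  -- `C` is invariant under left multiplication by `z` and by its adjoint, so the projection
  -- commutes with this multiplication.
  have h2 : ∀ z ∈ C, Λ z * Q = Q * Λ z := fun z hz => by
    have h := congrArg Matrix.conjTranspose (h1 _ (hstar z hz))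
    have h3 : (Λ zᴴ)ᴴ = Λ z := by
      ext s t
      simp only [Λ, Matrix.one_apply, Matrix.conjTranspose_apply, Matrix.kroneckerMap_apply,
        eq_comm (a := s.2)]
      split_ifs <;> simp
    simp only [Matrix.conjTranspose_mul, hQ.eq, h3] at h
    rw [← h1 z hz, ← h, ← Matrix.mul_assoc]
  -- The projection commutes with the involution of matrices, `C` being self-adjoint. For the
  -- rearranged matrix this is hermitian symmetry.
  have hQ' : Matrix.of (fun s t : ι × ι => star (Q s.swap t.swap)) = Q := by
    set Q' := Matrix.of (fun s t : ι × ι => star (Q s.swap t.swap)) with hQ'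
    have h3 : Q * Q' = Q' := by
      ext s t
      have h := hrep _ (hstar _ (hcol t.swap)) s
      rw [Matrix.mul_apply]
      exact h
    have h4 : Q' * Q = Q := by
      ext s t
      have h := congrArg star (hrep _ (hstar _ (hcol t)) s.swap)
      rw [star_sum] at h
      rw [Matrix.mul_apply, ← Equiv.sum_comp (Equiv.prodComm ι ι)]
      simpa [hQ', mul_comm, Prod.swap] using h
    have h5 : Q'ᴴ = Q' := by
      ext s t
      exact congrArg star (hQ.apply _ _)
    have h6 := congrArg Matrix.conjTranspose h3
    rw [Matrix.conjTranspose_mul, hQ.eq, h5, h4] at h6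
    exact h6.symm
  -- With `G` the rearranged matrix, `N` is built so that `L = Nᴴ * N` satisfies `G * G = L * G`.
  -- This identity is the commutation `h2`, applied to the columns of `Q`, which belong to `C`.
  let N : Matrix (ι × ι × ι × ι) (ι × ι) ℂ :=
    Matrix.of fun a p => if a.1 = p.1 then star (Q a.2.2 (p.2, a.2.1)) else 0
  refine posSemidef_of_mul_self_eq (L := Nᴴ * N) ?_ (Matrix.posSemidef_conjTranspose_mul_self N) ?_
  · ext p q
    exact congrFun (congrFun hQ' (p.1, q.1)) (p.2, q.2)
  · have hL : ∀ p q, (Nᴴ * N) p q = if p.1 = q.1 then ∑ j, Q (q.2, j) (p.2, j) else 0 := by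
      intro p q
      have h0 : ∀ k j r s, star (N (k, j, r, s) p) * N (k, j, r, s) q =
          if k = p.1 then (if k = q.1 then Q (q.2, j) (r, s) * Q (r, s) (p.2, j) else 0) else 0 := by
        intro k j r s
        simp only [N, Matrix.of_apply]
        split_ifs
        · rw [star_star, hQ.apply, mul_comm]
        all_goals simp
      have h3 : ∀ j, ∑ r, ∑ s, Q (q.2, j) (r, s) * Q (r, s) (p.2, j) = Q (q.2, j) (p.2, j) := by
        intro j
        conv_rhs => rw [← hQQ, Matrix.mul_apply, Fintype.sum_prod_type]
      rw [Matrix.mul_apply]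
      simp only [Fintype.sum_prod_type, Matrix.conjTranspose_apply, h0]
      rw [Finset.sum_eq_single p.1 (fun k _ hk => by simp [hk]) (by simp)]
      by_cases h : p.1 = q.1
      · simp [h, h3]
      · simp [h]
    ext p q
    rw [Matrix.mul_apply, Matrix.mul_apply]
    simp only [hL, Fintype.sum_prod_type, ite_mul, zero_mul, Matrix.of_apply]
    have h3 : ∀ j', ∑ k, Q (p.1, k) (p.2, j') * Q (k, q.1) (j', q.2) =
        ∑ m, Q (p.1, q.1) (m, q.2) * Q (m, j') (p.2, j') := fun j' => by
      have h := congrFun (congrFun (h2 _ (hcol (p.2, j'))) (p.1, q.1)) (j', q.2)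
      rw [hΛ, hΛ'] at h
      exact h
    rw [Finset.sum_comm, Finset.sum_congr rfl fun j' _ => h3 j', Finset.sum_comm]
    conv_rhs => rw [Finset.sum_comm]
    simp only [Finset.sum_ite_eq, Finset.mem_univ, if_true]
    refine Finset.sum_congr rfl fun m _ => ?_
    rw [← Finset.mul_sum, mul_comm]

end PosSemidef

/-! ### The projections onto the noncrossing vectors and their positivity -/

section Projection

variable {X : Type u} [Fintype X] [DecidableEq X]

/-- An orthonormal basis of the span of the noncrossing vectors. -/
theorem exists_ncBasis (k : ColoredWord) :
    ∃ (d : ℕ) (B : Fin d → List X → ℂ), (∀ a, B a ∈ ncSpan X k) ∧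
      (∀ a b, ∑ i ∈ lists X k.length, starRingEnd ℂ (B a i) * B b i = if a = b then 1 else 0) ∧
      ∀ f ∈ ncSpan X k, ∀ i, f i = ∑ a, B a i *
        ∑ j ∈ lists X k.length, starRingEnd ℂ (B a j) * f j :=
  exists_orthonormal_family _ _ fun _ hf _ hi => ncSpan_supp hf _ fun h => hi (mem_lists.2 h)

/-- The dimension of the span of the noncrossing vectors. -/
def ncDim (X : Type u) [Fintype X] [DecidableEq X] (k : ColoredWord) : ℕ :=
  (exists_ncBasis (X := X) k).choose

/-- An orthonormal basis of the span of the noncrossing vectors. -/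
def ncBasis (k : ColoredWord) : Fin (ncDim X k) → List X → ℂ :=
  (exists_ncBasis (X := X) k).choose_spec.choose

theorem ncBasis_spec (k : ColoredWord) : (∀ a, ncBasis (X := X) k a ∈ ncSpan X k) ∧
    (∀ a b, ∑ i ∈ lists X k.length, starRingEnd ℂ (ncBasis k a i) * ncBasis k b i =
      if a = b then 1 else 0) ∧
    ∀ f ∈ ncSpan X k, ∀ i, f i = ∑ a, ncBasis k a i *
      ∑ j ∈ lists X k.length, starRingEnd ℂ (ncBasis k a j) * f j :=
  (exists_ncBasis k).choose_spec.choose_spec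

/-- The entries of the orthogonal projection onto the span of the noncrossing vectors. -/
def ncProj (k : ColoredWord) (i j : List X) : ℂ :=
  ∑ a, ncBasis k a i * starRingEnd ℂ (ncBasis k a j)

theorem ncProj_mem (k : ColoredWord) (j : List X) : (fun i => ncProj k i j) ∈ ncSpan X k := by
  have : (fun i => ncProj k i j) = ∑ a, starRingEnd ℂ (ncBasis k a j) • ncBasis (X := X) k a := by
    ext i
    simp [ncProj, mul_comm]
  rw [this]
  exact Submodule.sum_mem _ fun a _ => Submodule.smul_mem _ _ ((ncBasis_spec k).1 a)

theorem ncProj_conj (k : ColoredWord) (i j : List X) :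
    starRingEnd ℂ (ncProj k i j) = ncProj k j i := by
  simp [ncProj, mul_comm]

theorem sum_ncProj_mul {k : ColoredWord} {f : List X → ℂ} (hf : f ∈ ncSpan X k) (i : List X) :
    ∑ j ∈ lists X k.length, ncProj k i j * f j = f i := by
  rw [(ncBasis_spec k).2.2 f hf i]
  simp only [ncProj, Finset.sum_mul, Finset.mul_sum]
  rw [Finset.sum_comm]
  simp only [mul_assoc]

/-- Uniqueness of the orthogonal projection: it is self-adjoint, valued in the span, and the
identity there. This is how the rotated projection gets recognized in `ncProj_rotate`. -/
theorem eq_ncProj {k : ColoredWord} {Q : List X → List X → ℂ}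
    (h1 : ∀ j, j.length = k.length → (fun i => Q i j) ∈ ncSpan X k)
    (h2 : ∀ i j, starRingEnd ℂ (Q i j) = Q j i)
    (h3 : ∀ f ∈ ncSpan X k, ∀ i, i.length = k.length →
      ∑ j ∈ lists X k.length, Q i j * f j = f i) {i j : List X}
    (hj : j.length = k.length) : Q i j = ncProj k i j := by
  rw [← sum_ncProj_mul (h1 j hj) i, ← ncProj_conj k j i, ← h3 _ (ncProj_mem k i) j hj, map_sum]
  refine Finset.sum_congr rfl fun l _ => ?_
  rw [map_mul, h2, ncProj_conj, mul_comm]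

/-- The multi-indices of the tensor powers of `ℂ^X` given by the words in `S`. -/
abbrev WordIndex (X : Type u) [Fintype X] (S : Finset ColoredWord) : Type u :=
  Σ k : S, lists X k.1.length

/-- The projections onto the noncrossing vectors are positive, as kernels on the words in the
coordinates. -/
theorem ncProj_nonneg {τ : Type*} (T : Finset τ) (k : τ → ColoredWord) (i j : τ → List X)
    (hi : ∀ s, (i s).length = (k s).length) (hj : ∀ s, (j s).length = (k s).length) (c : τ → ℂ) :
    0 ≤ ∑ s ∈ T, ∑ t ∈ T, starRingEnd ℂ (c s) * c t *
      ncProj (ColoredWord.conj (k s) ++ k t) ((i s).reverse ++ i t) ((j s).reverse ++ j t) := by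
  classical
  let S : Finset ColoredWord := T.image k
  have hι : ∀ p : WordIndex X S, p.2.1.length = p.1.1.length := fun p => mem_lists.1 p.2.2
  -- The *-algebra of noncrossing intertwiners of the sum of the tensor powers over `S`. By
  -- Frobenius duality, the block between `k` and `l` is a vector for the word `conj k ++ l`; so the
  -- projection `Q` onto this algebra acts block by block, as `ncProj`.
  let C : Submodule ℂ (Matrix (WordIndex X S) (WordIndex X S) ℂ) :=
    { carrier := {z | ∀ k l : S, ∃ ξ ∈ ncSpan X (ColoredWord.conj k.1 ++ l.1), ∀ i j,
        z ⟨k, i⟩ ⟨l, j⟩ = ξ (i.1.reverse ++ j.1)}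
      zero_mem' := fun k l => ⟨0, Submodule.zero_mem _, fun _ _ => rfl⟩
      add_mem' := fun {z w} hz hw k l => by
        obtain ⟨ξ, h1, h2⟩ := hz k l
        obtain ⟨η, h3, h4⟩ := hw k l
        exact ⟨ξ + η, Submodule.add_mem _ h1 h3, fun i j => by simp [h2, h4]⟩
      smul_mem' := fun c z hz k l => by
        obtain ⟨ξ, h1, h2⟩ := hz k l
        exact ⟨c • ξ, Submodule.smul_mem _ _ h1, fun i j => by simp [h2]⟩ }
  let Q : Matrix (WordIndex X S × WordIndex X S) (WordIndex X S × WordIndex X S) ℂ :=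
    Matrix.of fun p q =>
    if p.1.1 = q.1.1 ∧ p.2.1 = q.2.1 then
      ncProj (ColoredWord.conj p.1.1.1 ++ p.2.1.1) (p.1.2.1.reverse ++ p.2.2.1)
        (q.1.2.1.reverse ++ q.2.2.1) else 0
  have key := posSemidef_of_projection (C := C) (Q := Q) ?_ ?_ ?_ ?_ ?_
  · have hmem : ∀ s : T, k s ∈ S := fun s => Finset.mem_image_of_mem k s.2
    -- The kernel in the statement is the submatrix of the rearranged `Q` on those pairs of
    -- multi-indices having the same word.
    let φ : T → WordIndex X S × WordIndex X S := fun s =>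
      (⟨⟨k s, hmem s⟩, ⟨i s, mem_lists.2 (hi s)⟩⟩,
      ⟨⟨k s, hmem s⟩, ⟨j s, mem_lists.2 (hj s)⟩⟩)
    have h := (key.submatrix φ).dotProduct_mulVec_nonneg fun s => c s
    rw [← Finset.sum_coe_sort T]
    convert h using 1
    refine Finset.sum_congr rfl fun s _ => ?_
    rw [← Finset.sum_coe_sort T, Matrix.mulVec, dotProduct, Finset.mul_sum]
    refine Finset.sum_congr rfl fun t _ => ?_
    simp only [Q, φ, Matrix.submatrix_apply, Matrix.of_apply, and_self, if_true, Pi.star_apply]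
    simp only [RCLike.star_def]
    ring
  · intro x hx y hy k l
    have h : ∀ m : S, ∃ ξ ∈ ncSpan X (ColoredWord.conj k.1 ++ l.1), ∀ i j,
        ∑ q, x ⟨k, i⟩ ⟨m, q⟩ * y ⟨m, q⟩ ⟨l, j⟩ = ξ (i.1.reverse ++ j.1) := fun m => by
      obtain ⟨ξ, h1, h2⟩ := hx k m
      obtain ⟨η, h3, h4⟩ := hy m l
      obtain ⟨ζ, h5, h6⟩ := comp_mem_ncSpan h1 h3
      refine ⟨ζ, h5, fun i j => ?_⟩
      rw [h6 _ _ (by simpa using hι ⟨k, i⟩) (hι ⟨l, j⟩)]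
      refine Eq.trans ?_ (Finset.sum_coe_sort (lists X m.1.length) _)
      exact Finset.sum_congr rfl fun q _ => by rw [h2, h4]
    choose ξ h1 h2 using h
    refine ⟨∑ m, ξ m, Submodule.sum_mem _ fun m _ => h1 m, fun i j => ?_⟩
    rw [Matrix.mul_apply, Fintype.sum_sigma, Finset.sum_apply]
    exact Finset.sum_congr rfl fun m _ => h2 m i j
  · intro x hx k l
    obtain ⟨ξ, h1, h2⟩ := hx l k
    refine ⟨_, by simpa [conj_append, conj_conj] using conj_reverse_mem_ncSpan h1, fun i j => ?_⟩
    simp [h2]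
  · ext ⟨⟨k, i⟩, ⟨l, j⟩⟩ ⟨⟨k', i'⟩, ⟨l', j'⟩⟩
    simp only [Q, Matrix.conjTranspose_apply, Matrix.of_apply]
    by_cases h : k = k' ∧ l = l'
    · obtain ⟨rfl, rfl⟩ := h
      rw [if_pos ⟨rfl, rfl⟩, if_pos ⟨rfl, rfl⟩]
      exact ncProj_conj _ _ _
    · rw [if_neg h, if_neg fun h' => h ⟨h'.1.symm, h'.2.symm⟩, star_zero]
  · intro s k l
    by_cases h : k = s.1.1 ∧ l = s.2.1
    · exact ⟨_, ncProj_mem _ (s.1.2.1.reverse ++ s.2.2.1), fun i j => if_pos h⟩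
    · exact ⟨0, Submodule.zero_mem _, fun i j => if_neg h⟩
  · rintro x hx ⟨⟨k, i⟩, ⟨l, j⟩⟩
    obtain ⟨ξ, h1, h2⟩ := hx k l
    have h3 := sum_ncProj_mul h1 (i.1.reverse ++ j.1)
    rw [List.length_append, length_conj, sum_lists_add, ← sum_lists_reverse] at h3
    refine Eq.trans ?_ (h3.trans (h2 i j).symm)
    simp only [Q, Fintype.sum_prod_type, Fintype.sum_sigma, Matrix.of_apply, ite_mul, zero_mul]
    rw [Finset.sum_eq_single k (fun m _ hm => by simp [Ne.symm hm]) (by simp)]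
    refine Eq.trans ?_ (Finset.sum_coe_sort (lists X k.1.length) _)
    refine Finset.sum_congr rfl fun p _ => ?_
    rw [Finset.sum_eq_single l (fun m _ hm => by simp [Ne.symm hm]) (by simp)]
    refine Eq.trans ?_ (Finset.sum_coe_sort (lists X l.1.length) _)
    refine Finset.sum_congr rfl fun q _ => ?_
    rw [if_pos ⟨rfl, rfl⟩, h2]

end Projection

/-! ### The GNS construction for bounded positive functionals on *-algebras -/

section GNS

open scoped ComplexOrder InnerProductSpace
open UniformSpace

variable {P : Type u} [Ring P] [StarRing P] [Algebra ℂ P] [StarModule ℂ P]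

/-- A positive functional on a `*`-algebra for which the left multiplications are bounded. -/
structure IsBoundedPositive (f : P →ₗ[ℂ] ℂ) : Prop where
  nonneg : ∀ x, 0 ≤ f (star x * x)
  bounded : ∀ a, ∃ C : ℝ, ∀ x, (f (star (a * x) * (a * x))).re ≤ C * (f (star x * x)).re

/-- Polarization: positivity at `x + y` and at `x + i y` makes the form hermitian. -/
theorem conj_of_nonneg {f : P →ₗ[ℂ] ℂ} (hf : ∀ x, 0 ≤ f (star x * x)) (x y : P) :
    starRingEnd ℂ (f (star x * y)) = f (star y * x) := by
  have him : ∀ z, (f (star z * z)).im = 0 := fun z => (Complex.le_def.1 (hf z)).2.symm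
  have h1 := him (x + y)
  have h2 := him (x + Complex.I • y)
  simp only [star_add, add_mul, mul_add, map_add, star_smul, smul_mul_assoc, mul_smul_comm,
    map_smul, Complex.add_im, him, smul_eq_mul, Complex.mul_im, Complex.mul_re, Complex.star_def,
    Complex.conj_I, Complex.I_re, Complex.I_im, Complex.neg_re, Complex.neg_im] at h1 h2
  apply Complex.ext
  · simp only [Complex.conj_re]
    linarith
  · simp only [Complex.conj_im]
    linarith

/-- The GNS construction. -/
theorem IsBoundedPositive.exists_gns {f : P →ₗ[ℂ] ℂ} (hf : IsBoundedPositive f) :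
    ∃ (H : Type u) (_ : NormedAddCommGroup H) (_ : InnerProductSpace ℂ H) (_ : CompleteSpace H)
      (π : P →⋆ₐ[ℂ] (H →L[ℂ] H)) (Ω : H), (∀ a, f a = inner ℂ Ω (π a Ω)) ∧
      ∀ a, (∀ x, f (star (a * x) * (a * x)) = 0) → π a = 0 := by
  -- The form may be degenerate; completing the seminormed space `P` divides by the null vectors at
  -- the same time.
  let core : PreInnerProductSpace.Core ℂ P :=
    { inner := fun x y => f (star x * y)
      conj_inner_symm := fun x y => conj_of_nonneg hf.nonneg y x
      re_inner_nonneg := fun x => (Complex.le_def.1 (hf.nonneg x)).1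
      add_left := fun x y z => by rw [star_add, add_mul, map_add]
      smul_left := fun x y r => by
        rw [star_smul, smul_mul_assoc, map_smul]; rfl }
  let _ : SeminormedAddCommGroup P := InnerProductSpace.Core.toSeminormedAddCommGroup (c := core)
  let _ : InnerProductSpace ℂ P := InnerProductSpace.ofCore core
  have hin : ∀ x y : P, inner ℂ x y = f (star x * y) := fun _ _ => rfl
  have hnorm : ∀ x : P, ‖x‖ * ‖x‖ = (f (star x * x)).re := fun x => by
    rw [← inner_self_eq_norm_mul_norm (𝕜 := ℂ), hin]; rfl
  choose C hC using hf.bounded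
  -- The bound `C a` comes without a sign, whence the absolute value.
  let L : P → P →L[ℂ] P := fun a => (LinearMap.mulLeft ℂ a).mkContinuous (√|C a|) fun x => by
    refine abs_le_of_sq_le_sq' ?_ (by positivity) |>.2
    rw [mul_pow, Real.sq_sqrt (abs_nonneg _), sq, sq, hnorm, hnorm]
    refine (hC a x).trans (mul_le_mul_of_nonneg_right (le_abs_self _) ?_)
    rw [← hnorm]
    positivity
  have hL : ∀ a x, L a x = a * x := fun _ _ => rfl
  let ρ : P → Completion P →L[ℂ] Completion P := fun a => (L a).completion
  have hρ : ∀ a (x : P), ρ a (x : Completion P) = ((a * x : P) : Completion P) := fun a x =>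
    (L a).completion_apply_coe x
  have hext : ∀ S T : Completion P →L[ℂ] Completion P,
      (∀ x : P, S (x : Completion P) = T (x : Completion P)) → S = T := fun S T h => by
    ext x
    induction x using Completion.induction_on with
    | hp => exact isClosed_eq S.continuous T.continuous
    | ih x => exact h x
  let π : P →⋆ₐ[ℂ] (Completion P →L[ℂ] Completion P) :=
    { toFun := ρ
      map_one' := hext _ _ fun x => by rw [hρ, one_mul]; rfl
      map_mul' := fun a b => hext _ _ fun x => by
        rw [mul_apply_eq_comp, hρ, hρ, hρ, mul_assoc]
      map_zero' := hext _ _ fun x => by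
        rw [hρ, zero_mul, Completion.coe_zero, zero_apply]
      map_add' := fun a b => hext _ _ fun x => by
        rw [add_apply, hρ, hρ, hρ, add_mul, Completion.coe_add]
      commutes' := fun r => hext _ _ fun x => by
        rw [hρ, Algebra.algebraMap_eq_smul_one, smul_mul_assoc, one_mul, Completion.coe_smul,
          Algebra.algebraMap_eq_smul_one]
        rfl
      map_star' := fun a => by
        refine (ContinuousLinearMap.eq_adjoint_iff _ _).2 fun x y => ?_
        induction x, y using Completion.induction_on₂ with
        | hp => apply isClosed_eq <;> fun_prop
        | ih x y =>
          rw [hρ, hρ, Completion.inner_coe, Completion.inner_coe, hin, hin, star_mul, star_star,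
            mul_assoc] }
  refine ⟨Completion P, inferInstance, inferInstance, inferInstance, π, ((1 : P) : Completion P),
    fun a => ?_, fun a ha => hext _ _ fun x => ?_⟩
  · change _ = inner ℂ _ (ρ a _)
    rw [hρ, Completion.inner_coe, hin, star_one, one_mul, mul_one]
  · change ρ a _ = _
    rw [hρ, zero_apply, ← norm_eq_zero, Completion.norm_coe]
    have := hnorm (a * x)
    rw [ha, Complex.zero_re] at this
    exact mul_self_eq_zero.1 this

omit [StarModule ℂ P] in
/-- The boundedness of the left multiplications has to be checked on generators only. -/
theorem bounded_mul {f : P →ₗ[ℂ] ℂ} {a b : P}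
    (hf : ∀ x, 0 ≤ f (star x * x))
    (ha : ∃ C : ℝ, ∀ x, (f (star (a * x) * (a * x))).re ≤ C * (f (star x * x)).re)
    (hb : ∃ C : ℝ, ∀ x, (f (star (b * x) * (b * x))).re ≤ C * (f (star x * x)).re) :
    ∃ C : ℝ, ∀ x, (f (star (a * b * x) * (a * b * x))).re ≤ C * (f (star x * x)).re := by
  obtain ⟨C, hC⟩ := ha
  obtain ⟨D, hD⟩ := hb
  refine ⟨|C| * D, fun x => ?_⟩
  rw [mul_assoc a b x, mul_assoc]
  have h1 := (Complex.le_def.1 (hf (b * x))).1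
  refine (hC _).trans ((mul_le_mul_of_nonneg_right (le_abs_self C) h1).trans ?_)
  exact mul_le_mul_of_nonneg_left (hD x) (abs_nonneg _)

omit [StarModule ℂ P] in
theorem bounded_add {f : P →ₗ[ℂ] ℂ} {a b : P}
    (hf : ∀ x, 0 ≤ f (star x * x))
    (ha : ∃ C : ℝ, ∀ x, (f (star (a * x) * (a * x))).re ≤ C * (f (star x * x)).re)
    (hb : ∃ C : ℝ, ∀ x, (f (star (b * x) * (b * x))).re ≤ C * (f (star x * x)).re) :
    ∃ C : ℝ, ∀ x, (f (star ((a + b) * x) * ((a + b) * x))).re ≤ C * (f (star x * x)).re := by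
  obtain ⟨C, hC⟩ := ha
  obtain ⟨D, hD⟩ := hb
  -- Positivity at `a x - b x` bounds the cross terms, so the square of the sum is at most twice the
  -- sum of the squares.
  refine ⟨2 * C + 2 * D, fun x => ?_⟩
  have h1 := (Complex.le_def.1 (hf (a * x - b * x))).1
  have h2 := hC x
  have h3 := hD x
  rw [add_mul]
  generalize a * x = y at *
  generalize b * x = z at *
  simp only [star_add, star_sub, add_mul, mul_add, sub_mul, mul_sub, map_add, map_sub,
    Complex.add_re, Complex.sub_re, Complex.zero_re] at h1 ⊢
  linarith

theorem bounded_algebraMap {f : P →ₗ[ℂ] ℂ} (c : ℂ) :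
    ∃ C : ℝ, ∀ x, (f (star (algebraMap ℂ P c * x) * (algebraMap ℂ P c * x))).re ≤
      C * (f (star x * x)).re := by
  refine ⟨‖c‖ ^ 2, fun x => le_of_eq ?_⟩
  rw [Algebra.algebraMap_eq_smul_one, smul_mul_assoc, one_mul, star_smul, smul_mul_assoc,
    mul_smul_comm, map_smul, map_smul, smul_smul, smul_eq_mul, Complex.star_def,
    Complex.conj_mul', ← Complex.ofReal_pow, Complex.re_ofReal_mul]

/-- The vector state bound. -/
theorem norm_inner_apply_le {H : Type v} [NormedAddCommGroup H] [InnerProductSpace ℂ H]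
    (Ω : H) (T : H →L[ℂ] H) : ‖inner ℂ Ω (T Ω)‖ ≤ ‖Ω‖ ^ 2 * ‖T‖ := by
  calc ‖inner ℂ Ω (T Ω)‖ ≤ ‖Ω‖ * ‖T Ω‖ := norm_inner_le_norm _ _
    _ ≤ ‖Ω‖ * (‖T‖ * ‖Ω‖) := by gcongr; exact T.le_opNorm _
    _ = ‖Ω‖ ^ 2 * ‖T‖ := by ring

end GNS

open scoped ComplexOrder Matrix

/-! ### Compatibility of the projections with contractions -/

section Contraction

variable {X : Type u} [Fintype X] [DecidableEq X]

/-- With `c` the insertion of a cup, this is the commutation `P c = c P`. Both sides equal `P c P`,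
because `c` and its adjoint, the cap, preserve the noncrossing spans. This is why the Haar
functional respects the biunitarity relations. -/
theorem sum_ncProj_col (x : ColoredWord) (a : Bool) (y : ColoredWord) (i j j' : List X)
    (hj : j.length = x.length) :
    ∑ b, ncProj (x ++ a :: (!a) :: y) i (j ++ b :: b :: j') =
      cup x.length (fun i => ncProj (x ++ y) i (j ++ j')) i := by
  have h1 := cup_mem_ncSpan a (ncProj_mem (x ++ y) (j ++ j'))
  have hn : (x ++ a :: (!a) :: y).length = x.length + y.length + 2 := by simp; omega
  have h2 := cap_mem_ncSpan (ncProj_mem (x ++ a :: (!a) :: y) i)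
  have h3 : ∀ l, cap x.length (fun l => ncProj (x ++ a :: (!a) :: y) i l) l =
      starRingEnd ℂ (cap x.length (fun l => ncProj (x ++ a :: (!a) :: y) l i) l) := fun l => by
    have := cap_map ((starRingEnd ℂ : ℂ →+* ℂ) : ℂ →+ ℂ) x.length
      (fun l => ncProj (x ++ a :: (!a) :: y) l i) l
    simpa [ncProj_conj] using this
  have h4 := sum_ncProj_mul h2 (j ++ j')
  rw [← sum_ncProj_mul h1 i, hn]
  simp only [mul_comm (ncProj (x ++ a :: (!a) :: y) i _)]
  have h5 := sum_cup_smul (n := x.length + y.length) (p := x.length) (Nat.le_add_right _ _)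
    (fun i => ncProj (x ++ y) i (j ++ j')) fun l => ncProj (x ++ a :: (!a) :: y) i l
  simp only [smul_eq_mul] at h5
  rw [h5]
  rw [← hj, ← cap_append, hj, h3, ← h4, map_sum, List.length_append]
  refine Finset.sum_congr rfl fun l _ => ?_
  rw [map_mul, ncProj_conj, h3]

theorem sum_ncProj_row (x : ColoredWord) (a : Bool) (y : ColoredWord) (i i' j : List X)
    (hi : i.length = x.length) :
    ∑ b, ncProj (x ++ a :: (!a) :: y) (i ++ b :: b :: i') j =
      cup x.length (fun j => ncProj (x ++ y) (i ++ i') j) j := by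
  have h := congrArg (starRingEnd ℂ) (sum_ncProj_col x a y j i i' hi)
  rw [map_sum, ← cup_map (starRingEnd ℂ) (map_zero _)] at h
  simpa only [ncProj_conj] using h

end Contraction

/-! ### Words as a spanning set of the free *-algebra -/

section FreeState

variable {X : Type u}

/-- The words in the letters `x`, `x*` seen as elements of the free `*`-algebra. -/
def monomial (w : List (X × Bool)) : FreeStarAlgebra X := (w.map FreeStarAlgebra.letter).prod

theorem monomial_append (w z : List (X × Bool)) :
    monomial (w ++ z) = monomial w * monomial z := by
  simp [monomial]

theorem monomial_nil : monomial ([] : List (X × Bool)) = 1 := rfl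

theorem monomial_singleton (y : X × Bool) : monomial [y] = FreeStarAlgebra.letter y := by
  simp [monomial]

theorem star_monomial (w : List (X × Bool)) :
    star (monomial w) = monomial (w.map fun y => (y.1, !y.2)).reverse := by
  induction w with
  | nil => simp [monomial]
  | cons y w ih =>
    rw [show y :: w = [y] ++ w from rfl, monomial_append, star_mul, ih, monomial_singleton,
      FreeStarAlgebra.star_letter]
    simp [monomial_append, monomial_singleton]

theorem monomial_eq (w : List (X × Bool)) : monomial w =
    (MonoidAlgebra.of ℂ (FreeMonoid (X × Bool)) (FreeMonoid.ofList w) :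
      MonoidAlgebra ℂ (FreeMonoid (X × Bool))) := by
  induction w with
  | nil => rfl
  | cons y w ih =>
    rw [show y :: w = [y] ++ w from rfl, monomial_append, ih, monomial_singleton]
    exact (map_mul (MonoidAlgebra.of ℂ (FreeMonoid (X × Bool))) (FreeMonoid.of y)
      (FreeMonoid.ofList w)).symm

theorem exists_eq_sum_monomial (x : FreeStarAlgebra X) :
    ∃ (T : Finset (List (X × Bool))) (c : List (X × Bool) → ℂ),
      x = ∑ w ∈ T, c w • monomial w := by
  classical
  refine ⟨(MonoidAlgebra.coeff x).support.image FreeMonoid.toList,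
    fun w => MonoidAlgebra.coeff x (FreeMonoid.ofList w), ?_⟩
  refine Eq.trans ?_ (Finset.sum_image FreeMonoid.toList.injective.injOn).symm
  refine (MonoidAlgebra.sum_coeff_single (R := ℂ) (M := FreeMonoid (X × Bool)) x).symm.trans ?_
  rw [Finsupp.sum]
  refine Finset.sum_congr rfl fun w _ => ?_
  rw [monomial_eq]
  refine Eq.trans ?_ (MonoidAlgebra.smul_single _ _ _).symm
  rw [smul_eq_mul, mul_one]
  rfl

/-- The linear form on the free `*`-algebra having prescribed values on the words. -/
def monomialForm (q : List (X × Bool) → ℂ) : FreeStarAlgebra X →ₗ[ℂ] ℂ :=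
  (Finsupp.linearCombination ℂ fun w : FreeMonoid (X × Bool) => q w.toList) ∘ₗ
    (MonoidAlgebra.coeffLinearEquiv (S := ℂ) (M := FreeMonoid (X × Bool)) ℂ).toLinearMap

theorem monomialForm_monomial (q : List (X × Bool) → ℂ) (w : List (X × Bool)) :
    monomialForm q (monomial w) = q w := by
  rw [monomial_eq]
  refine (Finsupp.linearCombination_single ℂ (1 : ℂ) (FreeMonoid.ofList w)).trans ?_
  rw [one_smul]
  rfl

end FreeState

/-! ### The Haar functional: positivity, relations, extension to the C*-algebra -/

section CoordinateState

variable {N : ℕ}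

/-- The words in the coordinates, as triples formed by a colored word and by two multi-indices. -/
def colors (w : List ((Fin N × Fin N) × Bool)) : ColoredWord := w.map fun y => y.2

/-- The row indices of a word in the coordinates. -/
def rows (w : List ((Fin N × Fin N) × Bool)) : List (Fin N) := w.map fun y => y.1.1

/-- The column indices of a word in the coordinates. -/
def cols (w : List ((Fin N × Fin N) × Bool)) : List (Fin N) := w.map fun y => y.1.2

/-- The Haar functional, on the free `*`-algebra. -/
def haarForm (N : ℕ) : FreeStarAlgebra (Fin N × Fin N) →ₗ[ℂ] ℂ :=
  monomialForm fun w => ncProj (colors w) (rows w) (cols w)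

theorem haarForm_monomial (w : List ((Fin N × Fin N) × Bool)) :
    haarForm N (monomial w) = ncProj (colors w) (rows w) (cols w) := monomialForm_monomial _ _

theorem haarForm_nonneg (x : FreeStarAlgebra (Fin N × Fin N)) :
    0 ≤ haarForm N (star x * x) := by
  obtain ⟨T, c, rfl⟩ := exists_eq_sum_monomial x
  have h := ncProj_nonneg T colors rows cols (fun w => by simp [rows, colors])
    (fun w => by simp [cols, colors]) c
  convert h using 1
  rw [star_sum, Finset.sum_mul_sum, map_sum]
  refine Finset.sum_congr rfl fun s _ => ?_
  rw [map_sum]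
  refine Finset.sum_congr rfl fun t _ => ?_
  rw [star_smul, smul_mul_assoc, mul_smul_comm, map_smul, map_smul, star_monomial,
    ← monomial_append, haarForm_monomial, smul_eq_mul, smul_eq_mul, ← mul_assoc]
  congr 1
  simp [colors, rows, cols, ColoredWord.conj, Function.comp_def]

/-- Column contractions of the projections, giving `uu* = 1` for `a = true` and `ūuᵗ = 1` for `a =
false`. The factors `x` and `y` give vanishing on the two-sided ideal, as needed for GNS. -/
theorem haarForm_col (x y : FreeStarAlgebra (Fin N × Fin N)) (a : Bool) (i j : Fin N) :
    haarForm N (x * (∑ m, FreeStarAlgebra.letter ((i, m), a) *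
      FreeStarAlgebra.letter ((j, m), !a) - (1 : Matrix (Fin N) (Fin N) _) i j) * y) = 0 := by
  obtain ⟨S, c, rfl⟩ := exists_eq_sum_monomial x
  obtain ⟨T, d, rfl⟩ := exists_eq_sum_monomial y
  simp only [Finset.sum_mul, Finset.mul_sum, map_sum, smul_mul_assoc, mul_smul_comm, map_smul,
    Finset.smul_sum]
  refine Finset.sum_eq_zero fun s _ => Finset.sum_eq_zero fun t _ => ?_
  suffices h : haarForm N (monomial t * (∑ m, FreeStarAlgebra.letter ((i, m), a) *
      FreeStarAlgebra.letter ((j, m), !a) - (1 : Matrix (Fin N) (Fin N) _) i j) * monomial s) = 0 by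
    rw [h, smul_zero, smul_zero]
  have h1 : ∀ m, monomial t * (FreeStarAlgebra.letter ((i, m), a) *
      FreeStarAlgebra.letter ((j, m), !a)) * monomial s =
      monomial (t ++ ((i, m), a) :: ((j, m), !a) :: s) := fun m => by
    simp [monomial, mul_assoc]
  have h2 : monomial t * (1 : Matrix (Fin N) (Fin N) (FreeStarAlgebra (Fin N × Fin N))) i j *
      monomial s = if i = j then monomial (t ++ s) else 0 := by
    rw [Matrix.one_apply]
    split_ifs <;> simp [monomial_append]
  rw [mul_sub, sub_mul, h2, Finset.mul_sum, Finset.sum_mul, map_sub, map_sum]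
  simp only [h1, haarForm_monomial]
  have h3 := sum_ncProj_col (colors t) a (colors s) (rows t ++ i :: j :: rows s) (cols t) (cols s)
    (by simp [cols, colors])
  rw [show (colors t).length = (rows t).length by simp [rows, colors], cup_append] at h3
  simp only [colors, rows, cols, List.map_append, List.map_cons] at h3 ⊢
  rw [h3]
  split_ifs
  · rw [haarForm_monomial]
    simp [colors, rows, cols]
  · simp

/-- Row contractions likewise give `uᵗū = 1` for `a = true` and `u*u = 1` for `a = false`. -/
theorem haarForm_row (x y : FreeStarAlgebra (Fin N × Fin N)) (a : Bool) (i j : Fin N) :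
    haarForm N (x * (∑ m, FreeStarAlgebra.letter ((m, i), a) *
      FreeStarAlgebra.letter ((m, j), !a) - (1 : Matrix (Fin N) (Fin N) _) i j) * y) = 0 := by
  obtain ⟨S, c, rfl⟩ := exists_eq_sum_monomial x
  obtain ⟨T, d, rfl⟩ := exists_eq_sum_monomial y
  simp only [Finset.sum_mul, Finset.mul_sum, map_sum, smul_mul_assoc, mul_smul_comm, map_smul,
    Finset.smul_sum]
  refine Finset.sum_eq_zero fun s _ => Finset.sum_eq_zero fun t _ => ?_
  suffices h : haarForm N (monomial t * (∑ m, FreeStarAlgebra.letter ((m, i), a) *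
      FreeStarAlgebra.letter ((m, j), !a) - (1 : Matrix (Fin N) (Fin N) _) i j) * monomial s) = 0 by
    rw [h, smul_zero, smul_zero]
  have h1 : ∀ m, monomial t * (FreeStarAlgebra.letter ((m, i), a) *
      FreeStarAlgebra.letter ((m, j), !a)) * monomial s =
      monomial (t ++ ((m, i), a) :: ((m, j), !a) :: s) := fun m => by
    simp [monomial, mul_assoc]
  have h2 : monomial t * (1 : Matrix (Fin N) (Fin N) (FreeStarAlgebra (Fin N × Fin N))) i j *
      monomial s = if i = j then monomial (t ++ s) else 0 := by
    rw [Matrix.one_apply]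
    split_ifs <;> simp [monomial_append]
  rw [mul_sub, sub_mul, h2, Finset.mul_sum, Finset.sum_mul, map_sub, map_sum]
  simp only [h1, haarForm_monomial]
  have h3 := sum_ncProj_row (colors t) a (colors s) (rows t) (rows s) (cols t ++ i :: j :: cols s)
    (by simp [rows, colors])
  rw [show (colors t).length = (cols t).length by simp [cols, colors], cup_append] at h3
  simp only [colors, rows, cols, List.map_append, List.map_cons] at h3 ⊢
  rw [h3]
  split_ifs
  · rw [haarForm_monomial]
    simp [colors, rows, cols]
  · simp

/-- It is enough to treat the letters. A row relation writes the value at `star x * x` as a sum of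
nonnegative terms, and the term to be bounded is one of them. -/
theorem isBoundedPositive_haarForm : IsBoundedPositive (haarForm N) := by
  refine ⟨haarForm_nonneg, FreeStarAlgebra.induction (fun c => bounded_algebraMap c)
    (fun y => ?_) (fun a b ha hb => bounded_add haarForm_nonneg ha hb)
    fun a b ha hb => bounded_mul haarForm_nonneg ha hb⟩
  obtain ⟨⟨i, j⟩, a⟩ := y
  refine ⟨1, fun x => ?_⟩
  have h := haarForm_row (star x) x (!a) j j
  rw [Bool.not_not, Matrix.one_apply_eq, mul_sub, sub_mul, mul_one, map_sub, sub_eq_zero,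
    Finset.mul_sum, Finset.sum_mul, map_sum] at h
  rw [one_mul, ← h, Complex.re_sum]
  have h1 : ∀ m, haarForm N (star x * (FreeStarAlgebra.letter ((m, j), !a) *
      FreeStarAlgebra.letter ((m, j), a)) * x) =
      haarForm N (star (FreeStarAlgebra.letter ((m, j), a) * x) *
        (FreeStarAlgebra.letter ((m, j), a) * x)) := fun m => by
    rw [star_mul, FreeStarAlgebra.star_letter]
    simp only [mul_assoc]
  simp only [h1]
  exact Finset.single_le_sum
    (f := fun m => (haarForm N (star (FreeStarAlgebra.letter ((m, j), a) * x)
    * (FreeStarAlgebra.letter ((m, j), a) * x))).re)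
    (fun m _ => (Complex.le_def.1 (haarForm_nonneg _)).1) (Finset.mem_univ i)

theorem haarForm_relation {r : FreeStarAlgebra (Fin N × Fin N)} (hr : r ∈ biunitaryRelations N)
    (x y : FreeStarAlgebra (Fin N × Fin N)) : haarForm N (x * r * y) = 0 := by
  have key : ∀ (w z : Matrix (Fin N) (Fin N) (FreeStarAlgebra (Fin N × Fin N)))
      (f : Fin N → FreeStarAlgebra (Fin N × Fin N)) (i j : Fin N), (∀ m, w i m * z m j = f m) →
      haarForm N (x * (∑ m, f m - (1 : Matrix (Fin N) (Fin N) _) i j) * y) = 0 →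
      haarForm N (x * (w * z - 1) i j * y) = 0 := fun w z f i j hf h0 => by
    rwa [Matrix.sub_apply, Matrix.mul_apply, Finset.sum_congr rfl fun m _ => hf m]
  have hs : ∀ i j, star (genericMatrix N i j) = FreeStarAlgebra.letter ((i, j), false) :=
    fun i j => FreeStarAlgebra.star_var (i, j)
  obtain ⟨i, j, rfl | rfl | rfl | rfl⟩ := hr
  · exact key _ _ _ i j (fun m => congrArg _ (hs j m)) (haarForm_col x y true i j)
  · exact key _ _ _ i j (fun m => congrArg (· * _) (hs m i)) (haarForm_row x y false i j)
  · exact key _ _ _ i j (fun m => congrArg _ (hs m j)) (haarForm_row x y true i j)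
  · exact key _ _ _ i j (fun m => congrArg (· * _) (hs i m)) (haarForm_col x y false i j)

/-- The Haar functional extends to `C(U_N⁺)`. -/
theorem exists_state (N : ℕ) : ∃ h : FreeUnitaryAlgebra N →L[ℂ] ℂ,
    (∀ a, 0 ≤ h (star a * a)) ∧
    ∀ w, h (UniversalCStar.of (hasMaxSeminorm_biunitary N) (monomial w)) =
      ncProj (colors w) (rows w) (cols w) := by
  obtain ⟨H, _, _, _, π, Ω, h1, h2⟩ := (isBoundedPositive_haarForm (N := N)).exists_gns
  -- The functional vanishes on the ideal of the relations, so each relation annihilates all the GNS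
  -- vectors.
  have h3 : ∀ r ∈ biunitaryRelations N, π r = 0 := fun r hr => h2 r fun x => by
    have := haarForm_relation hr (star (r * x)) x
    rwa [mul_assoc] at this
  let ρ := UniversalCStar.lift (hasMaxSeminorm_biunitary N) π h3
  have hρ : ∀ a, ρ (UniversalCStar.of (hasMaxSeminorm_biunitary N) a) = π a :=
    UniversalCStar.lift_of (hasMaxSeminorm_biunitary N) π h3
  let h : FreeUnitaryAlgebra N →ₗ[ℂ] ℂ :=
    { toFun := fun a => inner ℂ Ω (ρ a Ω)
      map_add' := fun a b => by rw [map_add, add_apply, inner_add_right]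
      map_smul' := fun c a => by
        rw [map_smul, smul_apply, inner_smul_right]; rfl }
  refine ⟨h.mkContinuous (‖Ω‖ ^ 2) fun a => ?_, fun a => ?_, fun w => ?_⟩
  · refine (norm_inner_apply_le Ω (ρ a)).trans ?_
    gcongr
    exact NonUnitalStarAlgHom.norm_apply_le ρ a
  · change 0 ≤ inner ℂ Ω (ρ (star a * a) Ω)
    rw [map_mul, map_star, mul_apply_eq_comp, ContinuousLinearMap.star_eq_adjoint,
      ContinuousLinearMap.adjoint_inner_right, inner_self_eq_norm_sq_to_K]
    positivity
  · change inner ℂ Ω (ρ _ Ω) = _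
    rw [hρ, ← h1, haarForm_monomial]

end CoordinateState

open scoped ComplexOrder Matrix

/-! ### Tensor powers of a biunitary matrix and their fixed vectors -/

section Coefficients

variable {X : Type u} {B : Type v} [Ring B] [StarRing B]

/-- The entries of `w` and of its conjugate. -/
def letterCoef (w : Matrix X X B) (a : Bool) (i j : X) : B := if a then w i j else star (w i j)

/-- The entries of the tensor powers of the matrix `w`. -/
def coef (w : Matrix X X B) : ColoredWord → List X → List X → B
  | [], [], [] => 1
  | a :: k, b :: i, c :: j => letterCoef w a b c * coef w k i j
  | _, _, _ => 0

variable (w : Matrix X X B)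

theorem star_letterCoef (a : Bool) (i j : X) :
    star (letterCoef w a i j) = letterCoef w (!a) i j := by
  cases a <;> simp [letterCoef]

theorem coef_nil : coef w [] [] [] = 1 := by simp [coef]

theorem coef_cons (a : Bool) (k : ColoredWord) (b c : X) (i j : List X) :
    coef w (a :: k) (b :: i) (c :: j) = letterCoef w a b c * coef w k i j := by simp [coef]

theorem coef_cons_nil_left (a : Bool) (k : ColoredWord) (j : List X) :
    coef w (a :: k) [] j = 0 := by simp [coef]

theorem coef_cons_nil_right (a : Bool) (k : ColoredWord) (i : List X) :
    coef w (a :: k) i [] = 0 := by simp [coef]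

theorem coef_singleton (a : Bool) (b c : X) : coef w [a] [b] [c] = letterCoef w a b c := by
  rw [coef_cons, coef_nil, mul_one]

theorem coef_append {k l : ColoredWord} {i i' j j' : List X} (hi : i.length = k.length)
    (hj : j.length = k.length) :
    coef w (k ++ l) (i ++ i') (j ++ j') = coef w k i j * coef w l i' j' := by
  induction k generalizing i j with
  | nil =>
    rw [List.length_eq_zero_iff.1 hi, List.length_eq_zero_iff.1 hj, coef_nil, one_mul]
    rfl
  | cons a k ih =>
    match i, j, hi, hj with
    | b :: i, c :: j, hi, hj =>
      simp only [List.cons_append, coef_cons]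
      rw [ih (by simpa using hi) (by simpa using hj), mul_assoc]

theorem star_coef {k : ColoredWord} {i j : List X} (hi : i.length = k.length)
    (hj : j.length = k.length) :
    star (coef w k i j) = coef w (ColoredWord.conj k) i.reverse j.reverse := by
  induction k generalizing i j with
  | nil =>
    rw [List.length_eq_zero_iff.1 hi, List.length_eq_zero_iff.1 hj]
    simp [conj_nil, coef_nil]
  | cons a k ih =>
    match i, j, hi, hj with
    | b :: i, c :: j, hi, hj =>
      have hi' : i.length = k.length := by simpa using hi
      have hj' : j.length = k.length := by simpa using hj
      rw [coef_cons, star_mul, ih hi' hj', conj_cons, List.reverse_cons, List.reverse_cons,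
        coef_append w (by simp [length_conj, hi']) (by simp [length_conj, hj']), coef_singleton,
        star_letterCoef]

variable [Fintype X] [DecidableEq X] {w} (hw : IsBiunitary w)
include hw

theorem sum_letterCoef_row (a : Bool) (c d : X) :
    ∑ b, letterCoef w a b c * letterCoef w (!a) b d = if c = d then 1 else 0 := by
  cases a
  · have := congrFun (congrFun hw.conjTranspose_mul c) d
    simpa [letterCoef, Matrix.mul_apply, Matrix.one_apply] using this
  · have := congrFun (congrFun hw.transpose_mul_conj c) d
    simpa [letterCoef, Matrix.mul_apply, Matrix.one_apply] using this

theorem sum_letterCoef_col (a : Bool) (c d : X) :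
    ∑ b, letterCoef w a c b * letterCoef w (!a) d b = if c = d then 1 else 0 := by
  cases a
  · have := congrFun (congrFun hw.conj_mul_transpose c) d
    simpa [letterCoef, Matrix.mul_apply, Matrix.one_apply] using this
  · have := congrFun (congrFun hw.mul_conjTranspose c) d
    simpa [letterCoef, Matrix.mul_apply, Matrix.one_apply] using this

/-- In diagrams: the contraction intertwines the tensor powers. Biunitarity turns the contracted
pair of row indices into a Kronecker delta on the corresponding column indices, that is, into a cup.
-/
theorem cap_coef_row (x : ColoredWord) (a : Bool) (y : ColoredWord) (i j : List X) :
    cap x.length (fun i => coef w (x ++ a :: (!a) :: y) i j) i =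
      cup x.length (fun j => coef w (x ++ y) i j) j := by
  induction x generalizing i j with
  | nil =>
    change ∑ b, coef w (a :: (!a) :: y) (b :: b :: i) j = cup 0 (fun j => coef w y i j) j
    match j with
    | [] => simp [coef_cons_nil_right, cup]
    | [c] => simp [coef_cons_nil_right, coef_cons, cup]
    | c :: d :: j =>
      simp only [coef_cons, ← mul_assoc, ← Finset.sum_mul, sum_letterCoef_row hw, cup]
      split_ifs <;> simp
  | cons e x ih =>
    match i, j with
    | [], j =>
      simp only [List.cons_append, coef_cons_nil_left, cup_zero]
      rfl
    | b :: i, [] =>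
      simp only [List.cons_append, coef_cons_nil_right, cap_zero]
      rfl
    | b :: i, c :: j =>
      simp only [List.cons_append, List.length_cons, cap, cup, coef_cons]
      rw [cup_map (fun z => letterCoef w e b c * z) (mul_zero _), ← ih]
      exact cap_map (AddMonoidHom.mulLeft (letterCoef w e b c)) _ _ _

theorem cap_coef_col (x : ColoredWord) (a : Bool) (y : ColoredWord) (i j : List X) :
    cap x.length (fun j => coef w (x ++ a :: (!a) :: y) i j) j =
      cup x.length (fun i => coef w (x ++ y) i j) i := by
  induction x generalizing i j with
  | nil =>
    change ∑ b, coef w (a :: (!a) :: y) i (b :: b :: j) = cup 0 (fun i => coef w y i j) i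
    match i with
    | [] => simp [coef_cons_nil_left, cup]
    | [c] => simp [coef_cons_nil_left, coef_cons, cup]
    | c :: d :: i =>
      simp only [coef_cons, ← mul_assoc, ← Finset.sum_mul, sum_letterCoef_col hw, cup]
      split_ifs <;> simp
  | cons e x ih =>
    match i, j with
    | i, [] =>
      simp only [List.cons_append, coef_cons_nil_right, cup_zero]
      rfl
    | [], c :: j =>
      simp only [List.cons_append, coef_cons_nil_left, cap_zero]
      rfl
    | b :: i, c :: j =>
      simp only [List.cons_append, List.length_cons, cap, cup, coef_cons]
      rw [cup_map (fun z => letterCoef w e b c * z) (mul_zero _), ← ih]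
      exact cap_map (AddMonoidHom.mulLeft (letterCoef w e b c)) _ _ _

theorem sum_coef_mul_star {k : ColoredWord} {i j : List X} (hi : i.length = k.length)
    (hj : j.length = k.length) :
    ∑ l ∈ lists X k.length, coef w k i l * star (coef w k j l) = if i = j then 1 else 0 := by
  induction k generalizing i j with
  | nil =>
    rw [List.length_eq_zero_iff.1 hi, List.length_eq_zero_iff.1 hj]
    simp [sum_lists_zero, coef_nil]
  | cons a k ih =>
    match i, j, hi, hj with
    | b :: i, c :: j, hi, hj =>
      have h : ∀ d l, coef w (a :: k) (b :: i) (d :: l) * star (coef w (a :: k) (c :: j) (d :: l)) =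
          letterCoef w a b d * (coef w k i l * star (coef w k j l)) * letterCoef w (!a) c d :=
        fun d l => by simp only [coef_cons, star_mul, star_letterCoef, mul_assoc]
      simp only [List.length_cons, sum_lists_succ, h, ← Finset.sum_mul, ← Finset.mul_sum,
        ih (i := i) (j := j) (by simpa using hi) (by simpa using hj), List.cons.injEq]
      by_cases hij : i = j
      · simp only [hij, if_true, mul_one, and_true, sum_letterCoef_col hw]
      · simp [hij]

theorem sum_star_mul_coef {k : ColoredWord} {i j : List X} (hi : i.length = k.length)
    (hj : j.length = k.length) :
    ∑ l ∈ lists X k.length, star (coef w k l i) * coef w k l j = if i = j then 1 else 0 := by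
  induction k generalizing i j with
  | nil =>
    rw [List.length_eq_zero_iff.1 hi, List.length_eq_zero_iff.1 hj]
    simp [sum_lists_zero, coef_nil]
  | cons a k ih =>
    match i, j, hi, hj with
    | b :: i, c :: j, hi, hj =>
      have h : ∀ d l, star (coef w (a :: k) (d :: l) (b :: i)) * coef w (a :: k) (d :: l) (c :: j) =
          star (coef w k l i) * (letterCoef w (!a) d b * letterCoef w (!!a) d c) * coef w k l j :=
        fun d l => by
          rw [Bool.not_not]
          simp only [coef_cons, star_mul, star_letterCoef, mul_assoc]
      simp only [List.length_cons, sum_lists_succ, h]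
      rw [Finset.sum_comm]
      simp only [← Finset.sum_mul, ← Finset.mul_sum, sum_letterCoef_row hw, List.cons.injEq]
      by_cases hbc : b = c
      · simp only [hbc, if_true, mul_one, true_and]
        exact ih (by simpa using hi) (by simpa using hj)
      · simp [hbc]

/-- This concerns the entrywise conjugate of the tensor power, so plain unitarity of `w` is not
enough: the relation for `w.map star * wᵀ` enters. It is the form needed for Frobenius duality. -/
theorem sum_star_mul_coef' {k : ColoredWord} {i j : List X} (hi : i.length = k.length)
    (hj : j.length = k.length) :
    ∑ l ∈ lists X k.length, star (coef w k i l) * coef w k j l = if i = j then 1 else 0 := by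
  induction k generalizing i j with
  | nil =>
    rw [List.length_eq_zero_iff.1 hi, List.length_eq_zero_iff.1 hj]
    simp [sum_lists_zero, coef_nil]
  | cons a k ih =>
    match i, j, hi, hj with
    | b :: i, c :: j, hi, hj =>
      have h : ∀ d l, star (coef w (a :: k) (b :: i) (d :: l)) * coef w (a :: k) (c :: j) (d :: l) =
          star (coef w k i l) * (letterCoef w (!a) b d * letterCoef w (!!a) c d) * coef w k j l :=
        fun d l => by
          rw [Bool.not_not]
          simp only [coef_cons, star_mul, star_letterCoef, mul_assoc]
      simp only [List.length_cons, sum_lists_succ, h]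
      rw [Finset.sum_comm]
      simp only [← Finset.sum_mul, ← Finset.mul_sum, sum_letterCoef_col hw, List.cons.injEq]
      by_cases hbc : b = c
      · simp only [hbc, if_true, mul_one, true_and]
        exact ih (by simpa using hi) (by simpa using hj)
      · simp [hbc]

/-- The noncrossing vectors are fixed by the tensor powers of `w`. -/
theorem sum_ncSpan_smul_coef [Algebra ℂ B] {k : ColoredWord} {f : List X → ℂ}
    (hf : f ∈ ncSpan X k) (i : List X) :
    ∑ j ∈ lists X k.length, f j • coef w k i j = f i • (1 : B) := by
  refine ncSpan_induction (p := fun f => ∀ i, ∑ j ∈ lists X k.length, f j • coef w k i j =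
    f i • (1 : B)) hf (fun f h => ?_) (fun i => by simp) (fun f g hf hg i => ?_)
    (fun c f hf i => ?_) i
  · clear hf
    induction h with
    | nil =>
      intro i
      cases i with
      | nil => simp [sum_lists_zero, unitVec, coef_nil]
      | cons b i => simp [unitVec, coef]
    | cup x a y f hf ih =>
      intro i
      rw [show (x ++ a :: (!a) :: y).length = (x ++ y).length + 2 by simp; omega,
        sum_cup_smul (by simp)]
      simp only [cap_coef_col hw]
      have h := cup_sum (lists X (x ++ y).length) x.length
        (fun l i => f l • coef w (x ++ y) i l) i
      simp only [ih] at h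
      rw [cup_map (fun z : ℂ => z • (1 : B)) (zero_smul _ _)] at h
      rw [h]
      exact Finset.sum_congr rfl fun l _ => (cup_map (fun z => f l • z) (smul_zero _) _ _ _).symm
  · simp only [Pi.add_apply, add_smul, Finset.sum_add_distrib, hf i, hg i]
  · simp only [Pi.smul_apply, smul_eq_mul, mul_smul, ← Finset.smul_sum, hf i]

end Coefficients

/-! ### Rotation invariance of the projections -/

section Rotation

variable {X : Type u} [Fintype X] [DecidableEq X]

/-- Rotation is a unitary identification of the two noncrossing spans, so it carries one orthogonal
projection to the other. -/
theorem ncProj_rotate (a : Bool) (k : ColoredWord) (b c : X) (i j : List X)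
    (hi : i.length = k.length) (hj : j.length = k.length) :
    ncProj (k ++ [a]) (i ++ [b]) (j ++ [c]) = ncProj (a :: k) (b :: i) (c :: j) := by
  have hr : ∀ (l : List X) (d : X), l.length = k.length → (l ++ [d]).rotate k.length = d :: l :=
    fun l d hl => by rw [← hl, List.rotate_append_length_eq]; rfl
  have h := eq_ncProj (k := k ++ [a]) (i := i ++ [b]) (j := j ++ [c])
    (Q := fun i j => ncProj (a :: k) (i.rotate k.length) (j.rotate k.length))
    (fun j _ => rotate_mem_ncSpan (ncProj_mem (a :: k) (j.rotate k.length)))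
    (fun i j => ncProj_conj _ _ _) (fun f hf m hm => ?_) (by simp [hj])
  · simp only [hr _ _ hi, hr _ _ hj] at h
    exact h.symm
  · have h1 := conj_reverse_mem_ncSpan hf
    rw [conj_append, show ColoredWord.conj [a] = [!a] from rfl, List.singleton_append] at h1
    have h2 := conj_reverse_mem_ncSpan (rotate_mem_ncSpan h1)
    rw [conj_append, conj_conj, show ColoredWord.conj [!a] = [!!a] from rfl, Bool.not_not,
      List.singleton_append, length_conj] at h2
    simp only [RingHomCompTriple.comp_apply, RingHom.id_apply] at h2
    have hf' : ∀ (l : List X) (d : X), l.length = k.length →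
        f (((d :: l).reverse.rotate k.length).reverse) = f (l ++ [d]) := fun l d hl => by
      rw [List.reverse_cons, hr _ _ (by simpa using hl)]
      simp
    obtain ⟨i, n, rfl, hi, hn⟩ := exists_split (p := k.length) (by simp) hm
    obtain ⟨b, rfl⟩ := List.length_eq_one_iff.1 (hn.trans (by simp))
    have h3 := sum_ncProj_mul h2 (b :: i)
    rw [hf' _ _ hi, List.length_cons, sum_lists_succ] at h3
    rw [List.length_append, sum_lists_add, List.length_singleton, ← h3]
    simp only [sum_lists_one]
    rw [Finset.sum_comm]
    refine Finset.sum_congr rfl fun d _ => Finset.sum_congr rfl fun l hl => ?_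
    rw [mem_lists] at hl
    rw [hf' _ _ hl, hr _ _ hl, hr _ _ hi]

end Rotation

/-! ### Positive functionals, states and slice maps on the maximal tensor product -/

section Slices

open scoped ComplexOrder InnerProductSpace TensorProduct

theorem star_mul_norm_sub {A : Type u} [CStarAlgebra A] (a : A) :
    ∃ d : A, star d * d = algebraMap ℂ A (‖a‖ ^ 2 : ℝ) - star a * a := by
  let _ := CStarAlgebra.spectralOrder A
  have _ := CStarAlgebra.spectralOrderedRing A
  have h : star a * a ≤ algebraMap ℝ A (‖a‖ ^ 2) := CStarAlgebra.star_mul_le_algebraMap_norm_sq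
  obtain ⟨d, hd⟩ := CStarAlgebra.nonneg_iff_eq_star_mul_self.1 (sub_nonneg.2 h)
  exact ⟨d, hd.symm⟩

/-- Positive functionals are automatically bounded with respect to C*-subalgebras. -/
theorem bounded_of_cStarAlgebra {P : Type v} [Ring P] [StarRing P] [Algebra ℂ P] [StarModule ℂ P]
    {A : Type u} [CStarAlgebra A] (ι : A →⋆ₐ[ℂ] P) {f : P →ₗ[ℂ] ℂ}
    (hf : ∀ x, 0 ≤ f (star x * x)) (a : A) :
    ∃ C : ℝ, ∀ x, (f (star (ι a * x) * (ι a * x))).re ≤ C * (f (star x * x)).re := by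
  obtain ⟨d, hd⟩ := star_mul_norm_sub a
  refine ⟨‖a‖ ^ 2, fun x => ?_⟩
  have h := (Complex.le_def.1 (hf (ι d * x))).1
  have e : star (ι d * x) * (ι d * x) =
      ((‖a‖ ^ 2 : ℝ) : ℂ) • (star x * x) - star (ι a * x) * (ι a * x) := by
    have := congrArg ι hd
    rw [map_sub, map_mul, map_mul, AlgHomClass.commutes, map_star, map_star] at this
    rw [star_mul, mul_assoc, ← mul_assoc (star (ι d)), this, sub_mul, mul_sub, star_mul,
      Algebra.algebraMap_eq_smul_one, smul_mul_assoc, one_mul, mul_smul_comm]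
    simp only [mul_assoc]
  rw [e, map_sub, map_smul, Complex.sub_re, smul_eq_mul, Complex.re_ofReal_mul] at h
  simpa using h

theorem isBoundedPositive_of_cStarAlgebra {A : Type u} [CStarAlgebra A] {f : A →ₗ[ℂ] ℂ}
    (hf : ∀ x, 0 ≤ f (star x * x)) : IsBoundedPositive f :=
  ⟨hf, bounded_of_cStarAlgebra (StarAlgHom.id ℂ A) hf⟩

variable {A : Type u} {B : Type v} [CStarAlgebra A] [CStarAlgebra B]

/-- The tensor product of two functionals. -/
def tensorForm (f : A →ₗ[ℂ] ℂ) (g : B →ₗ[ℂ] ℂ) : A ⊗[ℂ] B →ₗ[ℂ] ℂ :=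
  LinearMap.mul' ℂ ℂ ∘ₗ TensorProduct.map f g

theorem tensorForm_tmul (f : A →ₗ[ℂ] ℂ) (g : B →ₗ[ℂ] ℂ) (a : A) (b : B) :
    tensorForm f g (a ⊗ₜ b) = f a * g b := by simp [tensorForm]

/-- The GNS vectors of the two functionals realize the form `tensorForm f g (star s * t)` as the
inner product of a tensor product of Hilbert spaces. -/
theorem tensorForm_nonneg {f : A →ₗ[ℂ] ℂ} {g : B →ₗ[ℂ] ℂ} (hf : ∀ x, 0 ≤ f (star x * x))
    (hg : ∀ x, 0 ≤ g (star x * x)) (t : A ⊗[ℂ] B) : 0 ≤ tensorForm f g (star t * t) := by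
  obtain ⟨H, _, _, _, π, Ω, hπ, -⟩ := (isBoundedPositive_of_cStarAlgebra hf).exists_gns
  obtain ⟨K, _, _, _, ρ, Θ, hρ, -⟩ := (isBoundedPositive_of_cStarAlgebra hg).exists_gns
  let p : A →ₗ[ℂ] H :=
    { toFun := fun a => π a Ω
      map_add' := fun a b => by rw [map_add, add_apply]
      map_smul' := fun c a => by rw [map_smul, smul_apply]; rfl }
  let r : B →ₗ[ℂ] K :=
    { toFun := fun a => ρ a Θ
      map_add' := fun a b => by rw [map_add, add_apply]
      map_smul' := fun c a => by rw [map_smul, smul_apply]; rfl }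
  have hp : ∀ a b, f (star a * b) = inner ℂ (p a) (p b) := fun a b => by
    rw [hπ, map_mul, map_star, mul_apply_eq_comp, ContinuousLinearMap.star_eq_adjoint,
      ContinuousLinearMap.adjoint_inner_right]
    rfl
  have hr : ∀ a b, g (star a * b) = inner ℂ (r a) (r b) := fun a b => by
    rw [hρ, map_mul, map_star, mul_apply_eq_comp, ContinuousLinearMap.star_eq_adjoint,
      ContinuousLinearMap.adjoint_inner_right]
    rfl
  have key : ∀ s t : A ⊗[ℂ] B, tensorForm f g (star s * t) =
      inner ℂ (TensorProduct.map p r s) (TensorProduct.map p r t) := fun s t => by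
    induction s with
    | zero => simp
    | add x y hx hy => rw [star_add, add_mul, map_add, hx, hy, map_add, inner_add_left]
    | tmul a b =>
      induction t with
      | zero => simp
      | add x y hx hy => rw [mul_add, map_add, hx, hy, map_add, inner_add_right]
      | tmul c d =>
        rw [TensorProduct.star_tmul, Algebra.TensorProduct.tmul_mul_tmul, tensorForm_tmul, hp, hr,
          TensorProduct.map_tmul, TensorProduct.map_tmul, TensorProduct.inner_tmul]
  rw [key]
  refine le_of_le_of_eq ?_ (inner_self_eq_norm_sq_to_K (𝕜 := ℂ) (E := H ⊗[ℂ] K)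
    (TensorProduct.map p r t)).symm
  positivity

/-- The tensor products of positive functionals are bounded. -/
theorem norm_tensorForm_le {f : A →ₗ[ℂ] ℂ} {g : B →ₗ[ℂ] ℂ} (hf : ∀ x, 0 ≤ f (star x * x))
    (hg : ∀ x, 0 ≤ g (star x * x)) (t : A ⊗[ℂ] B) :
    ‖tensorForm f g t‖ ≤ ‖f 1‖ * ‖g 1‖ *
      ‖UniversalCStar.of (hasMaxSeminorm_tensor A B) t‖ := by
  have hfg : IsBoundedPositive (tensorForm f g) := by
    refine ⟨tensorForm_nonneg hf hg, fun t => ?_⟩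
    induction t with
    | zero => exact ⟨0, fun x => by simp⟩
    | add x y hx hy => exact bounded_add (tensorForm_nonneg hf hg) hx hy
    | tmul a b =>
      have h1 := bounded_of_cStarAlgebra (P := A ⊗[ℂ] B)
        { Algebra.TensorProduct.includeLeft (R := ℂ) (S := ℂ) (A := A) (B := B) with
          map_star' := fun a => by simp } (tensorForm_nonneg hf hg) a
      have h2 := bounded_of_cStarAlgebra (P := A ⊗[ℂ] B)
        { Algebra.TensorProduct.includeRight (R := ℂ) (A := A) (B := B) with
          map_star' := fun a => by simp } (tensorForm_nonneg hf hg) b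
      have h3 : a ⊗ₜ[ℂ] b = (a ⊗ₜ[ℂ] (1 : B)) * ((1 : A) ⊗ₜ[ℂ] b) := by simp
      rw [h3]
      exact bounded_mul (tensorForm_nonneg hf hg) h1 h2
  obtain ⟨H, _, _, _, π, Ω, hπ, -⟩ := hfg.exists_gns
  have h1 : ‖Ω‖ ^ 2 = ‖f 1‖ * ‖g 1‖ := by
    have := hπ 1
    rw [Algebra.TensorProduct.one_def, tensorForm_tmul, ← Algebra.TensorProduct.one_def, map_one π]
      at this
    rw [← norm_mul, this]
    change _ = ‖inner ℂ Ω Ω‖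
    rw [inner_self_eq_norm_sq_to_K]
    simp
  rw [hπ, ← h1]
  refine (norm_inner_apply_le Ω (π t)).trans ?_
  gcongr
  -- The GNS representation of the product functional defines a C*-seminorm, dominated by the
  -- maximal one.
  have := le_maxSeminorm (hasMaxSeminorm_tensor A B)
    ⟨CStarSeminorm.comap π, fun r hr => absurd hr (Set.notMem_empty r)⟩ t
  exact this.trans ((maxSeminorm _ (hasMaxSeminorm_tensor A B)).norm_ofAlg t).ge

/-- The states detect the norm of the self-adjoint elements. -/
theorem exists_state_norm_le {s : A} (hs : IsSelfAdjoint s) :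
    ∃ φ : A →ₗ[ℂ] ℂ, (∀ x, 0 ≤ φ (star x * x)) ∧ ‖φ 1‖ ≤ 1 ∧ ‖s‖ ≤ ‖φ s‖ := by
  by_cases h0 : s = 0
  · exact ⟨0, by simp, by simp, by simp [h0]⟩
  have _ : Nontrivial A := ⟨s, 0, h0⟩
  let _ := CStarAlgebra.spectralOrder A
  have _ := CStarAlgebra.spectralOrderedRing A
  have hn : 0 < ‖s‖ := norm_pos_iff.2 h0
  -- The sign `z` puts `z * ‖s‖` in the spectrum of `s`, so `‖s‖ + z s` has the largest possible
  -- norm. A norming functional for this element must then equal 1 at the unit, and have real part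
  -- `‖s‖` at `z s`.
  obtain ⟨z, hz, hzs⟩ : ∃ z : ℝ, (z = 1 ∨ z = -1) ∧ ‖(‖s‖ : ℂ) • (1 : A) + (z : ℂ) • s‖ =
      2 * ‖s‖ := by
    have hle : ∀ z : ℝ, (z = 1 ∨ z = -1) →
        ‖(‖s‖ : ℂ) • (1 : A) + (z : ℂ) • s‖ ≤ 2 * ‖s‖ := fun z hz => by
      refine (norm_add_le _ _).trans ?_
      rw [norm_smul, norm_smul]
      rcases hz with rfl | rfl <;> simp <;> linarith
    have hge : ∀ z : ℝ, (z = 1 ∨ z = -1) → z * ‖s‖ ∈ spectrum ℝ s →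
        2 * ‖s‖ ≤ ‖(‖s‖ : ℂ) • (1 : A) + (z : ℂ) • s‖ := fun z hz h => by
      have hzz : z * z = 1 := by rcases hz with rfl | rfl <;> norm_num
      have h1 : ‖s‖ + z * (z * ‖s‖) ∈ spectrum ℝ (algebraMap ℝ A ‖s‖ + z • s) := by
        rw [add_comm ‖s‖, spectrum.add_mem_add_iff]
        have hz0 : z ≠ 0 := by rintro rfl; simp at hzz
        have := (spectrum.smul_mem_smul_iff (r := Units.mk0 z hz0)).2 h
        simpa [Units.smul_def] using this
      have h2 := spectrum.norm_le_norm_of_mem h1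
      rw [← mul_assoc, hzz, one_mul, Real.norm_of_nonneg (by positivity)] at h2
      calc 2 * ‖s‖ = ‖s‖ + ‖s‖ := two_mul _
        _ ≤ _ := h2
        _ = _ := by
          rw [Algebra.algebraMap_eq_smul_one]
          rfl
    rcases CStarAlgebra.norm_or_neg_norm_mem_spectrum hs with h | h
    · exact ⟨1, .inl rfl, le_antisymm (hle 1 (.inl rfl)) (hge 1 (.inl rfl) (by simpa using h))⟩
    · exact ⟨-1, .inr rfl, le_antisymm (hle _ (.inr rfl)) (hge _ (.inr rfl) (by simpa using h))⟩
  obtain ⟨g, hg1, hg⟩ := exists_dual_vector ℂ ((‖s‖ : ℂ) • (1 : A) + (z : ℂ) • s)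
    (by rw [hzs]; positivity)
  have hgn : ∀ a, ‖g a‖ ≤ ‖a‖ := fun a => by simpa [hg1] using g.le_opNorm a
  have hzn : ‖(z : ℂ)‖ = 1 := by rcases hz with rfl | rfl <;> simp
  have hre : ‖s‖ * (g 1).re + z * (g s).re = 2 * ‖s‖ := by
    have := congrArg Complex.re hg
    rw [hzs, map_add, map_smul, map_smul] at this
    simpa using this
  have h1 : (g 1).re ≤ 1 := (Complex.re_le_norm _).trans ((hgn 1).trans (by simp))
  have h2 : z * (g s).re ≤ ‖s‖ := by
    refine (le_abs_self _).trans ?_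
    rw [abs_mul, show |z| = 1 by rcases hz with rfl | rfl <;> simp, one_mul]
    exact (Complex.abs_re_le_norm _).trans (hgn s)
  have h3 : (g 1).re = 1 := by nlinarith
  have h4 : g 1 = 1 := by
    have h5 : ‖g 1‖ ≤ 1 := (hgn 1).trans (by simp)
    have h6 : (g 1).im = 0 := by
      have := Complex.sq_norm (g 1)
      rw [Complex.normSq_apply, h3] at this
      nlinarith [norm_nonneg (g 1), mul_self_nonneg (g 1).im]
    exact Complex.ext h3 h6
  -- A contractive functional equal to 1 at the unit has nonnegative real part on `a ≥ 0`, since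
  -- `‖a‖ - a` has norm at most `‖a‖`.
  have hpos : ∀ a : A, 0 ≤ a → 0 ≤ (g a).re := fun a ha => by
    have h5 : ‖algebraMap ℝ A ‖a‖ - a‖ ≤ ‖a‖ := by
      rw [CStarAlgebra.norm_le_iff_le_algebraMap _ (norm_nonneg a)
        (sub_nonneg.2 (IsSelfAdjoint.le_algebraMap_norm_self (.of_nonneg ha)))]
      exact sub_le_self _ ha
    have h6 := (Complex.re_le_norm _).trans ((hgn (algebraMap ℝ A ‖a‖ - a)).trans h5)
    rw [Algebra.algebraMap_eq_smul_one, map_sub,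
      show (‖a‖ • (1 : A)) = (‖a‖ : ℂ) • (1 : A) from rfl, map_smul, h4] at h6
    simp at h6
    exact h6
  -- The hermitian part of `g`, which is real on self-adjoint elements and hence truly positive.
  let φ : A →ₗ[ℂ] ℂ :=
    { toFun := fun a => (1 / 2 : ℂ) * (g a + starRingEnd ℂ (g (star a)))
      map_add' := fun a b => by rw [star_add, map_add, map_add, map_add]; ring
      map_smul' := fun c a => by
        rw [star_smul, map_smul, map_smul, smul_eq_mul, smul_eq_mul, map_mul, Complex.star_def,
          Complex.conj_conj, RingHom.id_apply, smul_eq_mul]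
        ring }
  have hφ : ∀ a : A, IsSelfAdjoint a → φ a = ((g a).re : ℂ) := fun a ha => by
    change (1 / 2 : ℂ) * (g a + starRingEnd ℂ (g (star a))) = _
    rw [ha.star_eq, Complex.add_conj]
    push_cast
    ring
  refine ⟨φ, fun x => ?_, ?_, ?_⟩
  · rw [hφ _ (.star_mul_self x)]
    exact_mod_cast hpos _ (star_mul_self_nonneg x)
  · rw [hφ _ (.one A), h3]
    simp
  · rw [hφ _ hs, Complex.norm_real, Real.norm_eq_abs]
    have h7 : z * (g s).re = ‖s‖ := by nlinarith
    rw [← h7]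
    refine (le_abs_self _).trans ?_
    rw [abs_mul, show |z| = 1 by rcases hz with rfl | rfl <;> simp, one_mul]

variable {C : Type*} [CStarAlgebra C]

/-- A hermitian linear map, which is bounded against the states, extends to the maximal tensor
product. -/
theorem exists_extension_maxTensor {S : A ⊗[ℂ] B →ₗ[ℂ] C} (hS : ∀ t, S (star t) = star (S t))
    {M : ℝ} (hM0 : 0 ≤ M) (hM : ∀ φ : C →ₗ[ℂ] ℂ, (∀ x, 0 ≤ φ (star x * x)) → ‖φ 1‖ ≤ 1 → ∀ t,
      ‖φ (S t)‖ ≤ M * ‖UniversalCStar.of (hasMaxSeminorm_tensor A B) t‖) :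
    ∃ E : MaxTensor A B →L[ℂ] C, ∀ a b, E (MaxTensor.tmul a b) = S (a ⊗ₜ b) := by
  set ι := UniversalCStar.of (hasMaxSeminorm_tensor A B) with hι
  have h1 : ∀ t, IsSelfAdjoint (S t) → ‖S t‖ ≤ M * ‖ι t‖ := fun t ht => by
    obtain ⟨φ, h1, h2, h3⟩ := exists_state_norm_le ht
    exact h3.trans (hM φ h1 h2 t)
  have hn : ∀ t, ‖ι (star t)‖ = ‖ι t‖ := fun t => by rw [map_star, norm_star]
  -- The states control self-adjoint values only; splitting `t` in its two hermitian parts costs a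
  -- factor 2.
  have h2 : ∀ t, ‖S t‖ ≤ (2 * M) * ‖ι t‖ := fun t => by
    have h3 := h1 (t + star t) (by
      rw [isSelfAdjoint_iff, ← hS, star_add, star_star, add_comm])
    have h4 := h1 (Complex.I • (t - star t)) (by
      rw [isSelfAdjoint_iff, ← hS, star_smul, star_sub, star_star, Complex.star_def,
        Complex.conj_I, neg_smul, ← smul_neg, neg_sub])
    have h5 : ‖ι (t + star t)‖ ≤ 2 * ‖ι t‖ := by
      rw [map_add, two_mul]
      exact (norm_add_le _ _).trans (by rw [hn])
    have h6 : ‖ι (Complex.I • (t - star t))‖ ≤ 2 * ‖ι t‖ := by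
      rw [map_smul, norm_smul, Complex.norm_I, one_mul, map_sub, two_mul]
      exact (norm_sub_le _ _).trans (by rw [hn])
    have h7 : (2 : ℂ) • S t = S (t + star t) - Complex.I • S (Complex.I • (t - star t)) := by
      rw [map_smul, smul_smul, Complex.I_mul_I, map_add, map_sub]
      module
    have h8 : 2 * ‖S t‖ ≤ ‖S (t + star t)‖ + ‖S (Complex.I • (t - star t))‖ := by
      have := norm_sub_le (S (t + star t)) (Complex.I • S (Complex.I • (t - star t)))
      rw [← h7, norm_smul, norm_smul, Complex.norm_I, one_mul] at this
      simpa using this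
    have h9 := mul_le_mul_of_nonneg_left h5 hM0
    have h10 := mul_le_mul_of_nonneg_left h6 hM0
    linarith
  refine ⟨LinearMap.extendOfNorm S (ι : A ⊗[ℂ] B →ₐ[ℂ] MaxTensor A B).toLinearMap, fun a b => ?_⟩
  exact LinearMap.extendOfNorm_eq (maxSeminorm _ (hasMaxSeminorm_tensor A B)).denseRange_ofAlg
    ⟨_, h2⟩ _

/-- The slice maps of the positive functionals. -/
theorem exists_slice {h : A →ₗ[ℂ] ℂ} (hh : ∀ x, 0 ≤ h (star x * x)) :
    (∃ E : MaxTensor A A →L[ℂ] A, ∀ a b, E (MaxTensor.tmul a b) = h a • b) ∧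
    ∃ E : MaxTensor A A →L[ℂ] A, ∀ a b, E (MaxTensor.tmul a b) = h b • a := by
  have hs : ∀ a, h (star a) = star (h a) := fun a => by
    have := conj_of_nonneg hh 1 a
    rw [star_one, one_mul, mul_one] at this
    exact this.symm
  constructor
  · let S : A ⊗[ℂ] A →ₗ[ℂ] A := TensorProduct.lift (LinearMap.lsmul ℂ A ∘ₗ h)
    have hS : ∀ a b, S (a ⊗ₜ b) = h a • b := fun a b => by simp [S]
    have hS' : ∀ t, S (star t) = star (S t) := fun t => by
      induction t with
      | zero => simp
      | add x y hx hy => rw [star_add, map_add, map_add, star_add, hx, hy]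
      | tmul a b => rw [TensorProduct.star_tmul, hS, hS, hs, star_smul]
    suffices hM : _ by
      obtain ⟨E, hE⟩ := exists_extension_maxTensor hS' (norm_nonneg (h 1)) hM
      exact ⟨E, fun a b => (hE a b).trans (hS a b)⟩
    · intro φ h1 h2 t
      -- A slice followed by a functional `φ` is a product functional, for which the bound is known.
      have e : φ (S t) = tensorForm h φ t := by
        induction t with
        | zero => simp
        | add x y hx hy => rw [map_add, map_add, map_add, hx, hy]
        | tmul a b => rw [hS, tensorForm_tmul, map_smul, smul_eq_mul]
      rw [e]
      refine (norm_tensorForm_le hh h1 t).trans ?_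
      gcongr
      exact mul_le_of_le_one_right (norm_nonneg _) h2
  · let S : A ⊗[ℂ] A →ₗ[ℂ] A :=
      TensorProduct.lift (LinearMap.lsmul ℂ A ∘ₗ h).flip
    have hS : ∀ a b, S (a ⊗ₜ b) = h b • a := fun a b => by simp [S]
    have hS' : ∀ t, S (star t) = star (S t) := fun t => by
      induction t with
      | zero => simp
      | add x y hx hy => rw [star_add, map_add, map_add, star_add, hx, hy]
      | tmul a b => rw [TensorProduct.star_tmul, hS, hS, hs, star_smul]
    suffices hM : _ by
      obtain ⟨E, hE⟩ := exists_extension_maxTensor hS' (norm_nonneg (h 1)) hM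
      exact ⟨E, fun a b => (hE a b).trans (hS a b)⟩
    · intro φ h1 h2 t
      have e : φ (S t) = tensorForm φ h t := by
        induction t with
        | zero => simp
        | add x y hx hy => rw [map_add, map_add, map_add, hx, hy]
        | tmul a b => rw [hS, tensorForm_tmul, map_smul, smul_eq_mul, mul_comm]
      rw [e]
      refine (norm_tensorForm_le h1 hh t).trans ?_
      gcongr
      exact mul_le_of_le_one_left (norm_nonneg _) h2

end Slices

/-! ### Calculus of elementary tensors -/

section MaxTensor

open scoped TensorProduct

variable {A : Type u} {B : Type v} [CStarAlgebra A] [CStarAlgebra B]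

theorem maxTensor_tmul_mul_tmul (a c : A) (b d : B) :
    MaxTensor.tmul a b * MaxTensor.tmul c d = MaxTensor.tmul (a * c) (b * d) := by
  rw [MaxTensor.tmul, MaxTensor.tmul, ← map_mul, Algebra.TensorProduct.tmul_mul_tmul]
  rfl

theorem star_maxTensor_tmul (a : A) (b : B) :
    star (MaxTensor.tmul a b) = MaxTensor.tmul (star a) (star b) := by
  rw [MaxTensor.tmul, ← map_star, TensorProduct.star_tmul]
  rfl

theorem maxTensor_tmul_one : MaxTensor.tmul (1 : A) (1 : B) = 1 := by
  rw [MaxTensor.tmul, ← Algebra.TensorProduct.one_def, map_one]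

theorem maxTensor_sum_tmul {ι : Type*} (s : Finset ι) (f : ι → A) (b : B) :
    MaxTensor.tmul (∑ i ∈ s, f i) b = ∑ i ∈ s, MaxTensor.tmul (f i) b := by
  rw [MaxTensor.tmul, TensorProduct.sum_tmul, map_sum]
  rfl

theorem maxTensor_tmul_sum {ι : Type*} (s : Finset ι) (a : A) (f : ι → B) :
    MaxTensor.tmul a (∑ i ∈ s, f i) = ∑ i ∈ s, MaxTensor.tmul a (f i) := by
  rw [MaxTensor.tmul, TensorProduct.tmul_sum, map_sum]
  rfl

theorem maxTensor_smul_tmul (c : ℂ) (a : A) (b : B) :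
    MaxTensor.tmul (c • a) b = c • MaxTensor.tmul a b := by
  rw [MaxTensor.tmul, ← TensorProduct.smul_tmul', map_smul]
  rfl

theorem maxTensor_tmul_smul (c : ℂ) (a : A) (b : B) :
    MaxTensor.tmul a (c • b) = c • MaxTensor.tmul a b := by
  rw [MaxTensor.tmul, TensorProduct.tmul_smul, map_smul]
  rfl

/-- The morphisms of C*-algebras, as continuous linear maps. -/
def toCLM (f : A →⋆ₐ[ℂ] B) : A →L[ℂ] B :=
  LinearMap.mkContinuous (f : A →ₐ[ℂ] B).toLinearMap 1 fun a => by
    rw [one_mul]; exact NonUnitalStarAlgHom.norm_apply_le f a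

end MaxTensor

/-! ### Coefficients of the tensor powers of the fundamental corepresentation -/

section CoordCoef

open scoped ComplexOrder

variable {N : ℕ}

/-- The entries of the tensor powers of the fundamental corepresentation. -/
abbrev coordCoef (k : ColoredWord) (i j : List (Fin N)) : FreeUnitaryAlgebra N :=
  coef (FreeUnitaryAlgebra.coord N) k i j

theorem of_monomial (w : List ((Fin N × Fin N) × Bool)) :
    UniversalCStar.of (hasMaxSeminorm_biunitary N) (monomial w) =
      coordCoef (colors w) (rows w) (cols w) := by
  induction w with
  | nil =>
    rw [monomial_nil, map_one]
    exact (coef_nil _).symm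
  | cons y w ih =>
    rw [← List.singleton_append, monomial_append, map_mul, ih, monomial_singleton]
    refine Eq.trans ?_ (coef_cons _ _ _ _ _ _ _).symm
    congr 1
    obtain ⟨⟨i, j⟩, a⟩ := y
    cases a with
    | true => rfl
    | false =>
      rw [← FreeStarAlgebra.star_var, map_star]
      rfl

theorem exists_word {k : ColoredWord} {i j : List (Fin N)} (hi : i.length = k.length)
    (hj : j.length = k.length) : ∃ w, colors w = k ∧ rows w = i ∧ cols w = j := by
  induction k generalizing i j with
  | nil =>
    rw [List.length_eq_zero_iff.1 hi, List.length_eq_zero_iff.1 hj]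
    exact ⟨[], rfl, rfl, rfl⟩
  | cons a k ih =>
    match i, j, hi, hj with
    | b :: i, c :: j, hi, hj =>
      obtain ⟨w, rfl, rfl, rfl⟩ := ih (i := i) (j := j) (by simpa using hi) (by simpa using hj)
      exact ⟨((b, c), a) :: w, rfl, rfl, rfl⟩

/-- The continuous linear maps are determined by their values on the coefficients of the tensor
powers of the fundamental corepresentation. -/
theorem ext_coordCoef {E : Type*} [AddCommMonoid E] [Module ℂ E] [TopologicalSpace E] [T2Space E]
    {f g : FreeUnitaryAlgebra N →L[ℂ] E}
    (h : ∀ k i j, i.length = k.length → j.length = k.length →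
      f (coordCoef k i j) = g (coordCoef k i j)) : f = g := by
  refine ContinuousLinearMap.ext fun a => ?_
  have hd : DenseRange (UniversalCStar.of (hasMaxSeminorm_biunitary N)) :=
    (maxSeminorm _ (hasMaxSeminorm_biunitary N)).denseRange_ofAlg
  refine hd.induction_on (p := fun a => f a = g a) a (isClosed_eq f.continuous g.continuous)
    fun x => ?_
  obtain ⟨T, c, rfl⟩ := exists_eq_sum_monomial x
  simp only [map_sum, map_smul, of_monomial]
  refine Finset.sum_congr rfl fun w _ => ?_
  rw [h _ _ _ (by simp [rows, colors]) (by simp [cols, colors])]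

theorem comul_coordCoef (k : ColoredWord) (i j : List (Fin N)) :
    (freeUnitary N).comul (coordCoef k i j) =
      ∑ l ∈ lists (Fin N) k.length, MaxTensor.tmul (coordCoef k i l) (coordCoef k l j) := by
  have hl : ∀ a b c, (freeUnitary N).comul (letterCoef (FreeUnitaryAlgebra.coord N) a b c) =
      ∑ d, MaxTensor.tmul (letterCoef (FreeUnitaryAlgebra.coord N) a b d)
        (letterCoef (FreeUnitaryAlgebra.coord N) a d c) := fun a b c => by
    have := (freeUnitary N).comul_u b c
    cases a with
    | true => exact this
    | false =>
      refine (map_star (freeUnitary N).comul _).trans ((congrArg star this).trans ?_)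
      simp only [star_sum, star_maxTensor_tmul]
      rfl
  induction k generalizing i j with
  | nil =>
    match i, j with
    | [], [] =>
      simp only [coordCoef, coef_nil, map_one, List.length_nil, sum_lists_zero,
        maxTensor_tmul_one]
    | b :: i, j => simp [coef, MaxTensor.tmul]
    | i, c :: j => simp [coef, MaxTensor.tmul]
  | cons a k ih =>
    match i, j with
    | [], j => simp [coef_cons_nil_left, MaxTensor.tmul]
    | b :: i, [] => simp [coef_cons_nil_right, MaxTensor.tmul]
    | b :: i, c :: j =>
      simp only [coef_cons, map_mul, ih, hl, List.length_cons, sum_lists_succ, Finset.sum_mul_sum,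
        maxTensor_tmul_mul_tmul]

theorem counit_coordCoef {k : ColoredWord} {i j : List (Fin N)} (hi : i.length = k.length)
    (hj : j.length = k.length) :
    (freeUnitary N).counit (coordCoef k i j) = if i = j then 1 else 0 := by
  have hl : ∀ a b c, (freeUnitary N).counit (letterCoef (FreeUnitaryAlgebra.coord N) a b c) =
      if b = c then 1 else 0 := fun a b c => by
    have := (freeUnitary N).counit_u b c
    cases a with
    | true => exact this
    | false =>
      refine (map_star (freeUnitary N).counit _).trans ((congrArg star this).trans ?_)
      split_ifs <;> simp
  induction k generalizing i j with
  | nil =>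
    rw [List.length_eq_zero_iff.1 hi, List.length_eq_zero_iff.1 hj, coordCoef, coef_nil, map_one,
      if_pos rfl]
  | cons a k ih =>
    match i, j, hi, hj with
    | b :: i, c :: j, hi, hj =>
      rw [coordCoef, coef_cons, map_mul, hl]
      refine (congrArg _ (ih (i := i) (j := j) (by simpa using hi) (by simpa using hj))).trans ?_
      by_cases hbc : b = c <;> simp [hbc]

theorem antipode_coordCoef (k : ColoredWord) (i j : List (Fin N)) :
    (freeUnitary N).antipode (coordCoef k i j) = MulOpposite.op (star (coordCoef k j i)) := by
  have hl : ∀ a b c, (freeUnitary N).antipode (letterCoef (FreeUnitaryAlgebra.coord N) a b c) =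
      MulOpposite.op (star (letterCoef (FreeUnitaryAlgebra.coord N) a c b)) := fun a b c => by
    have := (freeUnitary N).antipode_u b c
    cases a with
    | true => exact this
    | false =>
      refine (map_star (freeUnitary N).antipode _).trans ((congrArg star this).trans ?_)
      rfl
  induction k generalizing i j with
  | nil =>
    match i, j with
    | [], [] => simp [coef_nil]
    | b :: i, j => simp [coef]
    | i, c :: j => simp [coef]
  | cons a k ih =>
    match i, j with
    | [], j => simp [coef_cons_nil_left, coef_cons_nil_right]
    | b :: i, [] => simp [coef_cons_nil_left, coef_cons_nil_right]
    | b :: i, c :: j =>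
      simp only [coordCoef, coef_cons, map_mul, hl, ih, star_mul, MulOpposite.op_mul]

theorem coordCoef_mem_smooth (k : ColoredWord) (i j : List (Fin N)) :
    coordCoef k i j ∈ (freeUnitary N).smooth := by
  have hl : ∀ a b c, letterCoef (FreeUnitaryAlgebra.coord N) a b c ∈ (freeUnitary N).smooth :=
    fun a b c => by
      have : FreeUnitaryAlgebra.coord N b c ∈ (freeUnitary N).smooth :=
        StarAlgebra.subset_adjoin ℂ _ ⟨(b, c), rfl⟩
      cases a with
      | true => exact this
      | false => exact star_mem this
  induction k generalizing i j with
  | nil =>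
    match i, j with
    | [], [] => rw [coordCoef, coef_nil]; exact one_mem _
    | b :: i, j => simp [coef]
    | i, c :: j => simp [coef]
  | cons a k ih =>
    match i, j with
    | [], j => simp [coef_cons_nil_left]
    | b :: i, [] => simp [coef_cons_nil_right]
    | b :: i, c :: j =>
      rw [coordCoef, coef_cons]
      exact mul_mem (hl _ _ _) (ih _ _)

variable {B : Type*} [Ring B] [StarRing B] [Algebra ℂ B] [StarModule ℂ B]
  {X : Type*} [Fintype X] [DecidableEq X] {w : Matrix X X B}

omit [StarModule ℂ B] in
theorem sum_ncProj_smul_coef (hw : IsBiunitary w) (k : ColoredWord) (i j : List X) :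
    ∑ l ∈ lists X k.length, ncProj k l j • coef w k i l = ncProj k i j • (1 : B) :=
  sum_ncSpan_smul_coef hw (ncProj_mem k j) i

/-- From `u P = P` and unitarity one gets `u* P = P`; the adjoint of this is `P u = P`. -/
theorem sum_ncProj_smul_coef' (hw : IsBiunitary w) (k : ColoredWord) {i j : List X}
    (hj : j.length = k.length) :
    ∑ l ∈ lists X k.length, ncProj k i l • coef w k l j = ncProj k i j • (1 : B) := by
  have h : ∑ l ∈ lists X k.length, ncProj k l i • star (coef w k l j) =
      ncProj k j i • (1 : B) := by
    calc _ = ∑ l ∈ lists X k.length, star (coef w k l j) *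
          ∑ m ∈ lists X k.length, ncProj k m i • coef w k l m := by
          refine Finset.sum_congr rfl fun l _ => ?_
          rw [sum_ncSpan_smul_coef hw (ncProj_mem k i) l, mul_smul_comm, mul_one]
      _ = ∑ m ∈ lists X k.length, ncProj k m i • if j = m then (1 : B) else 0 := by
          simp only [Finset.mul_sum, mul_smul_comm]
          rw [Finset.sum_comm]
          refine Finset.sum_congr rfl fun m hm => ?_
          rw [← Finset.smul_sum, sum_star_mul_coef hw hj (mem_lists.1 hm)]
      _ = _ := by
          simp [mem_lists, hj]
  have := congrArg star h
  simp only [star_sum, star_smul, star_star, Complex.star_def, ncProj_conj, star_one] at this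
  exact this

end CoordCoef

/-! ### Existence and uniqueness of the Haar integration; determination of the fixed vectors -/

section Haar

open scoped ComplexOrder

variable {N : ℕ}

/-- Invariance is `P u = u P = P`, read through the slice maps. For the trace property, moving a
single letter from left to right is a rotation of the word (`ncProj_rotate`); longer words are moved
letter by letter, and density concludes. -/
theorem exists_haar (N : ℕ) : ∃ h : FreeUnitaryAlgebra N →L[ℂ] ℂ, (freeUnitary N).IsHaar h ∧
    ∀ k i j, i.length = k.length → j.length = k.length →
      h (coordCoef k i j) = ncProj k i j := by
  obtain ⟨h, hpos, hw⟩ := exists_state N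
  have hU := FreeUnitaryAlgebra.isBiunitary_coord N
  have hc : ∀ k i j, i.length = k.length → j.length = k.length →
      h (coordCoef k i j) = ncProj k i j := fun k i j hi hj => by
    obtain ⟨w, rfl, rfl, rfl⟩ := exists_word hi hj
    rw [← of_monomial, hw]
  have hl : ∀ a b c y, h (letterCoef (FreeUnitaryAlgebra.coord N) a b c * y) =
      h (y * letterCoef (FreeUnitaryAlgebra.coord N) a b c) := fun a b c y => by
    refine DFunLike.congr_fun (f := h.comp (ContinuousLinearMap.mul ℂ _
      (letterCoef (FreeUnitaryAlgebra.coord N) a b c)))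
      (g := h.comp ((ContinuousLinearMap.mul ℂ _).flip
      (letterCoef (FreeUnitaryAlgebra.coord N) a b c)))
      (ext_coordCoef fun k i j hi hj => ?_) y
    change h (_ * _) = h (_ * _)
    rw [← coef_cons, ← coef_singleton, ← coef_append _ hi hj]
    exact (hc _ _ _ (by simp [hi]) (by simp [hj])).trans
      ((ncProj_rotate a k b c i j hi hj).symm.trans
      (hc _ _ _ (by simp [hi]) (by simp [hj])).symm)
  have ht : ∀ k i j y, h (coordCoef k i j * y) = h (y * coordCoef k i j) := fun k => by
    induction k with
    | nil =>
      intro i j y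
      match i, j with
      | [], [] => rw [coordCoef, coef_nil, one_mul, mul_one]
      | b :: i, j => simp [coef]
      | i, c :: j => simp [coef]
    | cons a k ih =>
      intro i j y
      match i, j with
      | [], j => simp [coef_cons_nil_left]
      | b :: i, [] => simp [coef_cons_nil_right]
      | b :: i, c :: j =>
        rw [coordCoef, coef_cons, mul_assoc, hl, mul_assoc, ih, mul_assoc]
  obtain ⟨⟨E, hE⟩, E', hE'⟩ := exists_slice (h := (h : FreeUnitaryAlgebra N →ₗ[ℂ] ℂ)) hpos
  refine ⟨h, ⟨fun a => ?_, ?_, fun a b => ?_, ⟨E, hE, fun a => ?_⟩, ⟨E', hE', fun a => ?_⟩⟩, hc⟩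
  · exact ⟨(Complex.le_def.1 (hpos a)).1, (Complex.le_def.1 (hpos a)).2.symm⟩
  · have h1 := hc [] [] [] rfl rfl
    rw [coordCoef, coef_nil] at h1
    have h2 := sum_ncProj_mul (X := Fin N) (Submodule.subset_span NCVector.nil) []
    rw [List.length_nil, sum_lists_zero] at h2
    rw [h1]
    simpa [unitVec] using h2
  · exact DFunLike.congr_fun (f := h.comp ((ContinuousLinearMap.mul ℂ _).flip b))
      (g := h.comp (ContinuousLinearMap.mul ℂ _ b))
      (ext_coordCoef fun k i j _ _ => ht k i j b) a
  · refine DFunLike.congr_fun (f := E.comp (toCLM (freeUnitary N).comul))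
      (g := h.smulRight (1 : FreeUnitaryAlgebra N)) (ext_coordCoef fun k i j hi hj => ?_) a
    change E ((freeUnitary N).comul _) = h (coordCoef k i j) • (1 : FreeUnitaryAlgebra N)
    rw [comul_coordCoef, map_sum, hc _ _ _ hi hj, ← sum_ncProj_smul_coef' hU k hj]
    refine Finset.sum_congr rfl fun l hl => ?_
    rw [hE, ← hc _ _ _ hi (mem_lists.1 hl)]
    rfl
  · refine DFunLike.congr_fun (f := E'.comp (toCLM (freeUnitary N).comul))
      (g := h.smulRight (1 : FreeUnitaryAlgebra N)) (ext_coordCoef fun k i j hi hj => ?_) a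
    change E' ((freeUnitary N).comul _) = h (coordCoef k i j) • (1 : FreeUnitaryAlgebra N)
    rw [comul_coordCoef, map_sum, hc _ _ _ hi hj, ← sum_ncProj_smul_coef hU k i j]
    refine Finset.sum_congr rfl fun l hl => ?_
    rw [hE', ← hc _ _ _ (mem_lists.1 hl) hj]
    rfl

/-- The classical argument: the convolution of `h` and `h'` equals `h` by the left invariance of
`h`, and `h'` by the right invariance of `h'`. -/
theorem haar_unique {h h' : FreeUnitaryAlgebra N →L[ℂ] ℂ} (hh : (freeUnitary N).IsHaar h)
    (hh' : (freeUnitary N).IsHaar h') : h = h' := by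
  obtain ⟨E, hE, hE1⟩ := hh.left_invariant
  obtain ⟨E', hE', hE1'⟩ := hh'.right_invariant
  refine ext_coordCoef fun k i j hi hj => ?_
  have h1 := congrArg h' (hE1 (coordCoef k i j))
  have h2 := congrArg h (hE1' (coordCoef k i j))
  simp only [comul_coordCoef, map_sum, map_smul, hE, hE', hh.map_one, hh'.map_one, smul_eq_mul,
    mul_one] at h1 h2
  rw [← h1, ← h2]
  exact Finset.sum_congr rfl fun l _ => mul_comm _ _

/-- The fixed vectors of the tensor powers of the fundamental corepresentation. -/
theorem mem_ncSpan_of_fixed {k : ColoredWord} {ξ : List (Fin N) → ℂ} (hs : Supp k.length ξ)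
    (h : ∀ i, i.length = k.length →
      ∑ j ∈ lists (Fin N) k.length, ξ j • coordCoef k i j = ξ i • (1 : FreeUnitaryAlgebra N)) :
    ξ ∈ ncSpan (Fin N) k := by
  obtain ⟨τ, hτ, hc⟩ := exists_haar N
  have h1 : ξ = ∑ j ∈ lists (Fin N) k.length, ξ j • fun i => ncProj k i j := by
    have hm : ∑ j ∈ lists (Fin N) k.length, ξ j • (fun i => ncProj k i j) ∈ ncSpan (Fin N) k :=
      Submodule.sum_mem _ fun j _ => Submodule.smul_mem _ _ (ncProj_mem k j)
    refine Supp.ext hs (ncSpan_supp hm) fun i hi => ?_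
    -- Integrating the fixed vector equation gives `ξ = P ξ`.
    have h2 := congrArg τ (h i hi)
    rw [map_sum, map_smul, hτ.map_one, smul_eq_mul, mul_one] at h2
    rw [← h2, Finset.sum_apply]
    refine Finset.sum_congr rfl fun j hj => ?_
    rw [map_smul, hc _ _ _ hi (mem_lists.1 hj)]
    rfl
  rw [h1]
  exact Submodule.sum_mem _ fun j _ => Submodule.smul_mem _ _ (ncProj_mem k j)

end Haar

/-! ### Compression of the tensor powers to the vectors killed by the contractions -/

section CapBasis

variable {X : Type u} [Fintype X]

theorem exists_capBasis (k : ColoredWord) :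
    ∃ (d : ℕ) (B : Fin d → List X → ℂ), (∀ a, B a ∈ capKernel X k) ∧
      (∀ a b, ∑ i ∈ lists X k.length, starRingEnd ℂ (B a i) * B b i = if a = b then 1 else 0) ∧
      ∀ f ∈ capKernel X k, ∀ i, f i = ∑ a, B a i *
        ∑ j ∈ lists X k.length, starRingEnd ℂ (B a j) * f j :=
  exists_orthonormal_family _ _ fun _ hf i hi => capKernel_supp hf i fun h => hi (mem_lists.2 h)

/-- The dimension of the space of vectors killed by the contractions. -/
def capDim (X : Type u) [Fintype X] (k : ColoredWord) : ℕ :=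
  (exists_capBasis (X := X) k).choose

/-- An orthonormal basis of the space of vectors killed by the contractions. -/
def capBasis (k : ColoredWord) : Fin (capDim X k) → List X → ℂ :=
  (exists_capBasis (X := X) k).choose_spec.choose

theorem capBasis_mem (k : ColoredWord) (a : Fin (capDim X k)) : capBasis k a ∈ capKernel X k :=
  (exists_capBasis (X := X) k).choose_spec.choose_spec.1 a

theorem capBasis_orthonormal (k : ColoredWord) (a b : Fin (capDim X k)) :
    ∑ i ∈ lists X k.length, starRingEnd ℂ (capBasis k a i) * capBasis k b i =
      if a = b then 1 else 0 :=
  (exists_capBasis (X := X) k).choose_spec.choose_spec.2.1 a b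

theorem capBasis_expand {k : ColoredWord} {f : List X → ℂ} (hf : f ∈ capKernel X k) (i : List X) :
    f i = ∑ a, capBasis k a i * ∑ j ∈ lists X k.length, starRingEnd ℂ (capBasis k a j) * f j :=
  (exists_capBasis (X := X) k).choose_spec.choose_spec.2.2 f hf i

theorem capBasis_expand_conj {k : ColoredWord} {f : List X → ℂ} (hf : f ∈ capKernel X k)
    (i : List X) :
    f i = ∑ a, starRingEnd ℂ (capBasis k a i) *
      ∑ j ∈ lists X k.length, capBasis k a j * f j := by
  have h := congrArg (starRingEnd ℂ) (capBasis_expand (capKernel_conj hf) i)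
  simpa using h

theorem eq_of_forall_dual {M : Type*} [AddCommGroup M] [Module ℂ M] {x y : M}
    (h : ∀ φ : M →ₗ[ℂ] ℂ, φ x = φ y) : x = y := by
  rw [← sub_eq_zero, ← Module.forall_dual_apply_eq_zero_iff ℂ]
  intro φ
  rw [map_sub, h, sub_self]

/-- Linear forms separate points, so the scalar expansion extends to families with values in the
algebra. The hypothesis is phrased through linear forms since `capKernel` only contains scalar
families. -/
theorem capBasis_expand_module {M : Type*} [AddCommGroup M] [Module ℂ M] {k : ColoredWord}
    {f : List X → M} (hf : ∀ φ : M →ₗ[ℂ] ℂ, (fun i => φ (f i)) ∈ capKernel X k) (i : List X) :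
    f i = ∑ a, capBasis k a i •
      ∑ j ∈ lists X k.length, starRingEnd ℂ (capBasis k a j) • f j :=
  eq_of_forall_dual fun φ => by simpa using capBasis_expand (hf φ) i

theorem capBasis_expand_conj_module {M : Type*} [AddCommGroup M] [Module ℂ M] {k : ColoredWord}
    {f : List X → M} (hf : ∀ φ : M →ₗ[ℂ] ℂ, (fun i => φ (f i)) ∈ capKernel X k) (i : List X) :
    f i = ∑ a, starRingEnd ℂ (capBasis k a i) •
      ∑ j ∈ lists X k.length, capBasis k a j • f j :=
  eq_of_forall_dual fun φ => by simpa using capBasis_expand_conj (hf φ) i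

variable [DecidableEq X]

theorem sum_smul_cup {B : Type*} [Ring B] [Algebra ℂ B] {n p : ℕ} (hp : p ≤ n) (α : List X → ℂ)
    (f : List X → B) :
    ∑ l ∈ lists X (n + 2), α l • cup p f l = ∑ l ∈ lists X n, cap p α l • f l := by
  have h := sum_cup_smul hp f (fun l => algebraMap ℂ B (α l))
  have e : ∀ l, cap p (fun l => algebraMap ℂ B (α l)) l = algebraMap ℂ B (cap p α l) := fun l =>
    cap_map (algebraMap ℂ B : ℂ →+ B) p α l
  simp only [e, smul_eq_mul] at h
  simpa only [Algebra.smul_def, Algebra.commutes] using h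

variable {B : Type*} [Ring B] [StarRing B]

omit [Fintype X] [DecidableEq X] in
theorem coef_of_length_ne (w : Matrix X X B) {k : ColoredWord} {i j : List X}
    (h : i.length ≠ k.length ∨ j.length ≠ k.length) : coef w k i j = 0 := by
  induction k generalizing i j with
  | nil =>
    match i, j with
    | [], [] => simp at h
    | b :: i, j => simp [coef]
    | i, c :: j => simp [coef]
  | cons a k ih =>
    match i, j with
    | [], j => simp [coef_cons_nil_left]
    | b :: i, [] => simp [coef_cons_nil_right]
    | b :: i, c :: j => rw [coef_cons, ih (by simpa using h), mul_zero]

variable [Algebra ℂ B] {w : Matrix X X B}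

/-- Contractions intertwine the tensor powers, so their common kernel is invariant: a contraction of
the rows becomes a cup on the columns, and then, by adjointness, a cap on `α`. -/
theorem capKernel_coef_col (hw : IsBiunitary w) {k : ColoredWord} {α : List X → ℂ}
    (hα : α ∈ capKernel X k) (φ : B →ₗ[ℂ] ℂ) :
    (fun i => φ (∑ j ∈ lists X k.length, α j • coef w k i j)) ∈ capKernel X k := by
  refine mem_capKernel.2 ⟨fun i hi => ?_, ?_⟩
  · simp [coef_of_length_ne w (Or.inl hi)]
  · rintro x a y rfl i i' hi hi'
    rw [← map_sum, Finset.sum_comm]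
    have h : ∀ j, ∑ b, α j • coef w (x ++ a :: (!a) :: y) (i ++ b :: b :: i') j =
        α j • cup x.length (fun j => coef w (x ++ y) (i ++ i') j) j := fun j => by
      rw [← cap_coef_row hw x a, ← hi, cap_append, Finset.smul_sum]
    simp only [h]
    rw [show (x ++ a :: (!a) :: y).length = x.length + y.length + 2 by simp; omega,
      sum_smul_cup (by omega), Finset.sum_eq_zero, map_zero]
    intro l hl
    rw [cap_capKernel hα (mem_lists.1 hl), zero_smul]

theorem capKernel_coef_row (hw : IsBiunitary w) {k : ColoredWord} {α : List X → ℂ}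
    (hα : α ∈ capKernel X k) (φ : B →ₗ[ℂ] ℂ) :
    (fun j => φ (∑ i ∈ lists X k.length, α i • coef w k i j)) ∈ capKernel X k := by
  refine mem_capKernel.2 ⟨fun i hi => ?_, ?_⟩
  · simp [coef_of_length_ne w (Or.inr hi)]
  · rintro x a y rfl j j' hj hj'
    rw [← map_sum, Finset.sum_comm]
    have h : ∀ i, ∑ b, α i • coef w (x ++ a :: (!a) :: y) i (j ++ b :: b :: j') =
        α i • cup x.length (fun i => coef w (x ++ y) i (j ++ j')) i := fun i => by
      rw [← cap_coef_col hw x a, ← hj, cap_append, Finset.smul_sum]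
    simp only [h]
    rw [show (x ++ a :: (!a) :: y).length = x.length + y.length + 2 by simp; omega,
      sum_smul_cup (by omega), Finset.sum_eq_zero, map_zero]
    intro l hl
    rw [cap_capKernel hα (mem_lists.1 hl), zero_smul]

/-- The compression of the tensor power of `w` to the vectors killed by the contractions. -/
def irrep (w : Matrix X X B) (k : ColoredWord) :
    Matrix (Fin (capDim X k)) (Fin (capDim X k)) B :=
  Matrix.of fun a b => ∑ i ∈ lists X k.length, ∑ j ∈ lists X k.length,
    (starRingEnd ℂ (capBasis k a i) * capBasis k b j) • coef w k i j

omit [DecidableEq X] in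
theorem irrep_apply (k : ColoredWord) (a b : Fin (capDim X k)) :
    irrep w k a b = ∑ i ∈ lists X k.length, ∑ j ∈ lists X k.length,
    (starRingEnd ℂ (capBasis k a i) * capBasis k b j) • coef w k i j := rfl

/-- The invariance of the kernel in coordinates: its inclusion in the tensor power intertwines
`irrep w k` with that power. -/
theorem sum_capBasis_smul_coef (hw : IsBiunitary w) (k : ColoredWord) (b : Fin (capDim X k))
    (i : List X) : ∑ j ∈ lists X k.length, capBasis k b j • coef w k i j =
      ∑ a, capBasis k a i • irrep w k a b := by
  rw [capBasis_expand_module (capKernel_coef_col hw (capBasis_mem k b)) i]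
  simp only [irrep_apply, Finset.smul_sum, smul_smul]

theorem sum_conj_capBasis_smul_coef (hw : IsBiunitary w) (k : ColoredWord)
    (a : Fin (capDim X k)) (j : List X) :
    ∑ i ∈ lists X k.length, starRingEnd ℂ (capBasis k a i) • coef w k i j =
      ∑ b, starRingEnd ℂ (capBasis k b j) • irrep w k a b := by
  rw [capBasis_expand_conj_module (capKernel_coef_row hw (capKernel_conj (capBasis_mem k a))) j]
  refine Finset.sum_congr rfl fun b _ => ?_
  simp only [irrep_apply, Finset.smul_sum, smul_smul]
  rw [Finset.sum_comm]
  simp only [mul_comm, mul_left_comm]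

omit [DecidableEq X] in
theorem irrep_eq_sum_row (k : ColoredWord) (a b : Fin (capDim X k)) :
    irrep w k a b = ∑ j ∈ lists X k.length, capBasis k b j •
      ∑ i ∈ lists X k.length, starRingEnd ℂ (capBasis k a i) • coef w k i j := by
  rw [irrep_apply, Finset.sum_comm]
  simp only [Finset.smul_sum, smul_smul, mul_comm]

omit [DecidableEq X] in
theorem irrep_eq_sum_col (k : ColoredWord) (a b : Fin (capDim X k)) :
    irrep w k a b = ∑ i ∈ lists X k.length, starRingEnd ℂ (capBasis k a i) •
      ∑ j ∈ lists X k.length, capBasis k b j • coef w k i j := by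
  rw [irrep_apply]
  simp only [Finset.smul_sum, smul_smul]

variable [StarModule ℂ B]

theorem irrep_mul_conjTranspose (hw : IsBiunitary w) (k : ColoredWord) :
    irrep w k * (irrep w k).conjTranspose = 1 := by
  ext a b
  simp only [Matrix.mul_apply, Matrix.conjTranspose_apply, Matrix.one_apply]
  calc _ = ∑ j ∈ lists X k.length,
        (∑ i ∈ lists X k.length, starRingEnd ℂ (capBasis k a i) • coef w k i j) *
          star (∑ c, starRingEnd ℂ (capBasis k c j) • irrep w k b c) := by
        simp only [irrep_eq_sum_row k a, Finset.sum_mul, star_sum, star_smul, Finset.mul_sum]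
        rw [Finset.sum_comm]
        simp [Finset.sum_mul, Finset.smul_sum]
    _ = ∑ i ∈ lists X k.length, ∑ m ∈ lists X k.length,
        (starRingEnd ℂ (capBasis k a i) * capBasis k b m) •
          ∑ j ∈ lists X k.length, coef w k i j * star (coef w k m j) := by
        simp only [← sum_conj_capBasis_smul_coef hw, star_sum, Finset.sum_mul_sum, star_smul,
          smul_mul_smul_comm, Finset.smul_sum, Complex.star_def, Complex.conj_conj]
        rw [Finset.sum_comm]
        refine Finset.sum_congr rfl fun i _ => Finset.sum_comm
    _ = ∑ i ∈ lists X k.length, ∑ m ∈ lists X k.length,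
        (starRingEnd ℂ (capBasis k a i) * capBasis k b m) • if i = m then (1 : B) else 0 :=
        Finset.sum_congr rfl fun i hi => Finset.sum_congr rfl fun m hm => by
          rw [sum_coef_mul_star hw (mem_lists.1 hi) (mem_lists.1 hm)]
    _ = (∑ i ∈ lists X k.length, starRingEnd ℂ (capBasis k a i) * capBasis k b i) • (1 : B) := by
        rw [Finset.sum_smul]
        refine Finset.sum_congr rfl fun i hi => ?_
        simp [hi]
    _ = _ := by
        rw [capBasis_orthonormal]
        split_ifs <;> simp

theorem irrep_conjTranspose_mul (hw : IsBiunitary w) (k : ColoredWord) :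
    (irrep w k).conjTranspose * irrep w k = 1 := by
  ext a b
  simp only [Matrix.mul_apply, Matrix.conjTranspose_apply, Matrix.one_apply]
  calc _ = ∑ i ∈ lists X k.length,
        star (∑ j ∈ lists X k.length, capBasis k a j • coef w k i j) *
          ∑ c, capBasis k c i • irrep w k c b := by
        simp only [irrep_eq_sum_col k _ a, Finset.sum_mul, star_sum, star_smul, Finset.mul_sum]
        rw [Finset.sum_comm]
        simp [Finset.sum_mul, Finset.smul_sum]
    _ = ∑ j ∈ lists X k.length, ∑ m ∈ lists X k.length,
        (starRingEnd ℂ (capBasis k a j) * capBasis k b m) •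
          ∑ i ∈ lists X k.length, star (coef w k i j) * coef w k i m := by
        simp only [← sum_capBasis_smul_coef hw, star_sum, Finset.sum_mul_sum, star_smul,
          smul_mul_smul_comm, Finset.smul_sum, Complex.star_def]
        rw [Finset.sum_comm]
        refine Finset.sum_congr rfl fun i _ => Finset.sum_comm
    _ = ∑ i ∈ lists X k.length, ∑ m ∈ lists X k.length,
        (starRingEnd ℂ (capBasis k a i) * capBasis k b m) • if i = m then (1 : B) else 0 :=
        Finset.sum_congr rfl fun i hi => Finset.sum_congr rfl fun m hm => by
          rw [sum_star_mul_coef hw (mem_lists.1 hi) (mem_lists.1 hm)]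
    _ = (∑ i ∈ lists X k.length, starRingEnd ℂ (capBasis k a i) * capBasis k b i) • (1 : B) := by
        rw [Finset.sum_smul]
        refine Finset.sum_congr rfl fun i hi => ?_
        simp [hi]
    _ = _ := by
        rw [capBasis_orthonormal]
        split_ifs <;> simp

end CapBasis

/-! ### The compressions are corepresentations -/

section Irrep

variable {N : ℕ}

/-- The irreducible corepresentations of `U_N⁺`. -/
abbrev coordIrrep (N : ℕ) (k : ColoredWord) :
    Matrix (Fin (capDim (Fin N) k)) (Fin (capDim (Fin N) k)) (FreeUnitaryAlgebra N) :=
  irrep (FreeUnitaryAlgebra.coord N) k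

theorem isCorep_coordIrrep (k : ColoredWord) : (freeUnitary N).IsCorep (coordIrrep N k) := by
  have hU := FreeUnitaryAlgebra.isBiunitary_coord N
  refine ⟨fun a b => ?_, ⟨irrep_mul_conjTranspose hU k, irrep_conjTranspose_mul hU k⟩,
    fun a b => ?_, fun a b => ?_, fun a b => ?_⟩
  · exact sum_mem fun i _ => sum_mem fun j _ => SMulMemClass.smul_mem _ (coordCoef_mem_smooth k i j)
  · simp only [irrep_eq_sum_col k a, map_sum, map_smul, comul_coordCoef, maxTensor_sum_tmul,
      maxTensor_smul_tmul]
    rw [Finset.sum_comm]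
    refine Finset.sum_congr rfl fun i _ => ?_
    simp only [← Finset.smul_sum]
    congr 1
    calc _ = ∑ l ∈ lists (Fin N) k.length, MaxTensor.tmul (coordCoef k i l)
          (∑ j ∈ lists (Fin N) k.length, capBasis k b j • coordCoef k l j) := by
          simp only [maxTensor_tmul_sum, maxTensor_tmul_smul, Finset.smul_sum]
          exact Finset.sum_comm
      _ = _ := by
          simp only [sum_capBasis_smul_coef hU, maxTensor_tmul_sum, maxTensor_tmul_smul]
          exact Finset.sum_comm
  · rw [coordIrrep, irrep_eq_sum_col, ← capBasis_orthonormal, map_sum]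
    refine Finset.sum_congr rfl fun i hi => ?_
    rw [map_smul, map_sum, smul_eq_mul]
    congr 1
    rw [Finset.sum_congr rfl fun j hj => by
      rw [map_smul, counit_coordCoef (mem_lists.1 hi) (mem_lists.1 hj)]]
    simp [hi]
  · rw [coordIrrep, irrep_apply, irrep_eq_sum_row]
    simp only [map_sum, map_smul, antipode_coordCoef, star_sum, star_smul, Finset.op_sum,
      MulOpposite.op_smul, Finset.smul_sum, smul_smul, Complex.star_def, map_mul, Complex.conj_conj]

end Irrep

/-! ### Composition and adjoints of intertwiners, Schur's lemma -/

section Intertwiners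

open scoped Matrix ComplexOrder

variable {A : Type u} [CStarAlgebra A] {l m n : Type*} [Fintype l] [Fintype m] [Fintype n]

theorem mem_corepHom {v : Matrix n n A} {w : Matrix m m A} {T : Matrix m n ℂ} :
    T ∈ corepHom v w ↔ ∀ a c, ∑ b, T a b • v b c = ∑ b, T b c • w a b := by
  rw [corepHom, Set.mem_ofPred_eq, ← Matrix.ext_iff]
  refine forall₂_congr fun a c => ?_
  simp only [Matrix.mul_apply, Matrix.map_apply, Algebra.smul_def, Algebra.commutes]

theorem comp_mem_corepHom {v : Matrix n n A} {w : Matrix m m A} {z : Matrix l l A}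
    {T : Matrix m n ℂ} {S : Matrix l m ℂ} (hT : T ∈ corepHom v w) (hS : S ∈ corepHom w z) :
    S * T ∈ corepHom v z := by
  change (S * T).map (algebraMap ℂ A) * v = z * (S * T).map (algebraMap ℂ A)
  change T.map (algebraMap ℂ A) * v = w * T.map (algebraMap ℂ A) at hT
  change S.map (algebraMap ℂ A) * w = z * S.map (algebraMap ℂ A) at hS
  rw [Matrix.map_mul, Matrix.mul_assoc, hT, ← Matrix.mul_assoc, hS, Matrix.mul_assoc]

/-- Unitarity turns `T v = w T` into `w* T = T v*`, whose adjoint is the claim. -/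
theorem conjTranspose_mem_corepHom [DecidableEq m] [DecidableEq n] {v : Matrix n n A}
    {w : Matrix m m A} (hv : v * vᴴ = 1) (hw : wᴴ * w = 1) {T : Matrix m n ℂ}
    (hT : T ∈ corepHom v w) : Tᴴ ∈ corepHom w v := by
  change T.map (algebraMap ℂ A) * v = w * T.map (algebraMap ℂ A) at hT
  change Tᴴ.map (algebraMap ℂ A) * w = v * Tᴴ.map (algebraMap ℂ A)
  have h1 : wᴴ * T.map (algebraMap ℂ A) = T.map (algebraMap ℂ A) * vᴴ := by
    calc _ = wᴴ * T.map (algebraMap ℂ A) * (v * vᴴ) := by rw [hv, Matrix.mul_one]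
      _ = wᴴ * (T.map (algebraMap ℂ A) * v) * vᴴ := by simp only [Matrix.mul_assoc]
      _ = (wᴴ * w) * T.map (algebraMap ℂ A) * vᴴ := by rw [hT]; simp only [Matrix.mul_assoc]
      _ = _ := by rw [hw, Matrix.one_mul]
  have h2 := congrArg Matrix.conjTranspose h1
  rw [Matrix.conjTranspose_mul, Matrix.conjTranspose_mul, Matrix.conjTranspose_conjTranspose,
    Matrix.conjTranspose_conjTranspose] at h2
  have h3 : (T.map (algebraMap ℂ A))ᴴ = Tᴴ.map (algebraMap ℂ A) := by
    ext i j
    exact (algebraMap_star_comm (T j i)).symm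
  rwa [h3] at h2

/-- Schur's lemma. -/
theorem corepEquiv_of_ne_zero [DecidableEq m] [DecidableEq n] {v : Matrix n n A}
    {w : Matrix m m A} (hv : v * vᴴ = 1) (hw : wᴴ * w = 1) (hvi : CorepIrreducible v)
    (hwi : CorepIrreducible w) {T : Matrix m n ℂ} (hT : T ∈ corepHom v w) (h0 : T ≠ 0) :
    CorepEquiv v w := by
  have hT' := conjTranspose_mem_corepHom hv hw hT
  obtain ⟨c, hc⟩ := hvi.2 _ (comp_mem_corepHom hT hT')
  obtain ⟨d, hd⟩ := hwi.2 _ (comp_mem_corepHom hT' hT)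
  have hc0 : c ≠ 0 := by
    rintro rfl
    rw [zero_smul] at hc
    exact h0 (Matrix.conjTranspose_mul_self_eq_zero.1 hc)
  -- Evaluate `T Tᴴ T` in two ways.
  have hcd : c = d := by
    have h1 : c • T = d • T := by
      rw [← Matrix.mul_one (c • T), Matrix.smul_mul, ← Matrix.mul_smul, ← hc, ← Matrix.mul_assoc,
        hd, Matrix.smul_mul, Matrix.one_mul]
    by_contra h2
    refine h0 ?_
    rw [← sub_eq_zero, ← sub_smul] at h1
    exact (smul_eq_zero.1 h1).resolve_left (sub_ne_zero.2 h2)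
  refine ⟨T, hT, c⁻¹ • Tᴴ, ?_, ?_⟩
  · rw [Matrix.mul_smul, hd, ← hcd, smul_smul, inv_mul_cancel₀ hc0, one_smul]
  · rw [Matrix.smul_mul, hc, smul_smul, inv_mul_cancel₀ hc0, one_smul]

theorem corepEquiv_symm [DecidableEq m] [DecidableEq n] {v : Matrix n n A}
    {w : Matrix m m A} (h : CorepEquiv v w) : CorepEquiv w v := by
  obtain ⟨T, hT, T', h1, h2⟩ := h
  refine ⟨T', ?_, T, h2, h1⟩
  change T'.map (algebraMap ℂ A) * w = v * T'.map (algebraMap ℂ A)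
  change T.map (algebraMap ℂ A) * v = w * T.map (algebraMap ℂ A) at hT
  have e1 : T.map (algebraMap ℂ A) * T'.map (algebraMap ℂ A) = 1 := by
    rw [← Matrix.map_mul, h1]
    exact Matrix.map_one _ (map_zero _) (map_one _)
  have e2 : T'.map (algebraMap ℂ A) * T.map (algebraMap ℂ A) = 1 := by
    rw [← Matrix.map_mul, h2]
    exact Matrix.map_one _ (map_zero _) (map_one _)
  calc _ = T'.map (algebraMap ℂ A) * (w * T.map (algebraMap ℂ A)) * T'.map (algebraMap ℂ A) := by
        rw [Matrix.mul_assoc, Matrix.mul_assoc, e1, Matrix.mul_one]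
    _ = (T'.map (algebraMap ℂ A) * T.map (algebraMap ℂ A)) * v * T'.map (algebraMap ℂ A) := by
        rw [← hT]; simp only [Matrix.mul_assoc]
    _ = _ := by rw [e2, Matrix.one_mul]

theorem corepEquiv_trans [DecidableEq l] [DecidableEq m] [DecidableEq n] {v : Matrix n n A}
    {w : Matrix m m A} {z : Matrix l l A} (h : CorepEquiv v w) (h' : CorepEquiv w z) :
    CorepEquiv v z := by
  obtain ⟨T, hT, T', h1, h2⟩ := h
  obtain ⟨S, hS, S', h3, h4⟩ := h'
  refine ⟨S * T, comp_mem_corepHom hT hS, T' * S', ?_, ?_⟩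
  · rw [Matrix.mul_assoc, ← Matrix.mul_assoc T, h1, Matrix.one_mul, h3]
  · rw [Matrix.mul_assoc, ← Matrix.mul_assoc S', h4, Matrix.one_mul, h2]

end Intertwiners

/-! ### Explicit vectors killed by the contractions -/

section TestVectors

variable {N : ℕ}

/-- The tensor products of the vectors `(1, 1)` and `(-1, 1)`, alternating with the colors. -/
def signVec (N : ℕ) : ColoredWord → List (Fin N) → ℂ
  | [], [] => 1
  | a :: k, b :: i => (if b.1 = 0 then (if a then 1 else -1) else if b.1 = 1 then 1 else 0) *
      signVec N k i
  | _, _ => 0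

theorem signVec_supp (k : ColoredWord) : Supp k.length (signVec N k) := by
  induction k with
  | nil => intro i hi; cases i <;> simp [signVec] at hi ⊢
  | cons a k ih =>
    intro i hi
    cases i with
    | nil => simp [signVec]
    | cons b i => simp only [signVec]; rw [ih i (by simpa using hi), mul_zero]

theorem signVec_ne_zero {k : ColoredWord} {i : List (Fin N)} (hi : i.length = k.length)
    (h : ∀ b ∈ i, b.1 < 2) : signVec N k i ≠ 0 := by
  induction k generalizing i with
  | nil => rw [List.length_eq_zero_iff.1 hi]; simp [signVec]
  | cons a k ih =>
    match i, hi with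
    | b :: i, hi =>
      simp only [signVec]
      have hb := h b (by simp)
      refine mul_ne_zero ?_ (ih (by simpa using hi) fun c hc => h c (by simp [hc]))
      split_ifs with h1 h2 h3
      · simp
      · simp
      · simp
      · omega

/-- Neighbouring letters of different colors carry the vectors `(1, 1)` and `(-1, 1)`, whose
bilinear pairing is zero. Two coordinates are needed, and this vector is what makes all the `r_k`
nonzero. -/
theorem signVec_mem_capKernel (hN : 2 ≤ N) (k : ColoredWord) :
    signVec N k ∈ capKernel (Fin N) k := by
  refine mem_capKernel.2 ⟨signVec_supp k, ?_⟩
  rintro x a y rfl i j hi -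
  induction x generalizing i with
  | nil =>
    rw [List.length_eq_zero_iff.1 hi]
    simp only [List.nil_append, signVec, ← mul_assoc, ← Finset.sum_mul]
    refine mul_eq_zero_of_left ?_ _
    have h0 : (⟨0, by omega⟩ : Fin N) ≠ ⟨1, by omega⟩ := by simp
    rw [Fintype.sum_eq_add _ _ h0]
    · cases a <;> simp
    · rintro b ⟨h1, h2⟩
      rw [Ne, Fin.ext_iff] at h1 h2
      simp only at h1 h2
      simp [h1, h2]
  | cons c x ih =>
    match i, hi with
    | b :: i, hi =>
      simp only [List.cons_append, signVec, ← Finset.mul_sum]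
      rw [ih i (by simpa using hi), mul_zero]

/-- The basis vector of a multi-index without repetitions is killed by all contractions. -/
theorem single_mem_capKernel {X : Type u} [Fintype X] [DecidableEq X] {k : ColoredWord} {p : List X}
    (hp : p.length = k.length) (hc : p.IsChain (· ≠ ·)) :
    (Pi.single p 1 : List X → ℂ) ∈ capKernel X k := by
  refine mem_capKernel.2 ⟨fun i hi => Pi.single_eq_of_ne (by rintro rfl; exact hi hp) _,
    fun x a y _ i j _ _ => Finset.sum_eq_zero fun b _ => Pi.single_eq_of_ne ?_ _⟩
  rintro rfl
  have := (List.isChain_append.1 hc).2.1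
  simp at this

/-- The multi-indices `0101…`. -/
def altList (hN : 2 ≤ N) : ℕ → ℕ → List (Fin N)
  | 0, _ => []
  | n + 1, c => ⟨c % 2, by omega⟩ :: altList hN n (c + 1)

theorem length_altList (hN : 2 ≤ N) (n c : ℕ) : (altList hN n c).length = n := by
  induction n generalizing c with
  | zero => rfl
  | succ n ih => simp [altList, ih]

theorem altList_lt (hN : 2 ≤ N) (n c : ℕ) : ∀ b ∈ altList hN n c, b.1 < 2 := by
  induction n generalizing c with
  | zero => simp [altList]
  | succ n ih =>
    intro b hb
    rcases List.mem_cons.1 hb with rfl | hb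
    · exact Nat.mod_lt _ (by norm_num)
    · exact ih _ b hb

theorem isChain_altList (hN : 2 ≤ N) (n c : ℕ) : (altList hN n c).IsChain (· ≠ ·) := by
  induction n generalizing c with
  | zero => simp [altList]
  | succ n ih =>
    cases n with
    | zero => simp [altList]
    | succ n =>
      have := ih (c + 1)
      rw [altList] at this ⊢
      rw [altList, List.isChain_cons_cons]
      refine ⟨?_, this⟩
      rw [Ne, Fin.ext_iff]
      simp only
      omega

theorem altList_add (hN : 2 ≤ N) (m n c : ℕ) :
    altList hN (m + n) c = altList hN m c ++ altList hN n (c + m) := by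
  induction m generalizing c with
  | zero => simp [altList]
  | succ m ih =>
    rw [Nat.add_right_comm, altList, ih, altList, List.cons_append,
      Nat.add_right_comm c 1 m, Nat.add_assoc c m 1]

end TestVectors

/-! ### Frobenius duality; irreducibility and inequivalence of the `r_k` -/

section Irreducibility

open scoped Matrix

variable {N : ℕ}

/-- Frobenius duality. -/
theorem exists_ncSpan_of_intertwiner {k l : ColoredWord} {T : List (Fin N) → List (Fin N) → ℂ}
    (hT : ∀ i j, i.length = l.length → j.length = k.length →
      ∑ q ∈ lists (Fin N) l.length, T q j • coordCoef l i q =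
        ∑ q ∈ lists (Fin N) k.length, T i q • coordCoef k q j) :
    ∃ ξ ∈ ncSpan (Fin N) (ColoredWord.conj k ++ l), ∀ i j, i.length = l.length →
      j.length = k.length → ξ (j.reverse ++ i) = T i j := by
  have hU := FreeUnitaryAlgebra.isBiunitary_coord N
  -- `T` seen as a vector for the word `conj k ++ l`; the column index is reversed because
  -- conjugation reverses words.
  let ξ : List (Fin N) → ℂ := fun m => if m.length = k.length + l.length then
    T (m.drop k.length) (m.take k.length).reverse else 0
  have hξ : ∀ i j, i.length = l.length → j.length = k.length → ξ (j.reverse ++ i) = T i j :=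
    fun i j hi hj => by
      have h1 : (j.reverse ++ i).drop k.length = i := by rw [← hj, ← List.length_reverse (as := j),
        List.drop_left]
      have h2 : (j.reverse ++ i).take k.length = j.reverse := by
        rw [← hj, ← List.length_reverse (as := j), List.take_left]
      simp only [ξ, h1, h2, List.reverse_reverse]
      rw [if_pos (by simp [hi, hj])]
  refine ⟨ξ, mem_ncSpan_of_fixed (fun m hm => if_neg ?_) fun m hm => ?_, hξ⟩
  · simpa [length_conj] using hm
  · obtain ⟨j, i, rfl, hj, hi⟩ := exists_split (p := k.length)
      (by simp [length_conj]) hm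
    have hi : i.length = l.length := by simpa [length_conj] using hi
    obtain ⟨j, rfl⟩ : ∃ j', j = j'.reverse := ⟨j.reverse, by simp⟩
    rw [List.length_reverse] at hj
    rw [hξ i j hi hj, List.length_append, length_conj, sum_lists_add, ← sum_lists_reverse]
    calc _ = ∑ q ∈ lists (Fin N) k.length, star (coordCoef k j q) *
          ∑ p ∈ lists (Fin N) l.length, T p q • coordCoef l i p := by
          refine Finset.sum_congr rfl fun q hq => ?_
          rw [mem_lists] at hq
          rw [Finset.mul_sum]
          refine Finset.sum_congr rfl fun p hp => ?_
          rw [hξ p q (mem_lists.1 hp) hq, coordCoef, coef_append _ (by simp [length_conj, hj])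
            (by simp [length_conj, hq]), ← star_coef _ hj hq, mul_smul_comm]
      _ = ∑ p ∈ lists (Fin N) k.length, T i p • ∑ q ∈ lists (Fin N) k.length,
          star (coordCoef k j q) * coordCoef k p q := by
          rw [Finset.sum_congr rfl fun q hq => by rw [hT i q hi (mem_lists.1 hq)]]
          simp only [Finset.mul_sum, mul_smul_comm, Finset.smul_sum]
          exact Finset.sum_comm
      _ = ∑ p ∈ lists (Fin N) k.length, T i p • if j = p then (1 : FreeUnitaryAlgebra N) else 0 :=
          Finset.sum_congr rfl fun p hp => by rw [sum_star_mul_coef' hU hj (mem_lists.1 hp)]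
      _ = _ := by simp [mem_lists, hj]

/-- Conjugating by the inclusions of the kernels, `T` becomes an intertwiner between tensor powers,
thus a noncrossing vector by Frobenius duality. Such a vector pairs the kernels by a scalar multiple
of the canonical pairing, which is absent for `k ≠ l` (`ncSpan_pairing`). -/
theorem corepHom_coordIrrep {k l : ColoredWord}
    {T : Matrix (Fin (capDim (Fin N) l)) (Fin (capDim (Fin N) k)) ℂ}
    (hT : T ∈ corepHom (coordIrrep N k) (coordIrrep N l)) :
    ∃ c : ℂ, ∀ a b, T a b =
      c * if k = l then ∑ i ∈ lists (Fin N) k.length,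
        capBasis k b i * starRingEnd ℂ (capBasis l a i) else 0 := by
  have hU := FreeUnitaryAlgebra.isBiunitary_coord N
  rw [mem_corepHom] at hT
  obtain ⟨ξ, hξ, h1⟩ := exists_ncSpan_of_intertwiner (k := k) (l := l)
    (T := fun i j => ∑ a, ∑ b, capBasis l a i * T a b * starRingEnd ℂ (capBasis k b j))
    (fun i j hi hj => by
      calc _ = ∑ b, starRingEnd ℂ (capBasis k b j) • ∑ a, T a b •
            ∑ q ∈ lists (Fin N) l.length, capBasis l a q • coordCoef l i q := by
            simp only [Finset.sum_smul, Finset.smul_sum, smul_smul]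
            refine (Finset.sum_comm.trans (Finset.sum_congr rfl fun a _ => Finset.sum_comm)).trans
              (Finset.sum_comm.trans (Finset.sum_congr rfl fun b _ => Finset.sum_congr rfl
                fun a _ => Finset.sum_congr rfl fun q _ => ?_))
            ring_nf
        _ = ∑ b, starRingEnd ℂ (capBasis k b j) • ∑ c, capBasis l c i •
            ∑ a, T c a • coordIrrep N k a b := by
            refine Finset.sum_congr rfl fun b _ => congrArg _ ?_
            simp only [sum_capBasis_smul_coef hU, hT, Finset.smul_sum]
            rw [Finset.sum_comm]
            exact Finset.sum_congr rfl fun c _ => Finset.sum_congr rfl fun a _ => smul_comm _ _ _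
        _ = ∑ c, ∑ a, (capBasis l c i * T c a) •
            ∑ q ∈ lists (Fin N) k.length, starRingEnd ℂ (capBasis k a q) • coordCoef k q j := by
            simp only [sum_conj_capBasis_smul_coef hU, Finset.smul_sum, smul_smul]
            refine Finset.sum_comm.trans (Finset.sum_congr rfl fun c _ => Finset.sum_comm.trans
              (Finset.sum_congr rfl fun a _ => Finset.sum_congr rfl fun b _ => ?_))
            ring_nf
        _ = _ := by
            simp only [Finset.sum_smul, Finset.smul_sum, smul_smul]
            refine (Finset.sum_congr rfl fun c _ => Finset.sum_comm).trans
              (Finset.sum_comm.trans (Finset.sum_congr rfl fun q _ => Finset.sum_congr rfl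
                fun c _ => Finset.sum_congr rfl fun a _ => rfl)))
  obtain ⟨c, hc⟩ := ncSpan_pairing hξ
  refine ⟨c, fun a b => ?_⟩
  rw [← hc _ (capBasis_mem k b) _ (capKernel_conj (capBasis_mem l a)), pairing]
  calc T a b = ∑ a', ∑ b', T a' b' *
        ((∑ i ∈ lists (Fin N) l.length, starRingEnd ℂ (capBasis l a i) * capBasis l a' i) *
          ∑ j ∈ lists (Fin N) k.length, starRingEnd ℂ (capBasis k b' j) * capBasis k b j) := by
        simp [capBasis_orthonormal]
    _ = ∑ a', ∑ b', ∑ j ∈ lists (Fin N) k.length, ∑ i ∈ lists (Fin N) l.length, T a' b' *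
        ((starRingEnd ℂ (capBasis l a i) * capBasis l a' i) *
          (starRingEnd ℂ (capBasis k b' j) * capBasis k b j)) := by
        simp only [Finset.mul_sum, Finset.sum_mul]
    _ = ∑ j ∈ lists (Fin N) k.length, ∑ i ∈ lists (Fin N) l.length, ∑ a', ∑ b', T a' b' *
        ((starRingEnd ℂ (capBasis l a i) * capBasis l a' i) *
          (starRingEnd ℂ (capBasis k b' j) * capBasis k b j)) := by
        refine (Finset.sum_congr rfl fun _ _ => Finset.sum_comm.trans
          (Finset.sum_congr rfl fun _ _ => Finset.sum_comm)).trans (Finset.sum_comm.trans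
          (Finset.sum_congr rfl fun _ _ => Finset.sum_comm))
    _ = _ := by
        refine Finset.sum_congr rfl fun j hj => Finset.sum_congr rfl fun i hi => ?_
        rw [h1 i j (mem_lists.1 hi) (mem_lists.1 hj), Finset.sum_mul]
        refine Finset.sum_congr rfl fun a' _ => ?_
        rw [Finset.sum_mul]
        refine Finset.sum_congr rfl fun b' _ => ?_
        ring

theorem eq_zero_of_mem_corepHom_coordIrrep {k l : ColoredWord} (hkl : k ≠ l)
    {T : Matrix (Fin (capDim (Fin N) l)) (Fin (capDim (Fin N) k)) ℂ}
    (hT : T ∈ corepHom (coordIrrep N k) (coordIrrep N l)) : T = 0 := by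
  obtain ⟨c, hc⟩ := corepHom_coordIrrep hT
  ext a b
  rw [hc, if_neg hkl, mul_zero]
  rfl

theorem exists_eq_smul_one_of_mem_corepHom_coordIrrep {k : ColoredWord}
    {T : Matrix (Fin (capDim (Fin N) k)) (Fin (capDim (Fin N) k)) ℂ}
    (hT : T ∈ corepHom (coordIrrep N k) (coordIrrep N k)) : ∃ c : ℂ, T = c • 1 := by
  obtain ⟨c, hc⟩ := corepHom_coordIrrep hT
  refine ⟨c, Matrix.ext fun a b => ?_⟩
  rw [hc, if_pos rfl, Matrix.smul_apply, Matrix.one_apply, smul_eq_mul, ← capBasis_orthonormal]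
  simp only [mul_comm]

theorem nonempty_capDim (hN : 2 ≤ N) (k : ColoredWord) : Nonempty (Fin (capDim (Fin N) k)) := by
  by_contra h
  rw [not_nonempty_iff] at h
  refine signVec_ne_zero (length_altList hN k.length 0) (altList_lt hN _ _) ?_
  rw [capBasis_expand (signVec_mem_capKernel hN k)]
  simp

theorem corepIrreducible_coordIrrep (hN : 2 ≤ N) (k : ColoredWord) :
    CorepIrreducible (coordIrrep N k) :=
  ⟨nonempty_capDim hN k, fun _ => exists_eq_smul_one_of_mem_corepHom_coordIrrep⟩

theorem eq_of_corepEquiv_coordIrrep (hN : 2 ≤ N) {k l : ColoredWord}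
    (h : CorepEquiv (coordIrrep N k) (coordIrrep N l)) : k = l := by
  by_contra hkl
  obtain ⟨T, hT, T', h1, -⟩ := h
  obtain ⟨a⟩ := nonempty_capDim hN l
  rw [eq_zero_of_mem_corepHom_coordIrrep hkl hT, Matrix.zero_mul] at h1
  simpa using congrFun (congrFun h1 a) a

end Irreducibility

/-! ### Identification of `r_e`, `r_∘` and `r_•` -/

section SmallWords

variable {N : ℕ}

/-- There are no neighbouring letters, thus nothing to contract: the compression is the whole tensor
power. -/
theorem capKernel_of_length_le_one {X : Type u} [Fintype X] {k : ColoredWord} (hk : k.length ≤ 1)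
    {f : List X → ℂ} (hf : Supp k.length f) : f ∈ capKernel X k := by
  refine mem_capKernel.2 ⟨hf, ?_⟩
  rintro x a y rfl
  simp at hk
  omega

/-- The tensor powers of length at most one are irreducible. -/
theorem corepEquiv_of_length_le_one {k : ColoredWord} (hk : k.length ≤ 1) {n : Type*} [Fintype n]
    [DecidableEq n] (e : n → List (Fin N)) (he : Function.Injective e)
    (hlen : ∀ b, (e b).length = k.length)
    (hsum : ∀ {M : Type} [AddCommMonoid M] (f : List (Fin N) → M),
      ∑ i ∈ lists (Fin N) k.length, f i = ∑ b, f (e b))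
    {w : Matrix n n (FreeUnitaryAlgebra N)} (hw : ∀ b c, w b c = coordCoef k (e b) (e c)) :
    CorepEquiv (coordIrrep N k) w := by
  have hU := FreeUnitaryAlgebra.isBiunitary_coord N
  refine ⟨Matrix.of fun b c => capBasis k c (e b), ?_,
    Matrix.of fun c b => starRingEnd ℂ (capBasis k c (e b)), ?_, ?_⟩
  · rw [mem_corepHom]
    intro b c
    simp only [Matrix.of_apply, hw]
    rw [← sum_capBasis_smul_coef hU, hsum]
  · ext b c
    have h1 : (Pi.single (e c) 1 : List (Fin N) → ℂ) ∈ capKernel (Fin N) k :=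
      capKernel_of_length_le_one hk fun i hi => Pi.single_eq_of_ne (by
        rintro rfl; exact hi (hlen c)) _
    have h2 := capBasis_expand h1 (e b)
    simp only [hsum, Pi.single_apply, he.eq_iff, mul_ite, mul_one, mul_zero,
      Finset.sum_ite_eq', Finset.mem_univ, if_true] at h2
    rw [Matrix.mul_apply, Matrix.one_apply, h2]
    rfl
  · ext a b
    rw [Matrix.mul_apply, Matrix.one_apply, ← capBasis_orthonormal, hsum]
    rfl

theorem corepEquiv_coordIrrep_nil :
    CorepEquiv (coordIrrep N []) (1 : Matrix (Fin 1) (Fin 1) (FreeUnitaryAlgebra N)) :=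
  corepEquiv_of_length_le_one (by simp) (fun _ => []) (fun _ _ _ => Subsingleton.elim _ _)
    (fun _ => rfl) (fun f => by simp [sum_lists_zero]) fun b c => by
      rw [Subsingleton.elim b c, Matrix.one_apply_eq, coordCoef, coef_nil]

theorem corepEquiv_coordIrrep_singleton (a : Bool) :
    CorepEquiv (coordIrrep N [a])
      (Matrix.of fun i j => letterCoef (FreeUnitaryAlgebra.coord N) a i j) :=
  corepEquiv_of_length_le_one (by simp) (fun b => [b]) (fun _ _ h => by simpa using h)
    (fun _ => rfl) (fun f => by simp [sum_lists_one]) fun b c => by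
      rw [coordCoef, coef_singleton]; rfl

end SmallWords

/-! ### Conjugates of the `r_k` -/

section Conjugation

variable {N : ℕ}

/-- The reversal, from the conjugate of the vectors killed by the contractions for `k` to those for
`l = k̄`. -/
def reversal (N : ℕ) (k l : ColoredWord) :
    Matrix (Fin (capDim (Fin N) l)) (Fin (capDim (Fin N) k)) ℂ :=
  Matrix.of fun c a => ∑ i ∈ lists (Fin N) k.length,
    starRingEnd ℂ (capBasis l c i.reverse) * starRingEnd ℂ (capBasis k a i)

theorem reversal_comm {k l : ColoredWord} (h : k.length = l.length)
    (c : Fin (capDim (Fin N) l)) (a : Fin (capDim (Fin N) k)) :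
    reversal N k l c a = reversal N l k a c := by
  simp only [reversal, Matrix.of_apply, ← h]
  rw [← sum_lists_reverse]
  simp only [List.reverse_reverse, mul_comm]

theorem reversal_mul_conjTranspose {k l : ColoredWord} (h : k = ColoredWord.conj l) :
    reversal N k l * (reversal N k l).conjTranspose = 1 := by
  have hlen : k.length = l.length := by rw [h, length_conj]
  ext c d
  rw [Matrix.mul_apply, Matrix.one_apply, ← capBasis_orthonormal, ← hlen, ← sum_lists_reverse]
  simp only [Matrix.conjTranspose_apply, reversal, Matrix.of_apply, star_sum, star_mul',
    Complex.star_def, Complex.conj_conj, Finset.sum_mul]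
  rw [Finset.sum_comm]
  refine Finset.sum_congr rfl fun i _ => ?_
  have h1 : (fun i => capBasis l d i.reverse) ∈ capKernel (Fin N) k :=
    h ▸ capKernel_reverse (capBasis_mem l d)
  rw [capBasis_expand_conj h1 i, Finset.mul_sum]
  refine Finset.sum_congr rfl fun a _ => ?_
  simp only [mul_assoc, mul_comm (capBasis k a _)]

theorem corepEquiv_conj_coordIrrep {k l : ColoredWord} (h : k = ColoredWord.conj l) :
    CorepEquiv (corepConj (coordIrrep N k)) (coordIrrep N l) := by
  have hU := FreeUnitaryAlgebra.isBiunitary_coord N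
  have hlen : k.length = l.length := by rw [h, length_conj]
  have hl : l = ColoredWord.conj k := by rw [h, conj_conj]
  refine ⟨reversal N k l, ?_, (reversal N k l).conjTranspose, reversal_mul_conjTranspose h, ?_⟩
  · rw [mem_corepHom]
    intro c b
    calc _ = ∑ i ∈ lists (Fin N) k.length, starRingEnd ℂ (capBasis l c i.reverse) •
          star (∑ j ∈ lists (Fin N) k.length, capBasis k b j • coordCoef k i j) := by
          simp only [sum_capBasis_smul_coef hU, reversal, Matrix.of_apply, Finset.sum_smul,
            corepConj, Matrix.map_apply, star_sum, star_smul, Finset.smul_sum, smul_smul,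
            Complex.star_def]
          exact Finset.sum_comm
      _ = ∑ j ∈ lists (Fin N) k.length, starRingEnd ℂ (capBasis k b j) •
          ∑ i ∈ lists (Fin N) l.length, starRingEnd ℂ (capBasis l c i) •
            coordCoef l i j.reverse := by
          simp only [star_sum, star_smul, Finset.smul_sum, smul_smul, Complex.star_def]
          rw [Finset.sum_comm]
          refine Finset.sum_congr rfl fun j hj => ?_
          rw [← hlen, ← sum_lists_reverse]
          refine Finset.sum_congr rfl fun i hi => ?_
          rw [star_coef _ (by simpa using mem_lists.1 hi) (mem_lists.1 hj), ← hl,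
            List.reverse_reverse, mul_comm]
      _ = _ := by
          simp only [sum_conj_capBasis_smul_coef hU, reversal, Matrix.of_apply, Finset.sum_smul,
            Finset.smul_sum, smul_smul]
          rw [Finset.sum_comm]
          simp only [mul_comm]
  · have h1 := reversal_mul_conjTranspose (N := N) hl
    have h2 : reversal N k l = (reversal N l k).transpose := by
      ext a b
      exact reversal_comm hlen _ _
    rw [h2]
    have h3 := congrArg Matrix.transpose h1
    rwa [Matrix.transpose_mul, Matrix.transpose_one] at h3

end Conjugation

/-! ### Every irreducible corepresentation is some `r_k` -/

section PeterWeyl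

variable {N : ℕ} {n : Type*} [Fintype n] {v : Matrix n n (FreeUnitaryAlgebra N)}

/-- The intertwiners from the tensor power of the fundamental corepresentation associated to `k`
to `v`. -/
structure IsTensorIntertwiner (k : ColoredWord) (v : Matrix n n (FreeUnitaryAlgebra N))
    (Y : n → List (Fin N) → ℂ) : Prop where
  supp : ∀ a, Supp k.length (Y a)
  comm : ∀ a j, ∑ q ∈ lists (Fin N) k.length, Y a q • coordCoef k q j = ∑ b, Y b j • v a b

/-- Capping the rows of `Y` is composing `Y` with a cup, which is itself an intertwiner from a word
shorter by two letters. -/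
theorem IsTensorIntertwiner.cap {x y : ColoredWord} {c : Bool} {Y : n → List (Fin N) → ℂ}
    (hY : IsTensorIntertwiner (x ++ c :: (!c) :: y) v Y) :
    IsTensorIntertwiner (x ++ y) v fun a => cap x.length (Y a) := by
  have hU := FreeUnitaryAlgebra.isBiunitary_coord N
  have hlen : (x ++ c :: (!c) :: y).length = (x ++ y).length + 2 := by simp; omega
  refine ⟨fun a => Supp.cap (by rw [← hlen]; exact hY.supp a), fun a j => ?_⟩
  rw [← sum_smul_cup (by simp), ← hlen]
  have h1 := cap_sum (lists (Fin N) (x ++ c :: (!c) :: y).length) x.length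
    (fun q j => Y a q • coordCoef (x ++ c :: (!c) :: y) q j) j
  have h2 := cap_sum Finset.univ x.length (fun b j => Y b j • v a b) j
  simp only [hY.comm, h2] at h1
  have h3 : ∀ b, FreeUnitary.cap x.length (fun j => Y b j • v a b) j =
      FreeUnitary.cap x.length (Y b) j • v a b := fun b =>
    cap_map (AddMonoidHom.mk' (fun z : ℂ => z • v a b) fun z z' => add_smul z z' _) _ _ _
  have h4 : ∀ q, FreeUnitary.cap x.length
      (fun j => Y a q • coordCoef (x ++ c :: (!c) :: y) q j) j =
      Y a q • cup x.length (fun q => coordCoef (x ++ y) q j) q := fun q => by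
    rw [← cap_coef_col hU x c]
    exact cap_map (DistribSMul.toAddMonoidHom _ (Y a q)) _ _ _
  simp only [h3, h4] at h1
  exact h1.symm

variable [DecidableEq n]

/-- Averaging: by invariance, the integrals of entries of `v` times adjoints of entries of `u^k`
form intertwiners. If all of them vanished, then by density `h (v a c * x) = 0` for every `x`,
contradicting `v * vᴴ = 1`. -/
theorem exists_tensorIntertwiner [Nonempty n] (hv : (freeUnitary N).IsCorep v) :
    ∃ k Y, IsTensorIntertwiner k v Y ∧ ∃ a j, Y a j ≠ 0 := by
  have hU := FreeUnitaryAlgebra.isBiunitary_coord N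
  obtain ⟨h, hh, -⟩ := exists_haar N
  obtain ⟨E, hE, hE1⟩ := hh.right_invariant
  have hY : ∀ k c p, p.length = k.length →
      IsTensorIntertwiner k v fun a j => h (v a c * star (coordCoef k j p)) := fun k c p hp => by
    refine ⟨fun a j hj => ?_, fun a r => ?_⟩
    · rw [coordCoef, coef_of_length_ne _ (Or.inl hj), star_zero, mul_zero, map_zero]
    have h1 : ∀ j, h (v a c * star (coordCoef k j p)) • (1 : FreeUnitaryAlgebra N) =
        ∑ m, ∑ q ∈ lists (Fin N) k.length,
          h (v m c * star (coordCoef k q p)) • (v a m * star (coordCoef k j q)) := fun j => by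
      rw [← hE1, map_mul, map_star, hv.comul, comul_coordCoef, star_sum, Finset.sum_mul_sum,
        map_sum]
      refine Finset.sum_congr rfl fun m _ => ?_
      rw [map_sum]
      refine Finset.sum_congr rfl fun q _ => ?_
      rw [star_maxTensor_tmul, maxTensor_tmul_mul_tmul, hE]
    by_cases hr : r.length = k.length
    · calc _ = ∑ j ∈ lists (Fin N) k.length,
            (h (v a c * star (coordCoef k j p)) • (1 : FreeUnitaryAlgebra N)) * coordCoef k j r := by
            simp only [smul_mul_assoc, one_mul]
        _ = ∑ m, ∑ q ∈ lists (Fin N) k.length, h (v m c * star (coordCoef k q p)) •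
            (v a m * ∑ j ∈ lists (Fin N) k.length, star (coordCoef k j q) * coordCoef k j r) := by
            simp only [h1, Finset.sum_mul, smul_mul_assoc, Finset.mul_sum, Finset.smul_sum,
              mul_assoc]
            rw [Finset.sum_comm]
            exact Finset.sum_congr rfl fun m _ => Finset.sum_comm
        _ = _ := by
            refine Finset.sum_congr rfl fun m _ => ?_
            rw [Finset.sum_congr rfl fun q hq => by rw [sum_star_mul_coef hU (mem_lists.1 hq) hr]]
            simp [mem_lists, hr]
    · simp [coordCoef, coef_of_length_ne _ (Or.inl hr), coef_of_length_ne _ (Or.inr hr)]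
  by_contra hc
  push Not at hc
  have h0 : ∀ a c x, h (v a c * x) = 0 := fun a c x => by
    refine DFunLike.congr_fun (f := h.comp (ContinuousLinearMap.mul ℂ _ (v a c))) (g := 0)
      (ext_coordCoef fun k i j hi hj => ?_) x
    have h2 := hc _ _ (hY (ColoredWord.conj k) c j.reverse (by simp [length_conj, hj])) a i.reverse
    rw [coordCoef, star_coef _ (by simp [length_conj, hi]) (by simp [length_conj, hj]), conj_conj,
      List.reverse_reverse, List.reverse_reverse] at h2
    exact h2
  obtain ⟨a⟩ := ‹Nonempty n›
  have h2 := congrArg h (congrFun (congrFun hv.unitary.1 a) a)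
  rw [Matrix.mul_apply, map_sum, Matrix.one_apply_eq, hh.map_one] at h2
  simp [h0] at h2

/-- Descent on the length of the word. If some contraction of `Y` is nonzero, it is a nonzero
intertwiner from a shorter word. Otherwise the rows of `Y` lie in `capKernel`, so its restriction to
`r_k` is nonzero, and Schur's lemma applies. -/
theorem exists_corepEquiv_of_tensorIntertwiner (hN : 2 ≤ N) (hv : (freeUnitary N).IsCorep v)
    (hvi : CorepIrreducible v) (m : ℕ) : ∀ k Y, k.length = m → IsTensorIntertwiner k v Y →
      (∃ a j, Y a j ≠ 0) → ∃ l, CorepEquiv (coordIrrep N l) v := by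
  have hU := FreeUnitaryAlgebra.isBiunitary_coord N
  induction m using Nat.strong_induction_on with
  | _ m ih =>
    intro k Y hk hY h0
    by_cases hc : ∀ a, Y a ∈ capKernel (Fin N) k
    · obtain ⟨a, i, hai⟩ := h0
      let T : Matrix n (Fin (capDim (Fin N) k)) ℂ := Matrix.of fun a b =>
        ∑ j ∈ lists (Fin N) k.length, capBasis k b j * Y a j
      have hT : T ∈ corepHom (coordIrrep N k) v := by
        rw [mem_corepHom]
        intro a c
        calc _ = ∑ j ∈ lists (Fin N) k.length, Y a j •
              ∑ b, capBasis k b j • coordIrrep N k b c := by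
              simp only [T, Matrix.of_apply, Finset.sum_smul, Finset.smul_sum, smul_smul]
              rw [Finset.sum_comm]
              simp only [mul_comm]
          _ = ∑ q ∈ lists (Fin N) k.length, capBasis k c q •
              ∑ j ∈ lists (Fin N) k.length, Y a j • coordCoef k j q := by
              simp only [← sum_capBasis_smul_coef hU, Finset.smul_sum, smul_smul]
              rw [Finset.sum_comm]
              simp only [mul_comm]
          _ = _ := by
              simp only [hY.comm, T, Matrix.of_apply, Finset.sum_smul, Finset.smul_sum, smul_smul]
              exact Finset.sum_comm
      refine ⟨k, corepEquiv_of_ne_zero (isCorep_coordIrrep k).unitary.1 hv.unitary.2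
        (corepIrreducible_coordIrrep hN k) hvi hT fun h => hai ?_⟩
      rw [capBasis_expand_conj (hc a) i]
      refine Finset.sum_eq_zero fun b _ => ?_
      rw [show ∑ j ∈ lists (Fin N) k.length, capBasis k b j * Y a j = 0 from
        congrFun (congrFun h a) b, mul_zero]
    · push Not at hc
      obtain ⟨a, ha⟩ := hc
      rw [mem_capKernel] at ha
      push Not at ha
      obtain ⟨x, c, y, rfl, i, j, hi, hj, hij⟩ := ha (hY.supp a)
      refine ih (x ++ y).length ?_ _ _ rfl hY.cap ⟨a, i ++ j, ?_⟩
      · rw [← hk]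
        simp
      · rwa [← hi, cap_append]

/-- The irreducible corepresentations of `U_N⁺` are indexed by the colored words. -/
theorem existsUnique_corepEquiv (hN : 2 ≤ N) (hv : (freeUnitary N).IsCorep v)
    (hvi : CorepIrreducible v) : ∃! k, CorepEquiv v (coordIrrep N k) := by
  have _ := hvi.1
  obtain ⟨k, Y, hY, h0⟩ := exists_tensorIntertwiner hv
  obtain ⟨l, hl⟩ := exists_corepEquiv_of_tensorIntertwiner hN hv hvi _ k Y rfl hY h0
  exact ⟨l, corepEquiv_symm hl, fun l' hl' =>
    (eq_of_corepEquiv_coordIrrep hN (corepEquiv_trans hl hl')).symm⟩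

end PeterWeyl

/-! ### Tensor products and contraction of a middle word -/

open scoped Matrix ComplexOrder

theorem corepTensor_conjTranspose_mul {A : Type u} [CStarAlgebra A] {m n : Type*} [Fintype m]
    [Fintype n] [DecidableEq m] [DecidableEq n] {v : Matrix m m A} {w : Matrix n n A}
    (hv : vᴴ * v = 1) (hw : wᴴ * w = 1) : (corepTensor v w)ᴴ * corepTensor v w = 1 := by
  ext ⟨a, b⟩ ⟨a', b'⟩
  have h1 := congrFun (congrFun hv a) a'
  have h2 := congrFun (congrFun hw b) b'
  simp only [Matrix.mul_apply, Matrix.conjTranspose_apply] at h1 h2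
  simp only [Matrix.mul_apply, Matrix.conjTranspose_apply, corepTensor, Matrix.of_apply, star_mul,
    Fintype.sum_prod_type]
  have h3 : ∀ c d, star (w d b) * star (v c a) * (v c a' * w d b') =
      star (w d b) * (star (v c a) * v c a') * w d b' := fun c d => by simp only [mul_assoc]
  rw [Finset.sum_comm]
  simp only [h3, ← Finset.sum_mul, ← Finset.mul_sum, h1]
  by_cases h : a = a'
  · subst h
    simp only [Matrix.one_apply_eq, mul_one, h2]
    simp [Matrix.one_apply]
  · simp [h]

section Junction

variable {X : Type u} [Fintype X] [DecidableEq X]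

/-- The contraction of the last `n` indices on the left with the first `n` indices on the right. -/
def junction (n : ℕ) (η : List X → List X → ℂ) (i i' : List X) : ℂ :=
  ∑ m ∈ lists X n, η (i ++ m) (m.reverse ++ i')

/-- The contraction of `y` against `ȳ` intertwines: after splitting off the middle block, unitarity
of the tensor power for `y` reduces the sum over `m` to a Kronecker delta. -/
theorem junction_coef {B : Type*} [Ring B] [StarRing B] [Algebra ℂ B] {w : Matrix X X B}
    (hw : IsBiunitary w) (x y z : ColoredWord) (f g : List X → ℂ) {j j' : List X}
    (hj : j.length = x.length) :
    ∑ m ∈ lists X y.length, (∑ p ∈ lists X (x ++ y).length, f p • coef w (x ++ y) p (j ++ m)) *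
        ∑ q ∈ lists X (ColoredWord.conj y ++ z).length,
          g q • coef w (ColoredWord.conj y ++ z) q (m.reverse ++ j') =
      ∑ i ∈ lists X x.length, ∑ i' ∈ lists X z.length,
        junction y.length (fun p q => f p * g q) i i' • coef w (x ++ z) (i ++ i') (j ++ j') := by
  have h1 : ∀ m ∈ lists X y.length,
      ∑ p ∈ lists X (x ++ y).length, f p • coef w (x ++ y) p (j ++ m) =
      ∑ i ∈ lists X x.length, ∑ n ∈ lists X y.length,
        f (i ++ n) • (coef w x i j * coef w y n m) := fun m _ => by
    rw [List.length_append, sum_lists_add]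
    refine Finset.sum_congr rfl fun i hi => Finset.sum_congr rfl fun n _ => ?_
    rw [coef_append _ (mem_lists.1 hi) hj]
  have h2 : ∀ m ∈ lists X y.length,
      ∑ q ∈ lists X (ColoredWord.conj y ++ z).length,
        g q • coef w (ColoredWord.conj y ++ z) q (m.reverse ++ j') =
      ∑ i' ∈ lists X z.length, ∑ n ∈ lists X y.length,
        g (n.reverse ++ i') • (star (coef w y n m) * coef w z i' j') := fun m hm => by
    rw [mem_lists] at hm
    rw [List.length_append, sum_lists_add, length_conj, ← sum_lists_reverse, Finset.sum_comm]
    refine Finset.sum_congr rfl fun i' _ => Finset.sum_congr rfl fun n hn => ?_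
    rw [mem_lists] at hn
    rw [coef_append _ (by simp [length_conj, hn]) (by simp [length_conj, hm]), ← star_coef _ hn hm]
  rw [Finset.sum_congr rfl fun m hm => by rw [h1 m hm, h2 m hm, Finset.sum_mul_sum],
    Finset.sum_comm]
  refine Finset.sum_congr rfl fun i hi => ?_
  rw [Finset.sum_comm]
  refine Finset.sum_congr rfl fun i' _ => ?_
  calc _ = ∑ n ∈ lists X y.length, ∑ n' ∈ lists X y.length, (f (i ++ n) * g (n'.reverse ++ i')) •
        (coef w x i j * (∑ m ∈ lists X y.length, coef w y n m * star (coef w y n' m)) *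
          coef w z i' j') := by
        simp only [smul_mul_smul_comm, Finset.mul_sum, Finset.sum_mul, Finset.smul_sum]
        refine Finset.sum_comm.trans ((Finset.sum_congr rfl fun _ _ => Finset.sum_comm).trans
          (Finset.sum_comm.trans ?_))
        simp only [mul_assoc]
    _ = _ := by
        rw [junction, Finset.sum_smul]
        refine Finset.sum_congr rfl fun n hn => ?_
        rw [Finset.sum_congr rfl fun n' hn' => by
          rw [sum_coef_mul_star hw (mem_lists.1 hn) (mem_lists.1 hn')],
          coef_append _ (mem_lists.1 hi) hj]
        simp only [mul_ite, mul_one, mul_zero, ite_mul, zero_mul, smul_ite, smul_zero]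
        rw [Finset.sum_ite_eq, if_pos hn]

/-- The intertwiner corresponding to the summand `r_{xz}` of `r_k ⊗ r_l`, for `k = xy`
and `l = ȳz`. -/
def fusionMap (X : Type u) [Fintype X] (k l x y z : ColoredWord) :
    Matrix (Fin (capDim X k) × Fin (capDim X l)) (Fin (capDim X (x ++ z))) ℂ :=
  Matrix.of fun a c => ∑ i ∈ lists X x.length, ∑ i' ∈ lists X z.length,
    junction y.length (fun p q => starRingEnd ℂ (capBasis k a.1 p) *
      starRingEnd ℂ (capBasis l a.2 q)) i i' * capBasis (x ++ z) c (i ++ i')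

theorem fusionMap_mem {A : Type u} [CStarAlgebra A] {w : Matrix X X A} (hw : IsBiunitary w)
    {k l x y z : ColoredWord} (hk : k = x ++ y) (hl : l = ColoredWord.conj y ++ z) :
    fusionMap X k l x y z ∈
      corepHom (irrep w (x ++ z)) (corepTensor (irrep w k) (irrep w l)) := by
  rw [mem_corepHom]
  rintro ⟨a, b⟩ c
  calc _ = ∑ i ∈ lists X x.length, ∑ i' ∈ lists X z.length,
        junction y.length (fun p q => starRingEnd ℂ (capBasis k a p) *
          starRingEnd ℂ (capBasis l b q)) i i' •
          ∑ d, capBasis (x ++ z) d (i ++ i') • irrep w (x ++ z) d c := by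
        simp only [fusionMap, Matrix.of_apply, Finset.sum_smul, Finset.smul_sum, smul_smul]
        rw [Finset.sum_comm]
        exact Finset.sum_congr rfl fun i _ => Finset.sum_comm
    _ = ∑ j ∈ lists X x.length, ∑ j' ∈ lists X z.length, capBasis (x ++ z) c (j ++ j') •
        ∑ i ∈ lists X x.length, ∑ i' ∈ lists X z.length,
        junction y.length (fun p q => starRingEnd ℂ (capBasis k a p) *
          starRingEnd ℂ (capBasis l b q)) i i' • coef w (x ++ z) (i ++ i') (j ++ j') := by
        simp only [← sum_capBasis_smul_coef hw, List.length_append, sum_lists_add, Finset.smul_sum]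
        refine (Finset.sum_congr rfl fun _ _ => Finset.sum_comm.trans
          (Finset.sum_congr rfl fun _ _ => Finset.sum_comm)).trans (Finset.sum_comm.trans
          (Finset.sum_congr rfl fun _ _ => Finset.sum_comm.trans
          (Finset.sum_congr rfl fun _ _ => Finset.sum_congr rfl fun _ _ =>
            Finset.sum_congr rfl fun _ _ => smul_comm _ _ _)))
    _ = ∑ j ∈ lists X x.length, ∑ j' ∈ lists X z.length, capBasis (x ++ z) c (j ++ j') •
        ∑ m ∈ lists X y.length,
          (∑ a', starRingEnd ℂ (capBasis k a' (j ++ m)) • irrep w k a a') *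
          ∑ b', starRingEnd ℂ (capBasis l b' (m.reverse ++ j')) • irrep w l b b' := by
        refine Finset.sum_congr rfl fun j hj => Finset.sum_congr rfl fun j' _ => congrArg _ ?_
        subst hk hl
        rw [← junction_coef hw x y z _ _ (mem_lists.1 hj)]
        simp only [sum_conj_capBasis_smul_coef hw]
    _ = ∑ j ∈ lists X x.length, ∑ j' ∈ lists X z.length, capBasis (x ++ z) c (j ++ j') •
        ∑ a', ∑ b', junction y.length (fun p q => starRingEnd ℂ (capBasis k a' p) *
          starRingEnd ℂ (capBasis l b' q)) j j' • (irrep w k a a' * irrep w l b b') := by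
        refine Finset.sum_congr rfl fun j hj => Finset.sum_congr rfl fun j' _ => congrArg _ ?_
        simp only [junction, Finset.sum_smul, Finset.sum_mul_sum, smul_mul_smul_comm]
        exact Finset.sum_comm.trans (Finset.sum_congr rfl fun _ _ => Finset.sum_comm)
    _ = _ := by
        simp only [fusionMap, Matrix.of_apply, Finset.sum_smul, Finset.smul_sum, smul_smul,
          Fintype.sum_prod_type, mul_comm (capBasis (x ++ z) c _)]
        refine (Finset.sum_congr rfl fun _ _ => Finset.sum_comm).trans (Finset.sum_comm.trans
          (Finset.sum_congr rfl fun _ _ => ?_))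
        exact (Finset.sum_congr rfl fun _ _ => Finset.sum_comm).trans Finset.sum_comm

omit [DecidableEq X] in
-- The adjoint of `fusionMap` made explicit: expand `η` as a tensor on the two words, contract the
-- middle word `y`, and take coordinates along `capKernel` for `x ++ z`.
theorem sum_conj_fusionMap_mul {k l x y z : ColoredWord}
    (η : Fin (capDim X k) × Fin (capDim X l) → ℂ) (c : Fin (capDim X (x ++ z))) :
    ∑ a, starRingEnd ℂ (fusionMap X k l x y z a c) * η a =
      ∑ i ∈ lists X x.length, ∑ i' ∈ lists X z.length,
        starRingEnd ℂ (capBasis (x ++ z) c (i ++ i')) *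
          junction y.length (fun p q => ∑ a, η a * (capBasis k a.1 p * capBasis l a.2 q)) i i' := by
  simp only [fusionMap, Matrix.of_apply, junction, map_sum, map_mul, Complex.conj_conj,
    Finset.sum_mul, Finset.mul_sum]
  refine Finset.sum_comm.trans (Finset.sum_congr rfl fun i _ => Finset.sum_comm.trans
    (Finset.sum_congr rfl fun i' _ => Finset.sum_comm.trans (Finset.sum_congr rfl fun m _ =>
      Finset.sum_congr rfl fun a _ => ?_)))
  ring

omit [DecidableEq X] in
-- Induction on the length of `x`. A contraction of the junction inside `x` or inside `z` is zero by
-- the assumptions on `η`. The contraction straddling the two words is the junction for a shorter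
-- `x` and a longer middle word, zero by induction. So the junction lies in `capKernel` for `x ++
-- z`, where `h` makes all its coordinates vanish.
theorem junction_eq_zero {k l : ColoredWord} {η : List X → List X → ℂ}
    (hη : ∀ q, (fun p => η p q) ∈ capKernel X k) (hη' : ∀ p, η p ∈ capKernel X l)
    (h : ∀ x y z, k = x ++ y → l = ColoredWord.conj y ++ z → ∀ c,
      ∑ i ∈ lists X x.length, ∑ i' ∈ lists X z.length,
        starRingEnd ℂ (capBasis (x ++ z) c (i ++ i')) * junction y.length η i i' = 0)
    (n : ℕ) : ∀ x y z, x.length = n → k = x ++ y → l = ColoredWord.conj y ++ z →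
      ∀ i i', i.length = x.length → i'.length = z.length → junction y.length η i i' = 0 := by
  induction n using Nat.strong_induction_on with
  | _ n ih =>
    intro x y z hx hk hl
    let f : List X → ℂ := fun s => if s.length = x.length + z.length then
      junction y.length η (s.take x.length) (s.drop x.length) else 0
    have hf : ∀ i i', i.length = x.length → i'.length = z.length →
        f (i ++ i') = junction y.length η i i' := fun i i' hi hi' => by
      simp only [f, List.length_append, hi, hi', if_true]
      rw [← hi, List.take_left, List.drop_left]
    have hmem : f ∈ capKernel X (x ++ z) := by
      refine mem_capKernel.2 ⟨fun s hs => if_neg (by simpa using hs), ?_⟩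
      intro x₁ a y₁ he i j hi hj
      have right : ∀ u, x₁ = x ++ u → z = u ++ a :: (!a) :: y₁ →
          ∑ b, f (i ++ b :: b :: j) = 0 := by
        rintro u rfl rfl
        obtain ⟨i, i₁, rfl, hi, hi₁⟩ := exists_split (p := x.length) (by simp) hi
        have hi₁ : i₁.length = u.length := by simpa using hi₁
        have h1 : ∀ b, f (i ++ i₁ ++ b :: b :: j) = ∑ m ∈ lists X y.length,
            η (i ++ m) (m.reverse ++ i₁ ++ b :: b :: j) := fun b => by
          rw [List.append_assoc, hf _ _ hi (by simp [hi₁, hj]), junction]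
          simp only [List.append_assoc]
        simp only [h1]
        rw [Finset.sum_comm]
        refine Finset.sum_eq_zero fun m hm => ?_
        exact (mem_capKernel.1 (hη' (i ++ m))).2 (ColoredWord.conj y ++ u) a y₁ (by simp [hl])
          _ _ (by simp [length_conj, hi₁, mem_lists.1 hm]) hj
      rcases List.append_eq_append_iff.1 he with ⟨u, h1, h2⟩ | ⟨u, h1, h2⟩
      · exact right u h1 h2
      · match u, h1, h2 with
        | [], h1, h2 => exact right [] (by simpa using h1.symm) (by simpa using h2.symm)
        | [c], h1, h2 =>
          obtain ⟨rfl, rfl⟩ : a = c ∧ (!a) :: y₁ = z := by simpa using h2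
          have h3 : ∀ b, f (i ++ b :: b :: j) = junction y.length η (i ++ [b]) (b :: j) :=
            fun b => by
              rw [← hf _ _ (by simp [h1, hi]) (by simp [hj])]
              simp
          have h4 := ih x₁.length (by rw [← hx, h1]; simp) x₁ (a :: y) y₁ rfl (by simp [hk, h1])
            (by simp [hl, conj_cons]) i j hi hj
          rw [junction, List.length_cons, sum_lists_succ] at h4
          simp only [h3, junction]
          simpa using h4
        | c :: c' :: u, h1, h2 =>
          obtain ⟨rfl, rfl, rfl⟩ : a = c ∧ (!a) = c' ∧ y₁ = u ++ z := by simpa using h2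
          obtain ⟨j, j₁, rfl, hj, hj₁⟩ := exists_split (p := u.length) (by simp) hj
          have hj₁ : j₁.length = z.length := by simpa using hj₁
          have h3 : ∀ b, f (i ++ b :: b :: (j ++ j₁)) = ∑ m ∈ lists X y.length,
              η (i ++ b :: b :: (j ++ m)) (m.reverse ++ j₁) := fun b => by
            have := hf (i ++ b :: b :: j) j₁ (by simp [h1, hi, hj]) hj₁
            simpa [junction] using this
          simp only [h3]
          rw [Finset.sum_comm]
          refine Finset.sum_eq_zero fun m hm => ?_
          exact (mem_capKernel.1 (hη (m.reverse ++ j₁))).2 x₁ a (u ++ y) (by simp [hk, h1])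
            _ _ hi (by simp [hj, mem_lists.1 hm])
    intro i i' hi hi'
    rw [← hf i i' hi hi', capBasis_expand hmem]
    refine Finset.sum_eq_zero fun c _ => mul_eq_zero_of_right _ ?_
    rw [List.length_append, sum_lists_add, ← h x y z hk hl c]
    refine Finset.sum_congr rfl fun p hp => Finset.sum_congr rfl fun q hq => ?_
    rw [hf p q (mem_lists.1 hp) (mem_lists.1 hq)]

end Junction

/-! ### The fusion rules -/

section Fusion

variable {N : ℕ}

/-- The basis vectors at the alternating indices `p` and `q` lie in the kernels for `k` and `l`.
Reversing one of them makes the two agree along `y`, so their junction is exactly the basis vector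
at `i ++ i'`. Were the map zero, all vectors of the kernel for `x ++ z` would vanish at `i ++ i'`.
-/
theorem fusionMap_ne_zero (hN : 2 ≤ N) {k l x y z : ColoredWord} (hk : k = x ++ y)
    (hl : l = ColoredWord.conj y ++ z) : fusionMap (Fin N) k l x y z ≠ 0 := by
  intro h0
  have hp : (altList hN k.length 0).reverse =
      (altList hN x.length y.length).reverse ++ (altList hN y.length 0).reverse := by
    rw [hk, List.length_append, add_comm, altList_add, List.reverse_append, zero_add]
  have hq : altList hN l.length 0 = altList hN y.length 0 ++ altList hN z.length y.length := by
    rw [hl, List.length_append, length_conj, altList_add, zero_add]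
  set i := (altList hN x.length y.length).reverse with hi
  set i' := altList hN z.length y.length with hi'
  set p := (altList hN k.length 0).reverse with hp'
  set q := altList hN l.length 0 with hq'
  have hil : i.length = x.length := by simp [hi, length_altList]
  have hil' : i'.length = z.length := by simp [hi', length_altList]
  have hα : (Pi.single p 1 : List (Fin N) → ℂ) ∈ capKernel (Fin N) k :=
    single_mem_capKernel (by simp [hp', length_altList])
      (List.isChain_reverse.2 ((isChain_altList hN _ _).imp fun _ _ h => h.symm))
  have hβ : (Pi.single q 1 : List (Fin N) → ℂ) ∈ capKernel (Fin N) l :=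
    single_mem_capKernel (by simp [hq', length_altList]) (isChain_altList hN _ _)
  have h1 : ∀ c, starRingEnd ℂ (capBasis (x ++ z) c (i ++ i')) = 0 := fun c => by
    have h2 := sum_conj_fusionMap_mul (x := x) (y := y) (z := z)
      (fun a : Fin (capDim (Fin N) k) × Fin (capDim (Fin N) l) =>
      (∑ j ∈ lists (Fin N) k.length, starRingEnd ℂ (capBasis k a.1 j) *
        (Pi.single p 1 : List (Fin N) → ℂ) j) *
      ∑ j ∈ lists (Fin N) l.length, starRingEnd ℂ (capBasis l a.2 j) *
        (Pi.single q 1 : List (Fin N) → ℂ) j) c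
    have h3 : (fun r s => ∑ a : Fin (capDim (Fin N) k) × Fin (capDim (Fin N) l),
        ((∑ j ∈ lists (Fin N) k.length, starRingEnd ℂ (capBasis k a.1 j) *
          (Pi.single p 1 : List (Fin N) → ℂ) j) *
        ∑ j ∈ lists (Fin N) l.length, starRingEnd ℂ (capBasis l a.2 j) *
          (Pi.single q 1 : List (Fin N) → ℂ) j) * (capBasis k a.1 r * capBasis l a.2 s)) =
        fun r s => (Pi.single p 1 : List (Fin N) → ℂ) r * (Pi.single q 1 : List (Fin N) → ℂ) s := by
      funext r s
      rw [capBasis_expand hα r, capBasis_expand hβ s, Finset.sum_mul_sum, Fintype.sum_prod_type]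
      refine Finset.sum_congr rfl fun a _ => Finset.sum_congr rfl fun b _ => ?_
      ring
    rw [h3] at h2
    simp only [h0, Matrix.zero_apply, map_zero, zero_mul, Finset.sum_const_zero] at h2
    rw [Finset.sum_eq_single i, Finset.sum_eq_single i'] at h2
    · have h4 : junction y.length (fun r s => (Pi.single p 1 : List (Fin N) → ℂ) r *
          (Pi.single q 1 : List (Fin N) → ℂ) s) i i' = 1 := by
        rw [junction, Finset.sum_eq_single (altList hN y.length 0).reverse]
        · rw [← hp, List.reverse_reverse, ← hq, Pi.single_eq_same, Pi.single_eq_same, mul_one]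
        · intro m _ hm
          rw [Pi.single_eq_of_ne, zero_mul]
          intro he
          rw [hp] at he
          exact hm (List.append_cancel_left he)
        · intro hm
          exact absurd (mem_lists.2 (by simp [length_altList])) hm
      rw [h4, mul_one] at h2
      exact h2.symm
    · intro r hr hri
      refine mul_eq_zero_of_right _ (Finset.sum_eq_zero fun m hm => ?_)
      refine mul_eq_zero_of_right _ (Pi.single_eq_of_ne (fun he => hri ?_) _)
      rw [hq] at he
      exact (List.append_inj' he (by rw [hil', mem_lists.1 hr])).2
    · intro hr
      exact absurd (mem_lists.2 hil') hr
    · intro r hr hri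
      refine Finset.sum_eq_zero fun s _ =>
        mul_eq_zero_of_right _ (Finset.sum_eq_zero fun m hm => ?_)
      refine mul_eq_zero_of_left (Pi.single_eq_of_ne (fun he => hri ?_) _) _
      rw [hp] at he
      exact (List.append_inj he (by rw [hil, mem_lists.1 hr])).1
    · intro hr
      exact absurd (mem_lists.2 hil) hr
  -- The index `i ++ i'` may repeat a letter at the junction, so its basis vector need not be in the
  -- kernel; `signVec` is, and is nonzero at every index with letters in `{0, 1}`.
  refine signVec_ne_zero (k := x ++ z) (i := i ++ i') (by simp [hil, hil']) (fun b hb => ?_) ?_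
  · rcases List.mem_append.1 hb with hb | hb
    · exact altList_lt hN _ _ b (List.mem_reverse.1 hb)
    · exact altList_lt hN _ _ b hb
  · rw [capBasis_expand (signVec_mem_capKernel hN (x ++ z))]
    refine Finset.sum_eq_zero fun c _ => ?_
    rw [(map_eq_zero _).1 (h1 c), zero_mul]

/-- The summands exhaust the tensor product: for `x = k` and empty `y` the junction is the vector
with coordinates `η` itself, and `junction_eq_zero` applies. -/
theorem eq_zero_of_fusionMap {k l : ColoredWord}
    {η : Fin (capDim (Fin N) k) × Fin (capDim (Fin N) l) → ℂ}
    (h : ∀ x y z, k = x ++ y → l = ColoredWord.conj y ++ z → ∀ c,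
      ∑ a, starRingEnd ℂ (fusionMap (Fin N) k l x y z a c) * η a = 0) : η = 0 := by
  have h1 := junction_eq_zero (k := k) (l := l)
    (η := fun p q => ∑ a, η a * (capBasis k a.1 p * capBasis l a.2 q)) (fun q => ?_) (fun p => ?_)
    (fun x y z hk hl c => by rw [← sum_conj_fusionMap_mul, h x y z hk hl])
    k.length k [] l rfl (by simp) (by simp [conj_nil])
  · ext ⟨a, b⟩
    have h2 : η (a, b) = ∑ p ∈ lists (Fin N) k.length, ∑ q ∈ lists (Fin N) l.length,
        (starRingEnd ℂ (capBasis k a p) * starRingEnd ℂ (capBasis l b q)) *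
          ∑ c, η c * (capBasis k c.1 p * capBasis l c.2 q) := by
      calc _ = ∑ c : Fin (capDim (Fin N) k) × Fin (capDim (Fin N) l), η c *
            ((∑ p ∈ lists (Fin N) k.length, starRingEnd ℂ (capBasis k a p) * capBasis k c.1 p) *
            ∑ q ∈ lists (Fin N) l.length, starRingEnd ℂ (capBasis l b q) * capBasis l c.2 q) := by
            simp [capBasis_orthonormal, Fintype.sum_prod_type]
        _ = _ := by
            simp_rw [Finset.sum_mul_sum]
            simp only [Finset.mul_sum]
            refine Finset.sum_comm.trans (Finset.sum_congr rfl fun p _ => Finset.sum_comm.trans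
              (Finset.sum_congr rfl fun q _ => Finset.sum_congr rfl fun c _ => ?_))
            ring
    rw [h2]
    refine Finset.sum_eq_zero fun p hp => Finset.sum_eq_zero fun q hq => ?_
    have h3 := h1 p q (mem_lists.1 hp) (mem_lists.1 hq)
    simp only [junction, List.length_nil, sum_lists_zero, List.append_nil, List.reverse_nil,
      List.nil_append] at h3
    rw [h3, mul_zero]
  · have : (fun p => ∑ a, η a * (capBasis k a.1 p * capBasis l a.2 q)) =
        ∑ a, (η a * capBasis l a.2 q) • capBasis k a.1 := by
      ext p
      simp only [Finset.sum_apply, Pi.smul_apply, smul_eq_mul]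
      exact Finset.sum_congr rfl fun a _ => by ring
    rw [this]
    exact Submodule.sum_mem _ fun a _ => Submodule.smul_mem _ _ (capBasis_mem k a.1)
  · have : (fun q => ∑ a, η a * (capBasis k a.1 p * capBasis l a.2 q)) =
        ∑ a, (η a * capBasis k a.1 p) • capBasis l a.2 := by
      ext q
      simp only [Finset.sum_apply, Pi.smul_apply, smul_eq_mul]
      exact Finset.sum_congr rfl fun a _ => by ring
    rw [this]
    exact Submodule.sum_mem _ fun a _ => Submodule.smul_mem _ _ (capBasis_mem l a.2)

/-- The length of `x ++ z` determines that of `y`, hence those of `x` and `z`. So the fusion rules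
are multiplicity free. -/
theorem fusionIndex_ext {k l : ColoredWord} {s t : FusionIndex k l}
    (h : s.1.1 ++ s.1.2.2 = t.1.1 ++ t.1.2.2) : s = t := by
  obtain ⟨⟨x, y, z⟩, h1, h2⟩ := s
  obtain ⟨⟨x', y', z'⟩, h1', h2'⟩ := t
  simp only at h h1 h2 h1' h2'
  have e1 := congrArg List.length h
  have e2 := congrArg List.length (h1.symm.trans h1')
  have e3 := congrArg List.length (h2.symm.trans h2')
  simp only [List.length_append, length_conj] at e1 e2 e3
  obtain ⟨rfl, rfl⟩ := List.append_inj h (by omega)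
  obtain rfl := List.append_cancel_left (h1.symm.trans h1')
  rfl

/-- The fusion rules. -/
theorem corepEquiv_corepTensor (hN : 2 ≤ N) (k l : ColoredWord) :
    CorepEquiv (corepTensor (coordIrrep N k) (coordIrrep N l))
      (corepSum fun t : FusionIndex k l => coordIrrep N (t.1.1 ++ t.1.2.2)) := by
  have hU := FreeUnitaryAlgebra.isBiunitary_coord N
  let T : ∀ t : FusionIndex k l, Matrix (Fin (capDim (Fin N) k) × Fin (capDim (Fin N) l))
    (Fin (capDim (Fin N) (t.1.1 ++ t.1.2.2))) ℂ := fun t =>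
    fusionMap (Fin N) k l t.1.1 t.1.2.1 t.1.2.2
  have hT : ∀ t, T t ∈ corepHom (coordIrrep N (t.1.1 ++ t.1.2.2))
      (corepTensor (coordIrrep N k) (coordIrrep N l)) := fun t =>
    fusionMap_mem hU t.2.1 t.2.2
  have hT' : ∀ t, (T t)ᴴ ∈ corepHom (corepTensor (coordIrrep N k) (coordIrrep N l))
      (coordIrrep N (t.1.1 ++ t.1.2.2)) := fun t =>
    conjTranspose_mem_corepHom (isCorep_coordIrrep _).unitary.1
      (corepTensor_conjTranspose_mul (isCorep_coordIrrep k).unitary.2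
        (isCorep_coordIrrep l).unitary.2) (hT t)
  -- Different indices have different words `x ++ z`, between which there are no nonzero
  -- intertwiners.
  have hne : ∀ s t, s ≠ t → (T s)ᴴ * T t = 0 := fun s t hst =>
    eq_zero_of_mem_corepHom_coordIrrep (fun h => hst (fusionIndex_ext h).symm)
      (comp_mem_corepHom (hT t) (hT' s))
  -- By irreducibility each `T t` is a multiple of an isometry, nonzero by `fusionMap_ne_zero`.
  have heq : ∀ t, ∃ c : ℂ, c ≠ 0 ∧ (T t)ᴴ * T t = c • 1 := fun t => by
    obtain ⟨c, hc⟩ := exists_eq_smul_one_of_mem_corepHom_coordIrrep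
      (comp_mem_corepHom (hT t) (hT' t))
    refine ⟨c, ?_, hc⟩
    rintro rfl
    rw [zero_smul] at hc
    exact fusionMap_ne_zero hN t.2.1 t.2.2 (Matrix.conjTranspose_mul_self_eq_zero.1 hc)
  choose c hc0 hc using heq
  let S : Matrix (Σ t : FusionIndex k l, Fin (capDim (Fin N) (t.1.1 ++ t.1.2.2)))
      (Fin (capDim (Fin N) k) × Fin (capDim (Fin N) l)) ℂ :=
    Matrix.of fun x a => (T x.1)ᴴ x.2 a
  let C : Matrix (Σ t : FusionIndex k l, Fin (capDim (Fin N) (t.1.1 ++ t.1.2.2)))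
      (Σ t : FusionIndex k l, Fin (capDim (Fin N) (t.1.1 ++ t.1.2.2))) ℂ :=
    Matrix.diagonal fun x => (c x.1)⁻¹
  have hSS : S * (Sᴴ * C) = 1 := by
    rw [← Matrix.mul_assoc]
    ext ⟨s, a⟩ ⟨t, b⟩
    rw [Matrix.mul_diagonal]
    have h1 : (S * Sᴴ) ⟨s, a⟩ ⟨t, b⟩ = ((T s)ᴴ * T t) a b := by
      simp [S, Matrix.mul_apply]
    rw [h1]
    by_cases hst : s = t
    · subst hst
      rw [hc, Matrix.smul_apply, smul_eq_mul, mul_right_comm, mul_inv_cancel₀ (hc0 s), one_mul]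
      simp [Matrix.one_apply]
    · rw [hne s t hst, Matrix.zero_apply, zero_mul, Matrix.one_apply_ne]
      intro h
      exact hst (congrArg Sigma.fst h)
  refine ⟨S, ?_, _, hSS, ?_⟩
  · rw [mem_corepHom]
    rintro ⟨t, a⟩ b
    refine (mem_corepHom.1 (hT' t) a b).trans ?_
    rw [Fintype.sum_sigma, Finset.sum_eq_single t]
    · simp only [corepSum, Matrix.blockDiagonal'_apply_eq]
      rfl
    · intro s _ hst
      refine Finset.sum_eq_zero fun d _ => ?_
      rw [corepSum, Matrix.blockDiagonal'_apply_ne _ _ _ hst.symm, smul_zero]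
    · simp
  -- The matrix `S` has a right inverse, so `S` kills the defect `D` of the left inverse; `S` being
  -- injective, `D = 0`.
  · rw [← sub_eq_zero]
    set D := Sᴴ * C * S - 1 with hD
    have h1 : S * D = 0 := by
      rw [hD, Matrix.mul_sub, Matrix.mul_one, ← Matrix.mul_assoc, hSS, Matrix.one_mul, sub_self]
    ext a b
    refine congrFun (eq_zero_of_fusionMap (η := fun a => D a b) fun x y z hk hl d => ?_) a
    have h2 := congrFun (congrFun h1 ⟨⟨(x, y, z), hk, hl⟩, d⟩) b
    rw [Matrix.mul_apply] at h2
    exact h2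

end Fusion

/-! ### The recursion for noncrossing matching pairings -/

section NoncrossingCount

/-- The noncrossing pairings of a linearly ordered set, which match the colors. -/
structure IsNCPairing {α : Type*} [LinearOrder α] (col : α → Bool) (π : α → α) : Prop where
  invol : ∀ i, π (π i) = i
  ne : ∀ i, π i ≠ i
  color : ∀ i, col (π i) ≠ col i
  noncrossing : ∀ i j, ¬ (i < j ∧ j < π i ∧ π i < π j)

/-- The number of noncrossing pairings of `w` which do not pair any two of the first `c` letters. -/
def cutCard (w : ColoredWord) (c : ℕ) : ℕ :=
  Nat.card {π : Fin w.length → Fin w.length // IsNCPairing w.get π ∧ ∀ i, i.1 < c → c ≤ (π i).1}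

theorem card_NCMatchingPairing (w : ColoredWord) :
    Nat.card (NCMatchingPairing w) = cutCard w 0 :=
  Nat.card_congr (Equiv.subtypeEquivRight fun _ =>
    ⟨fun h => ⟨⟨h.1, h.2.1, h.2.2.1, h.2.2.2⟩, fun _ _ => Nat.zero_le _⟩,
      fun h => ⟨h.1.1, h.1.2, h.1.3, h.1.4⟩⟩)

theorem cutCard_length (w : ColoredWord) : cutCard w w.length = if w = [] then 1 else 0 := by
  split_ifs with h
  · subst h
    rw [cutCard, Nat.card_eq_one_iff_unique]
    refine ⟨⟨fun a b => Subtype.ext (funext fun i => i.elim0)⟩, ⟨⟨id, ⟨fun i => i.elim0,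
      fun i => i.elim0, fun i => i.elim0, fun i => i.elim0⟩, fun i => i.elim0⟩⟩⟩
  · rw [cutCard, Nat.card_eq_zero]
    refine Or.inl ⟨fun π => ?_⟩
    have h1 := π.2.2 ⟨0, List.length_pos_iff.2 h⟩ (List.length_pos_iff.2 h)
    have h2 := (π.1 ⟨0, List.length_pos_iff.2 h⟩).2
    omega

/-- Split according to whether the letter at position `c` is paired with an earlier one. -/
theorem cutCard_eq_add (w : ColoredWord) (c : Fin w.length) :
    cutCard w c = cutCard w (c + 1) +
      Nat.card {π : Fin w.length → Fin w.length // (IsNCPairing w.get π ∧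
        ∀ i, i < c → c ≤ π i) ∧ π c < c} := by
  classical
  let p : (Fin w.length → Fin w.length) → Prop := fun π =>
    IsNCPairing w.get π ∧ ∀ i, i.1 < c.1 → c.1 ≤ (π i).1
  let q : (Fin w.length → Fin w.length) → Prop := fun π =>
    IsNCPairing w.get π ∧ ∀ i, i.1 < c.1 + 1 → c.1 + 1 ≤ (π i).1
  let r : (Fin w.length → Fin w.length) → Prop := fun π => p π ∧ π c < c
  have hpq : ∀ π, p π ↔ q π ∨ r π := fun π => by
    constructor
    · intro h
      by_cases h1 : π c < c
      · exact Or.inr ⟨h, h1⟩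
      · refine Or.inl ⟨h.1, fun i hi => ?_⟩
        have h2 : π c ≠ c := h.1.ne c
        rw [Ne, Fin.ext_iff] at h2
        rw [Fin.lt_def] at h1
        rcases Nat.lt_succ_iff_lt_or_eq.1 hi with hi | hi
        · have h3 := h.2 i hi
          have h4 : (π i).1 ≠ c.1 := fun h4 => by
            have h5 : π i = c := Fin.ext h4
            have h6 := h.1.invol i
            rw [h5] at h6
            rw [h6] at h1
            omega
          omega
        · rw [show i = c from Fin.ext hi]
          omega
    · rintro (h | h)
      · refine ⟨h.1, fun i hi => ?_⟩
        have := h.2 i (by omega)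
        omega
      · exact h.1
  have hd : Disjoint q r := by
    rw [Pi.disjoint_iff]
    intro π
    rw [Prop.disjoint_iff]
    rintro ⟨h1, h2⟩
    have h3 := h1.2 c (by omega)
    have h4 := h2.2
    rw [Fin.lt_def] at h4
    omega
  calc cutCard w c = Nat.card {π // q π ∨ r π} :=
        Nat.card_congr (Equiv.subtypeEquivRight hpq)
    _ = Nat.card ({π // q π} ⊕ {π // r π}) := Nat.card_congr (subtypeOrEquiv q r hd)
    _ = _ := Nat.card_sum

/-- Otherwise the letter just before `c` lies strictly under the string ending at `c`; having to be
paired beyond `c`, it would produce a crossing. -/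
theorem apply_eq_of_lt {w : ColoredWord} {c : Fin w.length} {π : Fin w.length → Fin w.length}
    (hπ : IsNCPairing w.get π) (h : ∀ i, i < c → c ≤ π i) (hc : π c < c) :
    (π c).1 + 1 = c.1 := by
  by_contra hne
  rw [Fin.lt_def] at hc
  let j : Fin w.length := ⟨c.1 - 1, by omega⟩
  have hj : j.1 = c.1 - 1 := rfl
  have h1 := h j (Fin.lt_def.2 (by omega))
  have h2 : π j ≠ c := fun h2 => by
    have h3 := hπ.invol j
    rw [h2] at h3
    rw [h3] at hne
    omega
  refine hπ.noncrossing (π c) j ⟨Fin.lt_def.2 (by omega), ?_, ?_⟩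
  · rw [hπ.invol, Fin.lt_def]
    omega
  · rw [hπ.invol]
    exact lt_of_le_of_ne h1 h2.symm

theorem card_eq_zero_of_color {w : ColoredWord} {c : Fin w.length}
    (h : ∀ j : Fin w.length, j.1 + 1 = c.1 → w.get j = w.get c) :
    Nat.card {π : Fin w.length → Fin w.length // (IsNCPairing w.get π ∧
      ∀ i, i < c → c ≤ π i) ∧ π c < c} = 0 := by
  rw [Nat.card_eq_zero]
  exact Or.inl ⟨fun π => π.2.1.1.color c (h _ (apply_eq_of_lt π.2.1.1 π.2.1.2 π.2.2))⟩

/-- Deletion of two neighbours which are paired. -/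
theorem card_delete {α β : Type*} [LinearOrder α] [LinearOrder β] {cα : α → Bool} {cβ : β → Bool}
    (e : α ↪o β) {p q : β} (hpq : p < q) (hp : ∀ i, e i ≠ p) (hq : ∀ i, e i ≠ q)
    (hr : ∀ j, j ≠ p → j ≠ q → ∃ i, e i = j) (hadj : ∀ j, p < j → q ≤ j)
    (hcol : ∀ i, cβ (e i) = cα i) (hc : cβ p ≠ cβ q) :
    Nat.card {π : β → β // (IsNCPairing cβ π ∧ ∀ i, i < q → q ≤ π i) ∧ π q < q} =
      Nat.card {π : α → α // IsNCPairing cα π ∧ ∀ i, e i < q → q ≤ e (π i)} := by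
  classical
  -- Extends a pairing by the string joining `p` and `q`.
  let F : (α → α) → β → β := fun π j =>
    if h : ∃ i, e i = j then e (π h.choose) else if j = p then q else p
  have Fe : ∀ π i, F π (e i) = e (π i) := fun π i => by
    have h : ∃ i', e i' = e i := ⟨i, rfl⟩
    simp only [F, dif_pos h]
    rw [e.injective h.choose_spec]
  have Fp : ∀ π, F π p = q := fun π => by
    simp [F, hp]
  have Fq : ∀ π, F π q = p := fun π => by
    simp [F, hq, hpq.ne']
  have hβ : ∀ {Q : β → Prop}, Q p → Q q → (∀ i, Q (e i)) → ∀ j, Q j := fun {Q} h1 h2 h3 j => by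
    by_cases hjp : j = p
    · exact hjp ▸ h1
    by_cases hjq : j = q
    · exact hjq ▸ h2
    obtain ⟨i, rfl⟩ := hr j hjp hjq
    exact h3 i
  have hF : ∀ π : α → α, (IsNCPairing cα π ∧ ∀ i, e i < q → q ≤ e (π i)) →
      (IsNCPairing cβ (F π) ∧ ∀ i, i < q → q ≤ F π i) ∧ F π q < q := fun π h => by
    refine ⟨⟨⟨hβ ?_ ?_ fun i => ?_, hβ ?_ ?_ fun i => ?_, hβ ?_ ?_ fun i => ?_,
      hβ ?_ ?_ fun i => hβ ?_ ?_ fun j => ?_⟩, hβ ?_ ?_ fun i => ?_⟩, ?_⟩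
    · rw [Fp, Fq]
    · rw [Fq, Fp]
    · rw [Fe, Fe, h.1.invol]
    · rw [Fp]
      exact hpq.ne'
    · rw [Fq]
      exact hpq.ne
    · rw [Fe]
      exact e.injective.ne (h.1.ne i)
    · rw [Fp]
      exact hc.symm
    · rw [Fq]
      exact hc
    · rw [Fe, hcol, hcol]
      exact h.1.color i
    · rintro j ⟨h1, h2, -⟩
      rw [Fp] at h2
      exact absurd (hadj j h1) h2.not_ge
    · rintro j ⟨h1, h2, -⟩
      rw [Fq] at h2
      exact absurd ((h1.trans h2).trans hpq) (lt_irrefl _)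
    · rintro ⟨-, h2, h3⟩
      rw [Fp] at h3
      exact absurd (hadj _ h2) h3.not_ge
    · rintro ⟨-, h2, h3⟩
      rw [Fq] at h3
      exact absurd ((h2.trans h3).trans hpq) (lt_irrefl _)
    · rw [Fe, Fe, e.lt_iff_lt, e.lt_iff_lt, e.lt_iff_lt]
      exact h.1.noncrossing i j
    · exact fun _ => (Fp π).ge
    · exact fun h1 => absurd h1 (lt_irrefl _)
    · rw [Fe]
      exact h.2 i
    · rw [Fq]
      exact hpq
  refine (Nat.card_congr (Equiv.ofBijective (fun π => ⟨F π.1, hF π.1 π.2⟩)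
    ⟨fun π σ h => Subtype.ext (funext fun i => e.injective ?_), fun π => ?_⟩)).symm
  · rw [← Fe, ← Fe]
    exact congrFun (congrArg Subtype.val h) (e i)
  · obtain ⟨π, ⟨hπ, hcut⟩, hlt⟩ := π
    have hqp : π q = p := by
      by_contra hne
      have h1 : π q < p := lt_of_le_of_ne (not_lt.1 fun h1 => (hadj _ h1).not_gt hlt) hne
      have h2 : π p ≠ q := fun h2 => hne (by rw [← h2, hπ.invol])
      exact hπ.noncrossing (π q) p ⟨h1, by rwa [hπ.invol], by
        rw [hπ.invol]
        exact lt_of_le_of_ne (hcut p hpq) h2.symm⟩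
    have hpq' : π p = q := by rw [← hqp, hπ.invol]
    have hσ : ∀ i, ∃ i', e i' = π (e i) := fun i => hr _
      (fun h => hq i (by rw [← hπ.invol (e i), h, hpq']))
      fun h => hp i (by rw [← hπ.invol (e i), h, hqp])
    choose σ hσ using hσ
    refine ⟨⟨σ, ⟨fun i => e.injective ?_, fun i h => ?_, fun i => ?_, fun i j => ?_⟩,
      fun i hi => ?_⟩, Subtype.ext (funext (hβ ?_ ?_ fun i => ?_))⟩
    · rw [hσ, hσ, hπ.invol]
    · exact hπ.ne (e i) (by rw [← hσ, h])
    · rw [← hcol, ← hcol, hσ]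
      exact hπ.color _
    · rw [← e.lt_iff_lt, ← e.lt_iff_lt, ← e.lt_iff_lt (a := σ i), hσ, hσ]
      exact hπ.noncrossing _ _
    · rw [hσ]
      exact hcut _ hi
    · exact (Fp σ).trans hpq'.symm
    · exact (Fq σ).trans hqp.symm
    · exact (Fe σ i).trans (hσ i)

theorem cutCard_append_singleton_append (s k : ColoredWord) (a : Bool) :
    cutCard (s ++ [a] ++ k) (s ++ [a]).length = cutCard (s ++ a :: k) (s.length + 1) := by
  rw [List.append_assoc, List.length_append]
  rfl

/-- The letter `a` could only be paired backwards with its left neighbour, and the colors do not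
allow this. Compare with `character_mul_singleton_of_ne`. -/
theorem cutCard_append_cons_of_ne {s : ColoredWord} {a : Bool} (hs : ∀ x, s ≠ x ++ [!a])
    (k : ColoredWord) :
    cutCard (s ++ a :: k) s.length = cutCard (s ++ [a] ++ k) (s ++ [a]).length := by
  rw [cutCard_append_singleton_append]
  let c : Fin (s ++ a :: k).length := ⟨s.length, by simp⟩
  refine (cutCard_eq_add (s ++ a :: k) c).trans ?_
  rw [card_eq_zero_of_color, add_zero]
  intro j hj
  rcases List.eq_nil_or_concat s with rfl | ⟨x, b, rfl⟩
  · simp [c] at hj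
  have hb : b = a := by
    by_contra hb
    exact hs x (by rw [List.concat_eq_append, (Bool.eq_not).2 hb])
  subst hb
  have h1 : j.1 = x.length := by simpa [c] using hj
  simp only [List.get_eq_getElem, h1, c]
  simp

/-- The letter `a` is either not paired backwards, or paired with its left neighbour, and then both
can be deleted. Compare with `character_mul_singleton`. -/
theorem cutCard_append_cons (x : ColoredWord) (a : Bool) (k : ColoredWord) :
    cutCard (x ++ [!a] ++ a :: k) (x ++ [!a]).length =
      cutCard (x ++ [!a] ++ [a] ++ k) (x ++ [!a] ++ [a]).length + cutCard (x ++ k) x.length := by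
  rw [cutCard_append_singleton_append (x ++ [!a])]
  have hl : (x ++ [!a] ++ a :: k).length = (x ++ k).length + 2 := by
    simp only [List.length_append, List.length_cons, List.length_nil]
    omega
  have hx : x.length ≤ (x ++ k).length := by simp
  let c : Fin (x ++ [!a] ++ a :: k).length := ⟨(x ++ [!a]).length, by simp⟩
  have hc : c.1 = x.length + 1 := List.length_append
  refine (cutCard_eq_add _ c).trans (congrArg _ ?_)
  -- The order embedding which skips the two neighbouring positions of the deleted string.
  let f : Fin (x ++ k).length → Fin (x ++ [!a] ++ a :: k).length := fun i =>
    ⟨if i.1 < x.length then i.1 else i.1 + 2, by split_ifs <;> omega⟩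
  have hf : ∀ i, (f i).1 = if i.1 < x.length then i.1 else i.1 + 2 := fun _ => rfl
  have hfm : StrictMono f := fun i j hij => by
    rw [Fin.lt_def] at hij ⊢
    rw [hf, hf]
    split_ifs <;> omega
  let p : Fin (x ++ [!a] ++ a :: k).length := ⟨x.length, by omega⟩
  have hp : p.1 = x.length := rfl
  rw [card_delete (cα := (x ++ k).get) (OrderEmbedding.ofStrictMono f hfm) (p := p) (q := c)]
  · refine Nat.card_congr (Equiv.subtypeEquivRight fun π => and_congr_right fun _ =>
      forall_congr' fun i => ?_)
    simp only [OrderEmbedding.coe_ofStrictMono, Fin.lt_def, Fin.le_def, hf, hc]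
    split_ifs <;> omega
  · rw [Fin.lt_def]
    omega
  · intro i h
    have := congrArg Fin.val h
    simp only [OrderEmbedding.coe_ofStrictMono, hf, hp] at this
    split_ifs at this <;> omega
  · intro i h
    have := congrArg Fin.val h
    simp only [OrderEmbedding.coe_ofStrictMono, hf, hc] at this
    split_ifs at this <;> omega
  · intro j h1 h2
    rw [Ne, Fin.ext_iff] at h1 h2
    have hj := j.2
    rcases lt_or_ge j.1 x.length with h | h
    · refine ⟨⟨j.1, by omega⟩, Fin.ext ?_⟩
      simp [hf, h]
    · refine ⟨⟨j.1 - 2, by omega⟩, Fin.ext ?_⟩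
      simp only [OrderEmbedding.coe_ofStrictMono, hf]
      split_ifs <;> omega
  · intro j h
    rw [Fin.lt_def] at h
    rw [Fin.le_def]
    omega
  · intro i
    refine Option.some_injective _ ?_
    rw [List.get_eq_getElem, List.get_eq_getElem, ← List.getElem?_eq_getElem,
      ← List.getElem?_eq_getElem, OrderEmbedding.coe_ofStrictMono, hf, List.append_assoc]
    split_ifs with h
    · rw [List.getElem?_append_left h, List.getElem?_append_left h]
    · rw [List.getElem?_append_right (l₁ := x) (l₂ := k) (by omega),
        List.getElem?_append_right (l₁ := x) (l₂ := [!a] ++ a :: k) (by omega),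
        show i.1 + 2 - x.length = i.1 - x.length + 2 by omega]
      rfl
  · simp [p, c]

end NoncrossingCount

/-! ### Characters and the circular law -/

section Characters

open scoped Matrix

theorem trace_eq_of_corepEquiv {A : Type u} [CStarAlgebra A] {m n : Type*} [Fintype m] [Fintype n]
    [DecidableEq m] [DecidableEq n] {v : Matrix n n A} {w : Matrix m m A} (h : CorepEquiv v w) :
    v.trace = w.trace := by
  obtain ⟨T, hT, T', h1, h2⟩ := h
  change T.map (algebraMap ℂ A) * v = w * T.map (algebraMap ℂ A) at hT
  have e1 : T.map (algebraMap ℂ A) * T'.map (algebraMap ℂ A) = 1 := by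
    rw [← Matrix.map_mul, h1]
    exact Matrix.map_one _ (map_zero _) (map_one _)
  have e2 : T'.map (algebraMap ℂ A) * T.map (algebraMap ℂ A) = 1 := by
    rw [← Matrix.map_mul, h2]
    exact Matrix.map_one _ (map_zero _) (map_one _)
  -- The trace is not cyclic over a noncommutative algebra, but it is when one of the factors is
  -- scalar.
  have hc : ∀ M : Matrix n m A, (T.map (algebraMap ℂ A) * M).trace =
      (M * T.map (algebraMap ℂ A)).trace := fun M => by
    simp only [Matrix.trace, Matrix.diag_apply, Matrix.mul_apply, Matrix.map_apply,
      Algebra.commutes]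
    exact Finset.sum_comm
  calc v.trace = (v * T'.map (algebraMap ℂ A) * T.map (algebraMap ℂ A)).trace := by
        rw [Matrix.mul_assoc, e2, Matrix.mul_one]
    _ = (w * T.map (algebraMap ℂ A) * T'.map (algebraMap ℂ A)).trace := by
        rw [← hc, ← Matrix.mul_assoc, hT]
    _ = w.trace := by rw [Matrix.mul_assoc, e1, Matrix.mul_one]

theorem trace_corepTensor {A : Type u} [CStarAlgebra A] {m n : Type*} [Fintype m] [Fintype n]
    (v : Matrix m m A) (w : Matrix n n A) : (corepTensor v w).trace = v.trace * w.trace := by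
  simp only [Matrix.trace, Matrix.diag_apply, corepTensor, Matrix.of_apply, Fintype.sum_prod_type,
    Finset.sum_mul_sum]

variable {N : ℕ}

/-- The characters of the irreducible corepresentations. -/
def character (N : ℕ) (k : ColoredWord) : FreeUnitaryAlgebra N := (coordIrrep N k).trace

theorem character_mul (hN : 2 ≤ N) (k l : ColoredWord) : character N k * character N l =
    ∑ t : FusionIndex k l, character N (t.1.1 ++ t.1.2.2) := by
  rw [character, character, ← trace_corepTensor,
    trace_eq_of_corepEquiv (corepEquiv_corepTensor hN k l), corepSum, Matrix.trace_blockDiagonal']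
  rfl

theorem character_nil : character N [] = 1 := by
  rw [character, trace_eq_of_corepEquiv corepEquiv_coordIrrep_nil]
  simp

theorem character_singleton (a : Bool) : character N [a] =
    if a then (freeUnitary N).mainCharacter else star (freeUnitary N).mainCharacter := by
  rw [character, trace_eq_of_corepEquiv (corepEquiv_coordIrrep_singleton a)]
  cases a
  · rw [WoronowiczAlgebra.mainCharacter, star_sum]
    rfl
  · rfl

/-- In the fusion with one letter the middle word has length at most one, and length one would need
`s` to end with the opposite color. -/
theorem character_mul_singleton_of_ne (hN : 2 ≤ N) {s : ColoredWord} {a : Bool}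
    (hs : ∀ x, s ≠ x ++ [!a]) : character N s * character N [a] = character N (s ++ [a]) := by
  rw [character_mul hN]
  have h : ∀ t : FusionIndex s [a], t = ⟨(s, [], [a]), by simp, rfl⟩ := by
    rintro ⟨⟨x, y, z⟩, h1, h2⟩
    match y, h1, h2 with
    | [], h1, h2 =>
      obtain rfl : s = x := by simpa using h1
      obtain rfl : [a] = z := by simpa [conj_nil] using h2
      rfl
    | [b], h1, h2 =>
      simp [conj_cons, conj_nil] at h2
      exact absurd h1 (by simpa [h2.1] using hs x)
    | b :: b' :: y, h1, h2 =>
      have := congrArg List.length h2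
      simp [length_conj] at this
      omega
  rw [Fintype.sum_eq_single ⟨(s, [], [a]), by simp, rfl⟩ fun t ht => absurd (h t) ht]

theorem character_mul_singleton (hN : 2 ≤ N) (x : ColoredWord) (a : Bool) :
    character N (x ++ [!a]) * character N [a] =
      character N (x ++ [!a] ++ [a]) + character N x := by
  rw [character_mul hN]
  have h : ∀ t : FusionIndex (x ++ [!a]) [a], t = ⟨(x ++ [!a], [], [a]), by simp, rfl⟩ ∨
      t = ⟨(x, [!a], []), rfl, by simp [conj_cons, conj_nil]⟩ := by
    rintro ⟨⟨x', y, z⟩, h1, h2⟩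
    match y, h1, h2 with
    | [], h1, h2 =>
      obtain rfl : x ++ [!a] = x' := by simpa using h1
      obtain rfl : [a] = z := by simpa [conj_nil] using h2
      exact Or.inl rfl
    | [b], h1, h2 =>
      obtain ⟨h3, h4⟩ : a = !b ∧ [] = z := by simpa [conj_cons, conj_nil] using h2
      subst h3 h4
      rw [Bool.not_not] at h1
      obtain rfl := List.append_cancel_right h1
      refine Or.inr ?_
      simp
    | b :: b' :: y, h1, h2 =>
      have := congrArg List.length h2
      simp [length_conj] at this
      omega
  rw [Fintype.sum_eq_add ⟨(x ++ [!a], [], [a]), by simp, rfl⟩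
    ⟨(x, [!a], []), rfl, by simp [conj_cons, conj_nil]⟩ (by simp)
    fun t ht => absurd (h t) (not_or.2 ht)]
  simp

/-- By invariance, each column of integrals of entries of `r_s` is a fixed vector, that is, an
intertwiner from the trivial corepresentation. There are none for `s` nonempty. -/
theorem haar_character {h : FreeUnitaryAlgebra N →L[ℂ] ℂ}
    (hh : (freeUnitary N).IsHaar h) (s : ColoredWord) :
    h (character N s) = if s = [] then 1 else 0 := by
  split_ifs with hs
  · rw [hs, character_nil, hh.map_one]
  obtain ⟨E, hE, hE1⟩ := hh.right_invariant
  obtain ⟨S, hS, S', h1, -⟩ := corepEquiv_coordIrrep_nil (N := N)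
  rw [character, Matrix.trace, map_sum]
  refine Finset.sum_eq_zero fun b _ => ?_
  let T : Matrix (Fin (capDim (Fin N) s)) (Fin 1) ℂ := Matrix.of fun a _ => h (coordIrrep N s a b)
  have hT : T ∈ corepHom (1 : Matrix (Fin 1) (Fin 1) (FreeUnitaryAlgebra N)) (coordIrrep N s) := by
    rw [mem_corepHom]
    intro a c
    have h2 := hE1 (coordIrrep N s a b)
    rw [(isCorep_coordIrrep s).comul, map_sum] at h2
    simp only [hE] at h2
    simp only [T, Matrix.of_apply, h2]
    obtain rfl : c = 0 := Subsingleton.elim _ _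
    simp
  have h3 := eq_zero_of_mem_corepHom_coordIrrep (Ne.symm hs) (comp_mem_corepHom hS hT)
  have h4 : T = 0 := by
    rw [← Matrix.mul_one T, ← h1, ← Matrix.mul_assoc, h3, Matrix.zero_mul]
  exact congrFun (congrFun h4 b) 0

theorem coloredPow_cons (a : Bool) (k : ColoredWord) :
    coloredPow (freeUnitary N).mainCharacter (a :: k) =
      character N [a] * coloredPow (freeUnitary N).mainCharacter k := by
  rw [character_singleton, coloredPow, List.map_cons, List.prod_cons]
  rfl

/-- The letters of `k` are absorbed one at a time into the character. On the right, `s` consists of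
the letters already read and still open, hence not paired among themselves; the fusion with one
letter and the count `cutCard` obey the same recursion, with the same end value. -/
theorem haar_character_mul_coloredPow (hN : 2 ≤ N) {h : FreeUnitaryAlgebra N →L[ℂ] ℂ}
    (hh : (freeUnitary N).IsHaar h) (k s : ColoredWord) :
    h (character N s * coloredPow (freeUnitary N).mainCharacter k) =
      cutCard (s ++ k) s.length := by
  induction k generalizing s with
  | nil =>
    rw [coloredPow, List.map_nil, List.prod_nil, mul_one, haar_character hh, List.append_nil,
      cutCard_length]
    split_ifs <;> simp
  | cons a k ih =>
    rw [coloredPow_cons, ← mul_assoc]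
    by_cases hs : ∃ x, s = x ++ [!a]
    · obtain ⟨x, rfl⟩ := hs
      rw [character_mul_singleton hN, add_mul, map_add, ih, ih, cutCard_append_cons, Nat.cast_add]
    · rw [not_exists] at hs
      rw [character_mul_singleton_of_ne hN hs, ih, cutCard_append_cons_of_ne hs]

theorem isCircular_mainCharacter (hN : 2 ≤ N) {h : FreeUnitaryAlgebra N →L[ℂ] ℂ}
    (hh : (freeUnitary N).IsHaar h) : IsCircular h (freeUnitary N).mainCharacter := fun k => by
  rw [card_NCMatchingPairing]
  simpa [character_nil] using haar_character_mul_coloredPow hN hh k []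

end Characters

end FreeUnitary

end

/-! ### Assembly of the theorem -/

theorem theorem6p12 (N : ℕ) (hN : 2 ≤ N) :
    (∃! h : FreeUnitaryAlgebra N →L[ℂ] ℂ, (freeUnitary N).IsHaar h) ∧
    (∀ h : FreeUnitaryAlgebra N →L[ℂ] ℂ, (freeUnitary N).IsHaar h →
      IsCircular h (freeUnitary N).mainCharacter) ∧
    ∃ (d : ColoredWord → ℕ)
      (r : ∀ k : ColoredWord, Matrix (Fin (d k)) (Fin (d k)) (FreeUnitaryAlgebra N)),
      (∀ k, (freeUnitary N).IsCorep (r k) ∧ CorepIrreducible (r k)) ∧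
      (∀ (n : ℕ) (v : Matrix (Fin n) (Fin n) (FreeUnitaryAlgebra N)),
        (freeUnitary N).IsCorep v → CorepIrreducible v → ∃! k, CorepEquiv v (r k)) ∧
      CorepEquiv (r []) (1 : Matrix (Fin 1) (Fin 1) (FreeUnitaryAlgebra N)) ∧
      CorepEquiv (r [true]) (freeUnitary N).u ∧
      CorepEquiv (r [false]) (corepConj (freeUnitary N).u) ∧
      (∀ k, CorepEquiv (corepConj (r k)) (r (ColoredWord.conj k))) ∧
      (∀ k l, CorepEquiv (corepTensor (r k) (r l))
        (corepSum fun t : FusionIndex k l => r (t.1.1 ++ t.1.2.2))) := by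
  obtain ⟨h, hh, -⟩ := FreeUnitary.exists_haar N
  exact ⟨⟨h, hh, fun h' hh' => FreeUnitary.haar_unique hh' hh⟩,
    fun h hh => FreeUnitary.isCircular_mainCharacter hN hh,
    fun k => FreeUnitary.capDim (Fin N) k, FreeUnitary.coordIrrep N,
    fun k => ⟨FreeUnitary.isCorep_coordIrrep k, FreeUnitary.corepIrreducible_coordIrrep hN k⟩,
    fun n v hv hvi => FreeUnitary.existsUnique_corepEquiv hN hv hvi,
    FreeUnitary.corepEquiv_coordIrrep_nil, FreeUnitary.corepEquiv_coordIrrep_singleton true,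
    FreeUnitary.corepEquiv_coordIrrep_singleton false,
    fun k => FreeUnitary.corepEquiv_conj_coordIrrep (FreeUnitary.conj_conj k).symm,
    FreeUnitary.corepEquiv_corepTensor hN⟩
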